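/- Let $N$ be a smooth (Hausdorff, second countable) manifold of dimension $n$, let $1\le k\le n$, and let $\pi:M=\Lambda^kT^*N\to N$ be the multisymplectic phase space. Put $\theta_\mu(Z_1,\dots,Z_k)=\mu(\pi_*Z_1,\dots,\pi_*Z_k)$ for $\mu\in M$, $\omega=-d\theta$, and $\zeta(m)=-(-1)^{m(m+1)/2}$. For a decomposable multivector $X=X_1\wedge\dots\wedge X_l$ write $X\lrcorner\tau=X_l\lrcorner\cdots\lrcorner X_1\lrcorner\tau=\tau(X_1,\dots,X_l,\cdot)$, extended linearly; forms of negative degree are $0$. *Hamiltonian forms.* For $1\le l\le k$, a smooth $(k-l)$-form $\alpha$ on $M$ is Hamiltonian if there is a smooth $l$-vector field $X_\alpha$ on $M$ with $d\alpha=-X_\alpha\lrcorner\omega$. For Hamiltonian $\alpha,\beta$ with $X_\beta$ of degree $l'$, $\{\alpha,\beta\}=(-1)^{l'+1}X_\beta\lrcorner X_\alpha\lrcorner\omega$; this does not depend on the choice of $X_\alpha,X_\beta$. *Multivector fields on $N$.* Let $\mathfrak X=\Gamma(TN)$, a real Lie algebra, and let $\Lambda^l_{\mathbb R}\mathfrak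 X$ be its exterior power over $\mathbb R$ (finite sums of elements $Y_1\wedge\dots\wedge Y_l$, $Y_i\in\mathfrak X$, which also define $l$-vector fields on $N$). Let $$\partial_l(Y_1\wedge\dots\wedge Y_l)=\sum_{i<j}(-1)^{i+j}[Y_i,Y_j]\wedge Y_1\wedge\dots\widehat{Y_i}\dots\widehat{Y_j}\dots\wedge Y_l ,$$ and let the Lie kernel $\mathcal P_l\subset\Lambda^l_{\mathbb R}\mathfrak X$ consist of those $Y$ for which the $(l-1)$-vector field on $N$ defined by $\partial_lY$ vanishes. The Schouten bracket is the bilinear map $\Lambda^s_{\mathbb R}\mathfrak X\times\Lambda^t_{\mathbb R}\mathfrak X\to\Lambda^{s+t-1}_{\mathbb R}\mathfrak X$ with $$[X_1\wedge\dots\wedge X_s,Y_1\wedge\dots\wedge Y_t]=\sum_{i,j}(-1)^{i+j}[X_i,Y_j]\wedge X_1\wedge\dots\widehat{X_i}\dots\wedge X_s\wedge Y_1\wedge\dots\widehat{Y_j}\dots\wedge Y_t .$$ For $Y\in\Lambda^l_{\mathbb R}\mathfrak X$ the momentum form $P(Y)$ is the $(k-l)$-form on $M$ given, for $Y=Y_1\wedge\dots\wedge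 Y_l$ and linearly in general, by $$P(Y)_\mu(Z_1,\dots,Z_{k-l})=-\zeta(l+1)\,\mu(Y_1,\dots,Y_l,\pi_*Z_1,\dots,\pi_*Z_{k-l}).$$ The complete lift $Y^\sharp$ of $Y\in\mathfrak X$ with local flow $\varphi_t$ is the vector field on $M$ with flow $\mu\mapsto(\varphi_t^*)^{-1}\mu$; one sets $(Y_1\wedge\dots\wedge Y_l)^\sharp=Y_1^\sharp\wedge\dots\wedge Y_l^\sharp$ and extends linearly. **Proposition.** 1. For $1\le l\le k$ and $Y\in\mathcal P_l$, the form $P(Y)$ is a Hamiltonian $(k-l)$-form, and $\zeta(l)Y^\sharp$ is a Hamiltonian multivector field for it: $dP(Y)=-\zeta(l)\,Y^\sharp\lrcorner\omega$. 2. For $1\le s,t\le k$, $Y_1\in\mathcal P_s$ and $Y_2\in\mathcal P_t$, $$\{P(Y_1),P(Y_2)\}=-(-1)^{ts+s+t}P([Y_1,Y_2])+(-1)^{t(s+1)}\zeta(s+1)\zeta(t+1)\,d\big(Y_1^\sharp\lrcorner Y_2^\sharp\lrcorner\theta\big).$$ 3. For $1\le i\le k$ and every smooth $(k-i)$-form $\alpha$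 on $N$, the position form $\pi^*\alpha$ is a Hamiltonian $(k-i)$-form. 4. For $1\le i,j\le k$ and smooth forms $\alpha\in\Omega^{k-i}(N)$, $\beta\in\Omega^{k-j}(N)$, one has $\{\pi^*\alpha,\pi^*\beta\}=0$. 5. For $1\le i,j\le k$, a smooth form $\alpha\in\Omega^{k-i}(N)$ and $Y\in\mathcal P_j$, $$\{\pi^*\alpha,P(Y)\}=(-1)^j\zeta(j)\,\pi^*(Y\lrcorner d\alpha).$$ -/

import Mathlib

open Bundle Set
open scoped Manifold ContDiff Topology

noncomputable section

namespace MultiPhase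

section Algebra

variable {R L : Type*} [CommRing R] [LieRing L] [LieAlgebra R L]

local notation "Λ" => ExteriorAlgebra R L

/-- The wedge product `ξ₁ ∧ ⋯ ∧ ξₗ` of a list of elements. -/
def wedge (R : Type*) {L : Type*} [CommRing R] [AddCommGroup L] [Module R L] (l : List L) :
    ExteriorAlgebra R L :=
  (l.map (ExteriorAlgebra.ι R)).prod

@[simp] theorem wedge_nil : wedge R ([] : List L) = 1 := rfl

@[simp] theorem wedge_cons (a : L) (l : List L) :
    wedge R (a :: l) = ExteriorAlgebra.ι R a * wedge R l := by simp [wedge]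

theorem ι_anticomm (a b : L) :
    ExteriorAlgebra.ι R a * ExteriorAlgebra.ι R b =
      -(ExteriorAlgebra.ι R b * ExteriorAlgebra.ι R a) :=
  eq_neg_of_add_eq_zero_left (ExteriorAlgebra.ι_add_mul_swap a b)

theorem ι_anticomm_assoc (a b : L) (x : Λ) :
    ExteriorAlgebra.ι R a * (ExteriorAlgebra.ι R b * x) =
      -(ExteriorAlgebra.ι R b * (ExteriorAlgebra.ι R a * x)) := by
  rw [← mul_assoc, ι_anticomm, neg_mul, mul_assoc]

theorem ι_sq_assoc (a : L) (x : Λ) :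
    ExteriorAlgebra.ι R a * (ExteriorAlgebra.ι R a * x) = 0 := by
  rw [← mul_assoc, ExteriorAlgebra.ι_sq_zero, zero_mul]

/-- Two linear maps on the exterior algebra agree if they agree on wedge products. -/
theorem linearMap_ext_wedge {N : Type*} [AddCommGroup N] [Module R N] {f g : Λ →ₗ[R] N}
    (h : ∀ l : List L, f (wedge R l) = g (wedge R l)) : f = g := by
  refine LinearMap.ext fun x => ?_
  have hx : x ∈ Submodule.span R (Set.range (fun l : List L => wedge R l)) := by
    induction x using CliffordAlgebra.left_induction with
    | algebraMap r =>
      rw [Algebra.algebraMap_eq_smul_one]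
      exact Submodule.smul_mem _ _ (Submodule.subset_span ⟨[], rfl⟩)
    | add x y hx hy => exact Submodule.add_mem _ hx hy
    | ι_mul x m hx =>
      induction hx using Submodule.span_induction with
      | mem x hx =>
        obtain ⟨l, rfl⟩ := hx
        exact Submodule.subset_span ⟨m :: l, wedge_cons m l⟩
      | zero => simp
      | add x y _ _ hx hy => rw [mul_add]; exact Submodule.add_mem _ hx hy
      | smul c x _ hx => rw [mul_smul_comm]; exact Submodule.smul_mem _ _ hx
  induction hx using Submodule.span_induction with
  | mem x hx => obtain ⟨l, rfl⟩ := hx; exact h l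
  | zero => simp
  | add x y _ _ hx hy => simp [hx, hy]
  | smul c x _ hx => simp [hx]

/-- The recursion step `(m, (x, y)) ↦ [ξ, m] ∧ x + m ∧ y` of the adjoint action. -/
def adStep (ξ : L) : L →ₗ[R] (Λ × Λ) →ₗ[R] Λ :=
  LinearMap.mk₂ R
    (fun m p => ExteriorAlgebra.ι R ⁅ξ, m⁆ * p.1 + ExteriorAlgebra.ι R m * p.2)
    (by intro a b p; simp only [lie_add, map_add, add_mul]; abel)
    (by intro c a p; simp [lie_smul])
    (by intro a p q; simp only [Prod.fst_add, Prod.snd_add, mul_add]; abel)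
    (by intro c a p; simp)

theorem adStep_apply (ξ m : L) (x y : Λ) :
    adStep ξ m (x, y) = ExteriorAlgebra.ι R ⁅ξ, m⁆ * x + ExteriorAlgebra.ι R m * y := rfl

theorem adStep_adStep (ξ m : L) (x y : Λ) :
    adStep ξ m (ExteriorAlgebra.ι R m * x, adStep ξ m (x, y)) = (0 : QuadraticForm R L) m • y := by
  rw [adStep_apply, adStep_apply, mul_add, ι_sq_assoc, ι_anticomm_assoc]
  simp

/-- The adjoint action of `ξ` on the exterior algebra: the linear map with `ad_ξ 1 = 0` and
`ad_ξ (m ∧ x) = [ξ, m] ∧ x + m ∧ ad_ξ x`. -/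
def adExt (ξ : L) : Λ →ₗ[R] Λ :=
  CliffordAlgebra.foldr' (0 : QuadraticForm R L) (adStep ξ) (adStep_adStep ξ) 0

@[simp] theorem adExt_one (ξ : L) : adExt (R := R) ξ 1 = 0 := by
  have h := CliffordAlgebra.foldr'_algebraMap (0 : QuadraticForm R L) (adStep ξ)
    (adStep_adStep ξ) 0 1
  rw [map_one, smul_zero] at h
  exact h

@[simp] theorem adExt_ι_mul (ξ m : L) (x : Λ) :
    adExt ξ (ExteriorAlgebra.ι R m * x) =
      ExteriorAlgebra.ι R ⁅ξ, m⁆ * x + ExteriorAlgebra.ι R m * adExt ξ x :=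
  CliffordAlgebra.foldr'_ι_mul (0 : QuadraticForm R L) (adStep ξ) (adStep_adStep ξ) 0 m x

theorem adExt_add (ξ η : L) : adExt (R := R) (ξ + η) = adExt ξ + adExt η := by
  refine linearMap_ext_wedge fun l => ?_
  induction l with
  | nil => simp
  | cons a l ih =>
    rw [LinearMap.add_apply] at ih
    simp only [wedge_cons, adExt_ι_mul, ih, LinearMap.add_apply, add_lie, map_add, add_mul,
      mul_add]
    abel

theorem adExt_smul (c : R) (ξ : L) : adExt (R := R) (c • ξ) = c • adExt ξ := by
  refine linearMap_ext_wedge fun l => ?_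
  induction l with
  | nil => simp
  | cons a l ih =>
    rw [LinearMap.smul_apply] at ih
    simp [ih]

/-- The recursion step `(m, (x, y)) ↦ -(m ∧ y) - ad_m x` of the Chevalley–Eilenberg
differential. -/
def boundaryStep : L →ₗ[R] (Λ × Λ) →ₗ[R] Λ :=
  LinearMap.mk₂ R
    (fun m p => -(ExteriorAlgebra.ι R m * p.2) - adExt m p.1)
    (by intro a b p; simp only [map_add, add_mul, adExt_add, LinearMap.add_apply]; abel)
    (by intro c a p; simp [adExt_smul, smul_sub])
    (by intro a p q; simp only [Prod.fst_add, Prod.snd_add, mul_add, map_add]; abel)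
    (by intro c a p; simp [smul_sub])

theorem boundaryStep_apply (m : L) (x y : Λ) :
    boundaryStep m (x, y) = -(ExteriorAlgebra.ι R m * y) - adExt m x := rfl

theorem boundaryStep_boundaryStep (m : L) (x y : Λ) :
    boundaryStep m (ExteriorAlgebra.ι R m * x, boundaryStep m (x, y)) =
      (0 : QuadraticForm R L) m • y := by
  rw [boundaryStep_apply, boundaryStep_apply, mul_sub, mul_neg, ι_sq_assoc, adExt_ι_mul]
  simp

variable (R L) in
/-- The Chevalley–Eilenberg differential `∂` on the exterior algebra of a Lie algebra. It is
constructed by recursion on the wedge products; `ceBoundary_wedge` is the usual formula. -/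
def ceBoundary : Λ →ₗ[R] Λ :=
  CliffordAlgebra.foldr' (0 : QuadraticForm R L) boundaryStep boundaryStep_boundaryStep 0

@[simp] theorem ceBoundary_one : ceBoundary R L 1 = 0 := by
  have h := CliffordAlgebra.foldr'_algebraMap (0 : QuadraticForm R L) boundaryStep
    boundaryStep_boundaryStep 0 1
  rw [map_one, smul_zero] at h
  exact h

@[simp] theorem ceBoundary_ι_mul (m : L) (x : Λ) :
    ceBoundary R L (ExteriorAlgebra.ι R m * x) =
      -(ExteriorAlgebra.ι R m * ceBoundary R L x) - adExt m x :=
  CliffordAlgebra.foldr'_ι_mul (0 : QuadraticForm R L) boundaryStep boundaryStep_boundaryStep 0 m x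

/-- `ad_ξ (ξ₁ ∧ ⋯ ∧ ξₗ) = ∑ⱼ (-1)ʲ [ξ, ξⱼ] ∧ ξ₁ ∧ ⋯ ξ̂ⱼ ⋯ ∧ ξₗ`, with `j` counted from `0`. -/
theorem adExt_wedge (ξ : L) (l : List L) :
    adExt ξ (wedge R l) = ∑ j : Fin l.length,
      (-1 : R) ^ (j : ℕ) • (ExteriorAlgebra.ι R ⁅ξ, l[j]⁆ * wedge R (l.eraseIdx j)) := by
  induction l with
  | nil => simp
  | cons a l ih =>
    rw [wedge_cons, adExt_ι_mul, ih, Finset.mul_sum]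
    refine Eq.trans ?_ (Fin.sum_univ_succ (n := l.length) _).symm
    congr 1
    · simp
    · refine Finset.sum_congr rfl fun j _ => ?_
      simp [pow_succ, ι_anticomm_assoc a]

/-- The formula for the Chevalley–Eilenberg differential:
`∂ (ξ₁ ∧ ⋯ ∧ ξₗ) = ∑_{i < j} (-1)^(i+j) [ξᵢ, ξⱼ] ∧ ξ₁ ∧ ⋯ ξ̂ᵢ ⋯ ξ̂ⱼ ⋯ ∧ ξₗ`. -/
theorem ceBoundary_wedge (l : List L) :
    ceBoundary R L (wedge R l) = ∑ i : Fin l.length, ∑ j : Fin l.length,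
      if i < j then (-1 : R) ^ ((i : ℕ) + (j : ℕ)) •
        (ExteriorAlgebra.ι R ⁅l[i], l[j]⁆ * wedge R ((l.eraseIdx j).eraseIdx i)) else 0 := by
  induction l with
  | nil => simp
  | cons a l ih =>
    rw [wedge_cons, ceBoundary_ι_mul, ih, adExt_wedge, sub_eq_add_neg, add_comm]
    refine Eq.trans ?_ (Fin.sum_univ_succ (n := l.length) _).symm
    congr 1
    · refine Eq.trans ?_ (Fin.sum_univ_succ (n := l.length) _).symm
      rw [← Finset.sum_neg_distrib]
      simp [pow_succ]
    · rw [Finset.mul_sum, ← Finset.sum_neg_distrib]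
      refine Finset.sum_congr rfl fun i _ => ?_
      refine Eq.trans ?_ (Fin.sum_univ_succ (n := l.length) _).symm
      rw [Finset.mul_sum, ← Finset.sum_neg_distrib]
      simp only [Fin.not_lt_zero, if_false, zero_add]
      refine Finset.sum_congr rfl fun j _ => ?_
      by_cases h : i < j
      · have e : (-1 : R) ^ ((i : ℕ) + 1 + ((j : ℕ) + 1)) = (-1) ^ ((i : ℕ) + (j : ℕ)) := by
          rw [show (i : ℕ) + 1 + ((j : ℕ) + 1) = (i : ℕ) + j + 2 by ring, pow_add]; simp
        simp [h, e, ι_anticomm_assoc a]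
      · simp [h]

/-- The recursion step `(m, (x, y)) ↦ m ∧ y + (-1)^|x| x ∧ ad_m Y` of the Schouten bracket. -/
def schoutenStep (Y : Λ) : L →ₗ[R] (Λ × Λ) →ₗ[R] Λ :=
  LinearMap.mk₂ R
    (fun m p => ExteriorAlgebra.ι R m * p.2 +
      CliffordAlgebra.involute (Q := (0 : QuadraticForm R L)) p.1 * adExt m Y)
    (by intro a b p; simp only [map_add, add_mul, adExt_add, LinearMap.add_apply, mul_add]; abel)
    (by intro c a p; simp [adExt_smul])
    (by intro a p q; simp only [Prod.fst_add, Prod.snd_add, mul_add, map_add, add_mul]; abel)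
    (by intro c a p; simp)

theorem schoutenStep_apply (Y : Λ) (m : L) (x y : Λ) :
    schoutenStep Y m (x, y) = ExteriorAlgebra.ι R m * y +
      CliffordAlgebra.involute (Q := (0 : QuadraticForm R L)) x * adExt m Y := rfl

theorem schoutenStep_schoutenStep (Y : Λ) (m : L) (x y : Λ) :
    schoutenStep Y m (ExteriorAlgebra.ι R m * x, schoutenStep Y m (x, y)) =
      (0 : QuadraticForm R L) m • y := by
  rw [schoutenStep_apply, schoutenStep_apply, mul_add, ι_sq_assoc, map_mul,
    show CliffordAlgebra.involute (Q := (0 : QuadraticForm R L)) (ExteriorAlgebra.ι R m) =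
      -ExteriorAlgebra.ι R m from CliffordAlgebra.involute_ι m]
  simp [mul_assoc]

/-- The Schouten bracket on the exterior algebra of a Lie algebra. It is constructed by recursion
on the first argument; `schouten_wedge` is the usual formula. -/
def schouten (X Y : Λ) : Λ :=
  CliffordAlgebra.foldr' (0 : QuadraticForm R L) (schoutenStep Y) (schoutenStep_schoutenStep Y) 0 X

@[simp] theorem schouten_one (Y : Λ) : schouten 1 Y = 0 := by
  have h := CliffordAlgebra.foldr'_algebraMap (0 : QuadraticForm R L) (schoutenStep Y)
    (schoutenStep_schoutenStep Y) 0 1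
  rw [map_one, smul_zero] at h
  exact h

@[simp] theorem schouten_ι_mul (m : L) (x Y : Λ) :
    schouten (ExteriorAlgebra.ι R m * x) Y = ExteriorAlgebra.ι R m * schouten x Y +
      CliffordAlgebra.involute (Q := (0 : QuadraticForm R L)) x * adExt m Y :=
  CliffordAlgebra.foldr'_ι_mul (0 : QuadraticForm R L) (schoutenStep Y)
    (schoutenStep_schoutenStep Y) 0 m x

theorem involute_wedge (l : List L) :
    CliffordAlgebra.involute (Q := (0 : QuadraticForm R L)) (wedge R l) =
      (-1 : R) ^ l.length • wedge R l := by
  induction l with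
  | nil => simp
  | cons a l ih =>
    rw [wedge_cons, map_mul, ih,
      show CliffordAlgebra.involute (Q := (0 : QuadraticForm R L)) (ExteriorAlgebra.ι R a) =
      -ExteriorAlgebra.ι R a from CliffordAlgebra.involute_ι a]
    simp [pow_succ]

theorem wedge_mul_ι_mul (l : List L) (m : L) (x : Λ) :
    wedge R l * (ExteriorAlgebra.ι R m * x) =
      (-1 : R) ^ l.length • (ExteriorAlgebra.ι R m * (wedge R l * x)) := by
  induction l with
  | nil => simp
  | cons a l ih =>
    rw [wedge_cons, mul_assoc, ih, mul_smul_comm, ι_anticomm_assoc]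
    simp [pow_succ, mul_assoc]

/-- The formula for the Schouten bracket: `[X, Y] = ∑ᵢ ∑ⱼ (-1)^(i+j)
[Xᵢ, Yⱼ] ∧ X₁ ∧ ⋯ X̂ᵢ ⋯ ∧ Xₖ ∧ Y₁ ∧ ⋯ Ŷⱼ ⋯ ∧ Yₗ`
for `X = X₁ ∧ ⋯ ∧ Xₖ` and `Y = Y₁ ∧ ⋯ ∧ Yₗ`. -/
theorem schouten_wedge (X Y : List L) :
    schouten (wedge R X) (wedge R Y) = ∑ i : Fin X.length, ∑ j : Fin Y.length,
      (-1 : R) ^ ((i : ℕ) + (j : ℕ)) • (ExteriorAlgebra.ι R ⁅X[i], Y[j]⁆ *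
        wedge R (X.eraseIdx i) * wedge R (Y.eraseIdx j)) := by
  induction X with
  | nil => simp
  | cons a X ih =>
    rw [wedge_cons, schouten_ι_mul, ih, adExt_wedge, add_comm, involute_wedge]
    refine Eq.trans ?_ (Fin.sum_univ_succ (n := X.length) _).symm
    congr 1
    · rw [Finset.mul_sum]
      refine Finset.sum_congr rfl fun j _ => ?_
      simp only [Algebra.smul_mul_assoc, Algebra.mul_smul_comm, wedge_mul_ι_mul, smul_smul]
      have e : (-1 : R) ^ X.length * (-1) ^ X.length = 1 := by rw [← mul_pow]; simp
      simp [e, mul_assoc]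
    · rw [Finset.mul_sum]
      refine Finset.sum_congr rfl fun i _ => ?_
      rw [Finset.mul_sum]
      refine Finset.sum_congr rfl fun j _ => ?_
      simp [pow_succ, pow_add, mul_assoc, ι_anticomm_assoc a]

end Algebra

section
variable {E F G : Type*} [NormedAddCommGroup E] [NormedSpace ℝ E] [NormedAddCommGroup F]
  [NormedSpace ℝ F] [NormedAddCommGroup G] [NormedSpace ℝ G] {k : ℕ}

/-- Antisymmetrization of continuous multilinear maps, as a continuous linear map. -/
def alternatizationCLM (E G : Type*) [NormedAddCommGroup E] [NormedSpace ℝ E]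
    [NormedAddCommGroup G] [NormedSpace ℝ G] (k : ℕ) :
    ContinuousMultilinearMap ℝ (fun _ : Fin k => E) G →L[ℝ] (E [⋀^Fin k]→L[ℝ] G) :=
  LinearMap.mkContinuous
    { toFun := fun f => ContinuousMultilinearMap.alternatization f
      map_add' := fun f g => map_add _ f g
      map_smul' := fun c f => by
        ext v
        refine (ContinuousMultilinearMap.alternatization_apply_apply _ v).trans ?_
        refine Eq.trans ?_ (congrArg (fun x => c • x)
          (ContinuousMultilinearMap.alternatization_apply_apply f v).symm)
        rw [Finset.smul_sum]
        exact Finset.sum_congr rfl fun σ _ => smul_comm (Equiv.Perm.sign σ) c (f (v ∘ σ)) }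
    (Fintype.card (Equiv.Perm (Fin k)))
    (fun f => by
      refine ContinuousAlternatingMap.opNorm_le_bound _
        (mul_nonneg (Nat.cast_nonneg _) (norm_nonneg _)) fun v => ?_
      simp only [LinearMap.coe_mk, AddHom.coe_mk,
        ContinuousMultilinearMap.alternatization_apply_apply]
      refine (norm_sum_le _ _).trans ?_
      have h : ∀ σ ∈ (Finset.univ : Finset (Equiv.Perm (Fin k))),
          ‖Equiv.Perm.sign σ • f (v ∘ σ)‖ ≤ ‖f‖ * ∏ i, ‖v i‖ := by
        intro σ _
        have h1 : ‖Equiv.Perm.sign σ • f (v ∘ σ)‖ = ‖f (v ∘ σ)‖ := by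
          rcases Int.units_eq_one_or (Equiv.Perm.sign σ) with h | h <;> simp [h]
        rw [h1, ← Equiv.prod_comp σ fun i => ‖v i‖]
        exact f.le_opNorm _
      refine (Finset.sum_le_sum h).trans (le_of_eq ?_)
      rw [Finset.sum_const, nsmul_eq_mul, Finset.card_univ, mul_assoc])

theorem contDiff_compContinuousLinearMapCLM {n : WithTop ℕ∞} :
    ContDiff ℝ n (ContinuousAlternatingMap.compContinuousLinearMapCLM :
      (E →L[ℝ] F) → (F [⋀^Fin k]→L[ℝ] G) →L[ℝ] (E [⋀^Fin k]→L[ℝ] G)) := by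
  have key : (ContinuousAlternatingMap.compContinuousLinearMapCLM :
      (E →L[ℝ] F) → (F [⋀^Fin k]→L[ℝ] G) →L[ℝ] (E [⋀^Fin k]→L[ℝ] G)) = fun g =>
      ((k.factorial : ℝ)⁻¹ • alternatizationCLM E G k).comp
        ((ContinuousMultilinearMap.compContinuousLinearMapContinuousMultilinear ℝ
          (fun _ : Fin k => E) (fun _ => F) G (fun _ => g)).comp
          (ContinuousAlternatingMap.toContinuousMultilinearMapCLM ℝ)) := by
    funext g
    ext f v
    have h : ∀ σ : Equiv.Perm (Fin k), Equiv.Perm.sign σ • f (fun i => g (v (σ i))) =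
        f (fun i => g (v i)) := fun σ => by
      have h1 := f.toAlternatingMap.map_perm (fun i => g (v i)) σ
      have h2 : f (fun i => g (v (σ i))) = Equiv.Perm.sign σ • f (fun i => g (v i)) := h1
      rw [h2, smul_smul, Int.units_mul_self, one_smul]
    have h3 : alternatizationCLM E G k
        ((ContinuousMultilinearMap.compContinuousLinearMapContinuousMultilinear ℝ
          (fun _ : Fin k => E) (fun _ => F) G (fun _ => g)) f.toContinuousMultilinearMap) v =
        k.factorial • f (fun i => g (v i)) := by
      refine (ContinuousMultilinearMap.alternatization_apply_apply _ v).trans ?_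
      refine (Finset.sum_congr rfl fun σ _ => h σ).trans ?_
      rw [Finset.sum_const, Finset.card_univ, Fintype.card_perm, Fintype.card_fin]
    refine Eq.trans ?_ (congrArg (fun x => (k.factorial : ℝ)⁻¹ • x) h3.symm)
    rw [← Nat.cast_smul_eq_nsmul ℝ, smul_smul, inv_mul_cancel₀ (by positivity), one_smul]
    rfl
  rw [key]
  refine contDiff_const.clm_comp (ContDiff.clm_comp ?_ contDiff_const)
  exact (ContinuousMultilinearMap.contDiff _).comp (contDiff_pi.2 fun _ => contDiff_id)

theorem contDiff_compContinuousAlternatingMapCLM {n : WithTop ℕ∞} :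
    ContDiff ℝ n (fun g : F →L[ℝ] G =>
      (ContinuousLinearMap.compContinuousAlternatingMapCLM ℝ E F G (Fin k) g :
        (E [⋀^Fin k]→L[ℝ] F) →L[ℝ] (E [⋀^Fin k]→L[ℝ] G))) :=
  ContinuousLinearMap.contDiff _
end

section Bundle

variable {k : ℕ} {B F₁ F₂ : Type*} {n : WithTop ℕ∞} {E₁ : B → Type*} {E₂ : B → Type*}
  [∀ x, AddCommGroup (E₁ x)] [∀ x, Module ℝ (E₁ x)] [NormedAddCommGroup F₁] [NormedSpace ℝ F₁]
  [TopologicalSpace (TotalSpace F₁ E₁)] [∀ x, TopologicalSpace (E₁ x)] [∀ x, AddCommGroup (E₂ x)]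
  [∀ x, Module ℝ (E₂ x)] [NormedAddCommGroup F₂] [NormedSpace ℝ F₂]
  [TopologicalSpace (TotalSpace F₂ E₂)] [∀ x, TopologicalSpace (E₂ x)]
  {EB : Type*} [NormedAddCommGroup EB] [NormedSpace ℝ EB] {HB : Type*} [TopologicalSpace HB]
  {IB : ModelWithCorners ℝ EB HB} [TopologicalSpace B] [ChartedSpace HB B]
  [FiberBundle F₁ E₁] [VectorBundle ℝ F₁ E₁] [FiberBundle F₂ E₂] [VectorBundle ℝ F₂ E₂]
  [∀ x, IsTopologicalAddGroup (E₂ x)] [∀ x, ContinuousSMul ℝ (E₂ x)]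
  [ContMDiffVectorBundle n F₁ E₁ IB] [ContMDiffVectorBundle n F₂ E₂ IB]

/-- The bundle of alternating maps between two smooth vector bundles is smooth. -/
instance contMDiffVectorBundle_continuousAlternatingMap :
    ContMDiffVectorBundle n (F₁ [⋀^Fin k]→L[ℝ] F₂) (fun b : B => E₁ b [⋀^Fin k]→L[ℝ] E₂ b) IB :=
  have : (Bundle.ContinuousAlternatingMap.vectorPrebundle
      ℝ (Fin k) F₁ E₁ F₂ E₂).IsContMDiff IB n := by
    refine ⟨?_⟩
    rintro _ ⟨e₁, e₂, he₁, he₂, rfl⟩ _ ⟨e₁', e₂', he₁', he₂', rfl⟩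
    refine ⟨Pretrivialization.continuousAlternatingMapCoordChange ℝ (Fin k) e₁ e₁' e₂ e₂', ?_,
      Pretrivialization.continuousAlternatingMapCoordChange_apply⟩
    have h₁ := contMDiffOn_coordChangeL (IB := IB) e₁' e₁ (n := n)
    have h₂ := contMDiffOn_coordChangeL (IB := IB) e₂ e₂' (n := n)
    have hs : e₁.baseSet ∩ e₂.baseSet ∩ (e₁'.baseSet ∩ e₂'.baseSet) ⊆
      e₁'.baseSet ∩ e₁.baseSet := by mfld_set_tac
    have hs' : e₁.baseSet ∩ e₂.baseSet ∩ (e₁'.baseSet ∩ e₂'.baseSet) ⊆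
      e₂.baseSet ∩ e₂'.baseSet := by mfld_set_tac
    have g₁ := (contDiff_compContinuousLinearMapCLM (E := F₁) (F := F₁) (G := F₂) (k := k)
      (n := n)).contMDiff.comp_contMDiffOn (h₁.mono hs)
    have g₂ := (contDiff_compContinuousAlternatingMapCLM (E := F₁) (F := F₂) (G := F₂) (k := k)
      (n := n)).contMDiff.comp_contMDiffOn (h₂.mono hs')
    exact g₂.clm_comp g₁
  (Bundle.ContinuousAlternatingMap.vectorPrebundle
    ℝ (Fin k) F₁ E₁ F₂ E₂).contMDiffVectorBundle IB

end Bundle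

section Forms

variable {V W : Type*} [AddCommGroup V] [Module ℝ V] [TopologicalSpace V]
  [AddCommGroup W] [Module ℝ W] [TopologicalSpace W]

/-- Alternating forms of all degrees on a vector space: the component `α m` is an alternating
`m`-form. A form of degree `p` is one whose components of degree `m ≠ p` vanish. -/
abbrev GradedForms (V : Type*) [AddCommGroup V] [Module ℝ V] [TopologicalSpace V] : Type _ :=
  ∀ m : ℕ, V [⋀^Fin m]→L[ℝ] ℝ

/-- The interior product `(v ⌟ α)(w₁, …, w_m) = α (v, w₁, …, w_m)`; it kills `0`-forms, as
they are not the degree `m + 1` component of `α` for any `m`. -/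
def interior : V →ₗ[ℝ] GradedForms V →ₗ[ℝ] GradedForms V :=
  LinearMap.mk₂ ℝ
    (fun v α m =>
      { (α (m + 1)).toAlternatingMap.curryLeft v with
        cont := (α (m + 1)).cont.comp (continuous_const.finCons continuous_id) })
    (by
      intro v v' α; funext m; ext w
      exact DFunLike.congr_fun (map_add (α (m + 1)).toAlternatingMap.curryLeft v v') w)
    (by
      intro c v α; funext m; ext w
      exact DFunLike.congr_fun (map_smul (α (m + 1)).toAlternatingMap.curryLeft c v) w)
    (fun _ _ _ => rfl)
    (fun _ _ _ => rfl)

@[simp] theorem interior_apply (v : V) (α : GradedForms V) (m : ℕ) (w : Fin m → V) :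
    interior v α m w = α (m + 1) (Fin.cons v w) := rfl

theorem interior_interior (v : V) (α : GradedForms V) : interior v (interior v α) = 0 := by
  funext m
  ext w
  rw [interior_apply, interior_apply]
  exact (α (m + 1 + 1)).map_eq_zero_of_eq _ (i := 0) (j := 1) rfl (by simp)

/-- The contraction of a form by a multivector,
`(X₁ ∧ ⋯ ∧ Xₗ) ⌟ α = Xₗ ⌟ ⋯ ⌟ X₁ ⌟ α = α (X₁, …, Xₗ, …)`. -/
def contract (X : ExteriorAlgebra ℝ V) : GradedForms V →ₗ[ℝ] GradedForms V :=
  (ExteriorAlgebra.lift ℝ (A := (Module.End ℝ (GradedForms V))ᵐᵒᵖ)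
    ⟨(MulOpposite.opLinearEquiv ℝ).toLinearMap ∘ₗ interior, fun v => by
      refine MulOpposite.unop_injective (LinearMap.ext fun α => ?_)
      exact interior_interior v α⟩ X).unop

@[simp] theorem contract_one (α : GradedForms V) : contract (1 : ExteriorAlgebra ℝ V) α = α := by
  simp [contract]

@[simp] theorem contract_ι (v : V) (α : GradedForms V) :
    contract (ExteriorAlgebra.ι ℝ v) α = interior v α := by
  simp [contract]

theorem contract_mul (X Y : ExteriorAlgebra ℝ V) (α : GradedForms V) :
    contract (X * Y) α = contract Y (contract X α) := by
  simp [contract]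

theorem contract_add (X Y : ExteriorAlgebra ℝ V) (α : GradedForms V) :
    contract (X + Y) α = contract X α + contract Y α := by
  simp [contract]

theorem contract_smul (c : ℝ) (X : ExteriorAlgebra ℝ V) (α : GradedForms V) :
    contract (c • X) α = c • contract X α := by
  simp [contract]

/-- The pullback of forms by a linear map. -/
def pullback (f : V →L[ℝ] W) : GradedForms W →ₗ[ℝ] GradedForms V where
  toFun α m := (α m).compContinuousLinearMap f
  map_add' _ _ := rfl
  map_smul' _ _ := rfl

end Forms

section Fields

variable {E H : Type*} [NormedAddCommGroup E] [NormedSpace ℝ E] [TopologicalSpace H]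
  {I : ModelWithCorners ℝ E H} {M : Type*} [TopologicalSpace M] [ChartedSpace H M] [IsManifold I ∞ M]

variable (I M) in
/-- Smooth vector fields. -/
abbrev VF : Type _ := Cₛ^∞⟮I; E, (TangentSpace I : M → Type _)⟯

theorem VF.mdifferentiableAt (X : VF I M) (x : M) :
    MDifferentiableAt I I.tangent (fun y => (X y : TangentBundle I M)) x :=
  X.contMDiff.contMDiffAt.mdifferentiableAt (by simp)

variable [CompleteSpace E]

/-- The Lie bracket of smooth vector fields. -/
instance : Bracket (VF I M) (VF I M) where
  bracket X Y :=
    { toFun := VectorField.mlieBracket I X Y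
      contMDiff_toFun := fun x => by
        have : IsManifold I (((⊤ : ℕ∞) : WithTop ℕ∞) + 1) M := by
          simpa using (inferInstance : IsManifold I ∞ M)
        have : IsManifold I (minSmoothness ℝ 2) M := by
          simpa using (inferInstance : IsManifold I 2 M)
        exact ContMDiffAt.mlieBracket_vectorField (m := ⊤) (n := ⊤) X.contMDiff.contMDiffAt
          Y.contMDiff.contMDiffAt (by simp) }

theorem VF.coe_bracket (X Y : VF I M) : ⇑⁅X, Y⁆ = VectorField.mlieBracket I X Y := rfl

/-- Smooth vector fields form a Lie ring. -/
instance : LieRing (VF I M) where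
  add_lie X Y Z := by
    ext x
    exact VectorField.mlieBracket_add_left (X.mdifferentiableAt x) (Y.mdifferentiableAt x)
  lie_add X Y Z := by
    ext x
    exact VectorField.mlieBracket_add_right (Y.mdifferentiableAt x) (Z.mdifferentiableAt x)
  lie_self X := by
    ext x
    exact congrFun VectorField.mlieBracket_self x
  leibniz_lie X Y Z := by
    have : IsManifold I (minSmoothness ℝ 3) M := by
      simpa using (inferInstance : IsManifold I 3 M)
    have h (X : VF I M) (x : M) : ContMDiffAt I I.tangent (minSmoothness ℝ 2)
        (fun y => (X y : TangentBundle I M)) x := by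
      simpa using X.contMDiff.contMDiffAt.of_le (WithTop.coe_le_coe.2 (le_top : (2 : ℕ∞) ≤ ⊤))
    ext x
    exact VectorField.leibniz_identity_mlieBracket_apply (h X x) (h Y x) (h Z x)

/-- Smooth vector fields form a real Lie algebra. -/
instance : LieAlgebra ℝ (VF I M) where
  lie_smul c X Y := by
    ext x
    exact VectorField.mlieBracket_const_smul_right (Y.mdifferentiableAt x)

/-- The value at a point of an element of the exterior algebra of the real vector space of
vector fields: `(X₁ ∧ ⋯ ∧ Xₗ) x = X₁ x ∧ ⋯ ∧ Xₗ x`. -/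
def evalAt (x : M) : ExteriorAlgebra ℝ (VF I M) →ₐ[ℝ] ExteriorAlgebra ℝ (TangentSpace I x) :=
  ExteriorAlgebra.map
    { toFun := fun X => X x
      map_add' := fun _ _ => rfl
      map_smul' := fun _ _ => rfl }

/-- The Schouten bracket on the exterior algebra of the Lie algebra of vector fields. -/
def schoutenVF (X Y : ExteriorAlgebra ℝ (VF I M)) : ExteriorAlgebra ℝ (VF I M) :=
  schouten X Y

variable (I M) in
/-- The `l`-th Lie kernel: the kernel of the Chevalley–Eilenberg differential `∂`, from the `l`-th
exterior power of the Lie algebra of vector fields to the multivector fields of degree `l - 1`. -/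
def lieKernel (l : ℕ) : Set (ExteriorAlgebra ℝ (VF I M)) :=
  {Y | Y ∈ ⋀[ℝ]^l (VF I M) ∧ ∀ x, evalAt x (ceBoundary ℝ (VF I M) Y) = 0}

end Fields

section Calculus

variable {E H : Type*} [NormedAddCommGroup E] [NormedSpace ℝ E] [TopologicalSpace H]
  {I : ModelWithCorners ℝ E H} {M : Type*} [TopologicalSpace M] [ChartedSpace H M]

variable (I M) in
/-- Fields of alternating forms. -/
abbrev FormField : Type _ := ∀ x : M, GradedForms (TangentSpace I x)

variable (I M) in
/-- Fields of multivectors. -/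
abbrev MultivectorField : Type _ := ∀ x : M, ExteriorAlgebra ℝ (TangentSpace I x)

/-- The contraction `X ⌟ α` of a field of forms by a field of multivectors. -/
def contractField (X : MultivectorField I M) (α : FormField I M) : FormField I M :=
  fun x => contract (X x) (α x)

/-- `α ∈ Ω^p(M)`: the field `α` is homogeneous of degree `p` and is a smooth section of the bundle
of alternating forms. -/
def IsForm [IsManifold I ∞ M] (p : ℕ) (α : FormField I M) : Prop :=
  (∀ x m, m ≠ p → α x m = 0) ∧
    ContMDiff I (I.prod 𝓘(ℝ, E [⋀^Fin p]→L[ℝ] ℝ)) ∞ (fun x =>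
      TotalSpace.mk' (E := fun x : M => TangentSpace I x [⋀^Fin p]→L[ℝ] Bundle.Trivial M ℝ x)
        (E [⋀^Fin p]→L[ℝ] ℝ) x (α x p))

/-- `X ∈ Γ(Λ^l TM)`: near every point, `X` is a finite sum of terms `f · V₁ ∧ ⋯ ∧ Vₗ` with smooth
functions `f` and smooth vector fields `V₁, …, Vₗ`. -/
def IsMultivectorField [IsManifold I ∞ M] (l : ℕ) (X : MultivectorField I M) : Prop :=
  ∀ x₀ : M, ∃ (n : ℕ) (f : Fin n → C^∞⟮I, M; ℝ⟯) (V : Fin n → Fin l → VF I M),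
    ∀ᶠ x in 𝓝 x₀, X x = ∑ a, f a x • ExteriorAlgebra.ιMulti ℝ l (fun j => V a j x)

/-- The exterior derivative of a field of forms on a manifold without boundary, at the point `x`:
the exterior derivative of its representative in the chart at `x`. -/
def extD (α : FormField I M) : FormField I M := fun x m =>
  match m with
  | 0 => 0
  | m + 1 =>
    (extDeriv (fun z : E => ((α ((extChartAt I x).symm z) m).compContinuousLinearMap
        (mfderiv 𝓘(ℝ, E) I (extChartAt I x).symm z) : E [⋀^Fin m]→L[ℝ] ℝ))
      (extChartAt I x x)).compContinuousLinearMap (mfderiv I 𝓘(ℝ, E) (extChartAt I x) x)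

/-- The sign `ζ(k) = -(-1)^(k(k+1)/2)`. -/
def zeta (k : ℕ) : ℝ := -(-1) ^ (k * (k + 1) / 2)

/-- `X` is a Hamiltonian multivector field of degree `l` for `α`, that is `dα = -X ⌟ Ω`. -/
def IsHamiltonianField [IsManifold I ∞ M] (Ω : FormField I M) (l : ℕ) (α : FormField I M)
    (X : MultivectorField I M) : Prop :=
  IsMultivectorField l X ∧ extD α = -contractField X Ω

/-- `α ∈ Ω_Ham^(n-l)(M)`, where `Ω` has degree `n + 1`: `α` is an `(n-l)`-form with a Hamiltonian
multivector field of degree `l`. -/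
def IsHamiltonianForm [IsManifold I ∞ M] (Ω : FormField I M) (n l : ℕ) (α : FormField I M) :
    Prop :=
  IsForm (n - l) α ∧ ∃ X, IsHamiltonianField Ω l α X

open Classical in
/-- A Hamiltonian multivector field of degree `l` for `α` (and `0` if there is none). -/
def hamiltonianField [IsManifold I ∞ M] (Ω : FormField I M) (l : ℕ) (α : FormField I M) :
    MultivectorField I M :=
  if h : ∃ X, IsHamiltonianField Ω l α X then h.choose else 0

theorem hamiltonianField_spec [IsManifold I ∞ M] {Ω : FormField I M} {l : ℕ} {α : FormField I M}
    (h : ∃ X, IsHamiltonianField Ω l α X) :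
    IsHamiltonianField Ω l α (hamiltonianField Ω l α) := by
  rw [hamiltonianField, dif_pos h]
  exact h.choose_spec

/-- The bracket `{α, β} = (-1)^(l+1) X_β ⌟ X_α ⌟ Ω` of Hamiltonian forms `α, β` whose Hamiltonian
multivector fields `X_α, X_β` have degrees `k, l`. It does not depend on the choice of `X_α` and
`X_β`, see `hamBracket_eq`. -/
def hamBracket [IsManifold I ∞ M] (Ω : FormField I M) (k l : ℕ) (α β : FormField I M) :
    FormField I M :=
  (-1 : ℝ) ^ (l + 1) •
    contractField (hamiltonianField Ω l β) (contractField (hamiltonianField Ω k α) Ω)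

theorem IsMultivectorField.mem [IsManifold I ∞ M] {l : ℕ} {X : MultivectorField I M}
    (h : IsMultivectorField l X) (x : M) : X x ∈ ⋀[ℝ]^l (TangentSpace I x) := by
  obtain ⟨n, f, V, hX⟩ := h x
  rw [hX.self_of_nhds]
  refine Submodule.sum_mem _ fun a _ => Submodule.smul_mem _ _ ?_
  rw [← ExteriorAlgebra.ιMulti_span_fixedDegree]
  exact Submodule.subset_span ⟨_, rfl⟩

theorem wedge_mul_wedge {R L : Type*} [CommRing R] [AddCommGroup L] [Module R L] (l m : List L) :
    wedge R l * wedge R m = (-1 : R) ^ (l.length * m.length) • (wedge R m * wedge R l) := by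
  induction l with
  | nil => simp [wedge]
  | cons a l ih =>
    have h : ∀ m : List L, ExteriorAlgebra.ι R a * wedge R m =
        (-1 : R) ^ m.length • (wedge R m * ExteriorAlgebra.ι R a) := fun m => by
      induction m with
      | nil => simp [wedge]
      | cons b m ih' =>
        have e : wedge R (b :: m) = ExteriorAlgebra.ι R b * wedge R m := by simp [wedge]
        have e' : ExteriorAlgebra.ι R a * ExteriorAlgebra.ι R b =
          -(ExteriorAlgebra.ι R b * ExteriorAlgebra.ι R a) :=
          eq_neg_of_add_eq_zero_left (ExteriorAlgebra.ι_add_mul_swap a b)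
        rw [e, ← mul_assoc, e', neg_mul, mul_assoc, ih']
        simp [pow_succ, mul_assoc]
    have e : wedge R (a :: l) = ExteriorAlgebra.ι R a * wedge R l := by simp [wedge]
    rw [e, mul_assoc, ih, mul_smul_comm, ← mul_assoc, h, smul_mul_assoc, smul_smul, mul_assoc,
      ← pow_add, List.length_cons, add_mul, one_mul]

theorem mul_comm_of_mem {V : Type*} [AddCommGroup V] [Module ℝ V] {k l : ℕ}
    {X Y : ExteriorAlgebra ℝ V} (hX : X ∈ ⋀[ℝ]^k V) (hY : Y ∈ ⋀[ℝ]^l V) :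
    X * Y = (-1 : ℝ) ^ (k * l) • (Y * X) := by
  have e : ∀ (n : ℕ) (v : Fin n → V), ExteriorAlgebra.ιMulti ℝ n v = wedge ℝ (List.ofFn v) :=
    fun n v => by rw [ExteriorAlgebra.ιMulti_apply, wedge, List.map_ofFn]; rfl
  rw [← ExteriorAlgebra.ιMulti_span_fixedDegree] at hX hY
  induction hX using Submodule.span_induction with
  | mem X hX =>
    obtain ⟨v, rfl⟩ := hX
    induction hY using Submodule.span_induction with
    | mem Y hY =>
      obtain ⟨w, rfl⟩ := hY
      rw [e, e, wedge_mul_wedge, List.length_ofFn, List.length_ofFn]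
    | zero => simp
    | add Y Y' _ _ h h' => rw [mul_add, h, h', add_mul, smul_add]
    | smul c Y _ h => rw [mul_smul_comm, h, smul_mul_assoc, smul_comm]
  | zero => simp
  | add X X' _ _ h h' => rw [add_mul, h, h', mul_add, smul_add]
  | smul c X _ h => rw [smul_mul_assoc, h, mul_smul_comm, smul_comm]

/-- The bracket can be computed with any Hamiltonian multivector fields. -/
theorem hamBracket_eq [IsManifold I ∞ M] {Ω α β : FormField I M} {k l : ℕ}
    {X Y : MultivectorField I M} (hX : IsHamiltonianField Ω k α X)
    (hY : IsHamiltonianField Ω l β Y) :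
    hamBracket Ω k l α β = (-1 : ℝ) ^ (l + 1) • contractField Y (contractField X Ω) := by
  have hX' := hamiltonianField_spec ⟨X, hX⟩
  have hY' := hamiltonianField_spec ⟨Y, hY⟩
  have e₁ : contractField (hamiltonianField Ω k α) Ω = contractField X Ω :=
    neg_injective (hX'.2.symm.trans hX.2)
  have e₂ : contractField (hamiltonianField Ω l β) Ω = contractField Y Ω :=
    neg_injective (hY'.2.symm.trans hY.2)
  rw [hamBracket, e₁]
  congr 1
  funext x
  have e₃ : contract (hamiltonianField Ω l β x) (Ω x) = contract (Y x) (Ω x) := congrFun e₂ x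
  simp only [contractField]
  rw [← contract_mul, ← contract_mul,
    mul_comm_of_mem (hX.1.mem x) (hY'.1.mem x), mul_comm_of_mem (hX.1.mem x) (hY.1.mem x),
    contract_smul, contract_smul, contract_mul, contract_mul, e₃]

end Calculus

section PhaseSpace

variable {E N : Type*} [NormedAddCommGroup E] [NormedSpace ℝ E] [TopologicalSpace N]
  [ChartedSpace E N] [IsManifold 𝓘(ℝ, E) ∞ N] {k : ℕ}

/-- The multisymplectic phase space `M = Λ^k T*N`: the total space of the bundle of alternating
`k`-forms on the tangent spaces of `N`. A point `μ` has the base point `μ.1` and is the `k`-form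
`μ.2` on the tangent space at `μ.1`. -/
abbrev PhaseSpace (E N : Type*) [NormedAddCommGroup E] [NormedSpace ℝ E] [TopologicalSpace N]
    [ChartedSpace E N] [IsManifold 𝓘(ℝ, E) ∞ N] (k : ℕ) : Type _ :=
  TotalSpace (E [⋀^Fin k]→L[ℝ] ℝ)
    (fun x : N => TangentSpace 𝓘(ℝ, E) x [⋀^Fin k]→L[ℝ] Bundle.Trivial N ℝ x)

/-- The model with corners of the phase space. -/
abbrev phaseModel (E : Type*) [NormedAddCommGroup E] [NormedSpace ℝ E] (k : ℕ) :
    ModelWithCorners ℝ (E × (E [⋀^Fin k]→L[ℝ] ℝ)) (ModelProd E (E [⋀^Fin k]→L[ℝ] ℝ)) :=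
  𝓘(ℝ, E).prod 𝓘(ℝ, E [⋀^Fin k]→L[ℝ] ℝ)

/-- The derivative at `μ` of the projection `π : M → N`. -/
def dproj (μ : PhaseSpace E N k) :
    TangentSpace (phaseModel E k) μ →L[ℝ] TangentSpace 𝓘(ℝ, E) μ.1 :=
  mfderiv (phaseModel E k) 𝓘(ℝ, E) (fun ν : PhaseSpace E N k => ν.1) μ

/-- The point `μ` of the phase space, as a form on the tangent space at its base point. -/
def PhaseSpace.form (μ : PhaseSpace E N k) : GradedForms (TangentSpace 𝓘(ℝ, E) μ.1) :=
  Pi.single k μ.2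

/-- The canonical `k`-form `θ` on the phase space,
`θ_μ (Z₁, …, Z_k) = μ (π_* Z₁, …, π_* Z_k)`. -/
def theta (E N : Type*) [NormedAddCommGroup E] [NormedSpace ℝ E] [TopologicalSpace N]
    [ChartedSpace E N] [IsManifold 𝓘(ℝ, E) ∞ N] (k : ℕ) :
    FormField (phaseModel E k) (PhaseSpace E N k) :=
  fun μ => pullback (dproj μ) μ.form

/-- The canonical `(k+1)`-form `ω = -dθ` on the phase space. -/
def omega (E N : Type*) [NormedAddCommGroup E] [NormedSpace ℝ E] [TopologicalSpace N]
    [ChartedSpace E N] [IsManifold 𝓘(ℝ, E) ∞ N] (k : ℕ) :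
    FormField (phaseModel E k) (PhaseSpace E N k) :=
  -extD (theta E N k)

/-- The position form `π^* α`. -/
def positionForm (k : ℕ) (α : FormField 𝓘(ℝ, E) N) :
    FormField (phaseModel E k) (PhaseSpace E N k) :=
  fun μ => pullback (dproj μ) (α μ.1)

/-- An element of the exterior algebra of the real vector space of vector fields on `N`, as a field
of multivectors on `N`. -/
def toMultivectorField (Y : ExteriorAlgebra ℝ (VF 𝓘(ℝ, E) N)) : MultivectorField 𝓘(ℝ, E) N :=
  fun x => evalAt x Y

/-- The momentum form of `Y` of degree `l`: for `Y = Y₁ ∧ ⋯ ∧ Yₗ`,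
`P(Y)_μ (Z₁, …, Z_{k-l}) = -ζ(l+1) μ (Y₁, …, Yₗ, π_* Z₁, …, π_* Z_{k-l})`. -/
def momentumForm (k l : ℕ) (Y : ExteriorAlgebra ℝ (VF 𝓘(ℝ, E) N)) :
    FormField (phaseModel E k) (PhaseSpace E N k) :=
  fun μ => -(zeta (l + 1)) • pullback (dproj μ) (contract (evalAt μ.1 Y) μ.form)

/-- The derivative at `x`, in the chart at `x`, of the vector field `Y`. -/
def chartDeriv (x : N) (Y : VF 𝓘(ℝ, E) N) : E →L[ℝ] E :=
  fderiv ℝ (fun z : E => (mfderiv 𝓘(ℝ, E) 𝓘(ℝ, E) (extChartAt 𝓘(ℝ, E) x).symm z).inverse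
    (Y ((extChartAt 𝓘(ℝ, E) x).symm z))) (extChartAt 𝓘(ℝ, E) x x)

theorem differentiableAt_chartField [CompleteSpace E] (x : N) (Y : VF 𝓘(ℝ, E) N) :
    DifferentiableAt ℝ
      (fun z : E => (mfderiv 𝓘(ℝ, E) 𝓘(ℝ, E) (extChartAt 𝓘(ℝ, E) x).symm z).inverse
        (Y ((extChartAt 𝓘(ℝ, E) x).symm z))) (extChartAt 𝓘(ℝ, E) x x) := by
  have h := (Y.mdifferentiableAt x).mdifferentiableWithinAt
    (s := univ).differentiableWithinAt_mpullbackWithin_vectorField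
  have e : (extChartAt 𝓘(ℝ, E) x).symm ⁻¹' univ ∩ range 𝓘(ℝ, E) = univ := by simp
  rw [e] at h
  have e' : VectorField.mpullbackWithin 𝓘(ℝ, E) 𝓘(ℝ, E) (extChartAt 𝓘(ℝ, E) x).symm Y
      (range 𝓘(ℝ, E)) = fun z : E =>
        (mfderiv 𝓘(ℝ, E) 𝓘(ℝ, E) (extChartAt 𝓘(ℝ, E) x).symm z).inverse
          (Y ((extChartAt 𝓘(ℝ, E) x).symm z)) := by
    funext z
    rw [VectorField.mpullbackWithin_apply, ModelWithCorners.range_eq_univ, mfderivWithin_univ]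
  have h' := differentiableWithinAt_univ.1 h
  exact e' ▸ h'

variable [CompleteSpace E]

/-- The value at `μ` of the complete lift `Y♯` of a vector field `Y`, the vector field on the phase
space whose flow is `(φ_t^*)⁻¹` if `φ_t` is the flow of `Y`. In the chart at `μ` this is
`Y♯ (q, p) = (Y q, -∑ᵢ p (…, DY vᵢ, …))`; see `hasMFDerivAt_completeLift` for the flow. -/
def completeLiftAt (μ : PhaseSpace E N k) :
    VF 𝓘(ℝ, E) N →ₗ[ℝ] TangentSpace (phaseModel E k) μ where
  toFun Y := ((Y μ.1 : E),
    -ContinuousAlternatingMap.fderivCompContinuousLinearMap (μ.2 : E [⋀^Fin k]→L[ℝ] ℝ)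
      (ContinuousLinearMap.id ℝ E) (chartDeriv μ.1 Y))
  map_add' Y Z := by
    have h : chartDeriv μ.1 (Y + Z) = chartDeriv μ.1 Y + chartDeriv μ.1 Z := by
      refine Eq.trans ?_ (fderiv_add (differentiableAt_chartField μ.1 Y)
        (differentiableAt_chartField μ.1 Z))
      refine congrArg (fun f => fderiv ℝ f _) (funext fun z => ?_)
      exact map_add _ _ _
    rw [h, map_add, neg_add]
    rfl
  map_smul' c Y := by
    have h : chartDeriv μ.1 (c • Y) = c • chartDeriv μ.1 Y := by
      refine Eq.trans ?_ (fderiv_const_smul (differentiableAt_chartField μ.1 Y) c)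
      refine congrArg (fun f => fderiv ℝ f _) (funext fun z => ?_)
      exact map_smul _ _ _
    rw [h, map_smul, ← smul_neg]
    rfl

/-- The complete lift of multivector fields, `(Y₁ ∧ ⋯ ∧ Yₗ)♯ = Y₁♯ ∧ ⋯ ∧ Yₗ♯`. -/
def completeLift (k : ℕ) (Y : ExteriorAlgebra ℝ (VF 𝓘(ℝ, E) N)) :
    MultivectorField (phaseModel E k) (PhaseSpace E N k) :=
  fun μ => ExteriorAlgebra.map (completeLiftAt μ) Y

/-- The derivative at `t = 0` of the pullback of a form by the inverse of the derivative of a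
local flow `Φ_t`. -/
theorem hasDerivAt_comp_inverse_fderiv (Φ : ℝ → E → E) (z₀ : E) (v : E → E) (p : E [⋀^Fin k]→L[ℝ] ℝ)
    (hΦ : ContDiffAt ℝ ∞ (fun q : ℝ × E => Φ q.1 q.2) (0, z₀))
    (h0 : ∀ᶠ z in 𝓝 z₀, Φ 0 z = z)
    (hd : ∀ᶠ z in 𝓝 z₀, HasDerivAt (fun t => Φ t z) (v z) 0) :
    HasDerivAt (fun t => p.compContinuousLinearMap (fderiv ℝ (Φ t) z₀).inverse)
      (-p.fderivCompContinuousLinearMap (ContinuousLinearMap.id ℝ E) (fderiv ℝ v z₀)) 0 := by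
  set F : ℝ × E → E := fun q => Φ q.1 q.2 with hF
  have hdiff : ∀ᶠ q in 𝓝 ((0 : ℝ), z₀), DifferentiableAt ℝ F q :=
    ((hΦ.of_le (m := 1) (by simp)).eventually (by simp)).mono fun q h => h.differentiableAt (by simp)
  have hd1 : DifferentiableAt ℝ (fderiv ℝ F) (0, z₀) :=
    (hΦ.fderiv_right (m := 1) (by norm_cast)).differentiableAt (by simp)
  have hsymm : IsSymmSndFDerivAt ℝ F (0, z₀) := hΦ.isSymmSndFDerivAt
    (by simpa using WithTop.coe_le_coe.2 (le_top : (2 : ℕ∞) ≤ ⊤))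
  -- the partial derivatives
  have hA : ∀ᶠ t in 𝓝 (0 : ℝ), fderiv ℝ (Φ t) z₀ =
      (fderiv ℝ F (t, z₀)).comp (ContinuousLinearMap.inr ℝ ℝ E) := by
    have hc : Filter.Tendsto (fun t : ℝ => (t, z₀)) (𝓝 0) (𝓝 (0, z₀)) :=
      (by fun_prop : Continuous fun t : ℝ => (t, z₀)).tendsto 0
    filter_upwards [hc.eventually hdiff] with t ht
    exact (ht.hasFDerivAt.comp z₀ (hasFDerivAt_prodMk_right t z₀)).fderiv
  have hv : ∀ᶠ z in 𝓝 z₀, v z = fderiv ℝ F (0, z) (1, 0) := by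
    have hc : Filter.Tendsto (fun z : E => ((0 : ℝ), z)) (𝓝 z₀) (𝓝 (0, z₀)) :=
      (by fun_prop : Continuous fun z : E => ((0 : ℝ), z)).tendsto z₀
    filter_upwards [hc.eventually hdiff, hd] with z hz hz'
    have := (hz.hasFDerivAt.comp (0 : ℝ) (hasFDerivAt_prodMk_left (0 : ℝ) z)).hasDerivAt
    exact (hz'.unique this).trans (by simp)
  have hA0 : fderiv ℝ (Φ 0) z₀ = ContinuousLinearMap.id ℝ E := by
    have : Φ 0 =ᶠ[𝓝 z₀] id := h0
    rw [this.fderiv_eq, fderiv_id]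
  have hv' : fderiv ℝ v z₀ = (fderiv ℝ (fderiv ℝ F) (0, z₀) (1, 0)).comp
      (ContinuousLinearMap.inr ℝ ℝ E) := by
    have e : v =ᶠ[𝓝 z₀] fun z => fderiv ℝ F (0, z) (1, 0) := hv
    have h1 := (hd1.hasFDerivAt.comp z₀ (hasFDerivAt_prodMk_right (0 : ℝ) z₀)).clm_apply
      (hasFDerivAt_const ((1 : ℝ), (0 : E)) z₀)
    rw [e.fderiv_eq]
    refine h1.fderiv.trans ?_
    ext w
    simpa using hsymm.eq (0, w) (1, 0)
  have hAd : HasDerivAt (fun t => fderiv ℝ (Φ t) z₀) (fderiv ℝ v z₀) 0 := by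
    have h1 := (hd1.hasFDerivAt.comp (0 : ℝ) (hasFDerivAt_prodMk_left (0 : ℝ) z₀)).hasDerivAt
    have h2 := h1.clm_comp (hasDerivAt_const (0 : ℝ) (ContinuousLinearMap.inr ℝ ℝ E))
    refine HasDerivAt.congr_of_eventuallyEq ?_ hA
    rw [hv']
    simpa using h2
  have hinv : HasDerivAt (fun t => (fderiv ℝ (Φ t) z₀).inverse) (-fderiv ℝ v z₀) 0 := by
    have h1 := hasFDerivAt_ringInverse (𝕜 := ℝ) (R := E →L[ℝ] E) 1
    rw [ContinuousLinearMap.ringInverse_eq_inverse, Units.val_one,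
      show (1 : E →L[ℝ] E) = ContinuousLinearMap.id ℝ E from rfl] at h1
    rw [← hA0] at h1
    have h2 := h1.comp_hasDerivAt (0 : ℝ) hAd
    refine h2.congr_deriv ?_
    rw [neg_apply, ContinuousLinearMap.mulLeftRight_apply, inv_one, Units.val_one, one_mul, mul_one]
  have hp := (ContinuousAlternatingMap.hasStrictFDerivAt_compContinuousLinearMap
    (p, (fderiv ℝ (Φ 0) z₀).inverse)).hasFDerivAt
  have h3 := hp.comp_hasDerivAt (0 : ℝ) ((hasDerivAt_const (0 : ℝ) p).prodMk hinv)
  refine h3.congr_deriv ?_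
  rw [hA0]
  simp
  rfl

set_option maxHeartbeats 400000 in
/-- The complete lift is the velocity of the curves `t ↦ (φ_t^*)⁻¹ μ`, for each smooth local
flow `φ_t` of `Y`. -/
theorem hasMFDerivAt_completeLift (Y : VF 𝓘(ℝ, E) N) (μ : PhaseSpace E N k) (φ : ℝ → N → N)
    (hφ : ContMDiffAt (𝓘(ℝ, ℝ).prod 𝓘(ℝ, E)) 𝓘(ℝ, E) ∞ (fun q : ℝ × N => φ q.1 q.2) (0, μ.1))
    (h0 : ∀ᶠ y in 𝓝 μ.1, φ 0 y = y)
    (hd : ∀ᶠ y in 𝓝 μ.1, HasMFDerivAt 𝓘(ℝ, ℝ) 𝓘(ℝ, E) (fun t => φ t y) 0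
      ((ContinuousLinearMap.id ℝ ℝ).smulRight (Y (φ 0 y)))) :
    let γ : ℝ → PhaseSpace E N k := fun t => ⟨φ t μ.1, (μ.2 : E [⋀^Fin k]→L[ℝ] ℝ)
      |>.compContinuousLinearMap (mfderiv 𝓘(ℝ, E) 𝓘(ℝ, E) (φ t) μ.1).inverse⟩
    γ 0 = μ ∧ HasMFDerivAt 𝓘(ℝ, ℝ) (phaseModel E k) γ 0
      ((ContinuousLinearMap.id ℝ ℝ).smulRight (completeLiftAt (γ 0) Y)) := by
  intro γ
  obtain ⟨x, p⟩ := μ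
  let p' : E [⋀^Fin k]→L[ℝ] ℝ := p
  change ContMDiffAt _ _ _ _ (0, x) at hφ
  change ∀ᶠ y in 𝓝 x, _ at h0
  change ∀ᶠ y in 𝓝 x, _ at hd
  let J : ℝ → E →L[ℝ] E := fun t => mfderiv 𝓘(ℝ, E) 𝓘(ℝ, E) (φ t) x
  have hJ0 : J 0 = ContinuousLinearMap.id ℝ E := by
    have e : φ 0 =ᶠ[𝓝 x] id := h0
    exact e.mfderiv_eq.trans mfderiv_id
  let mk (y : N) (q : E [⋀^Fin k]→L[ℝ] ℝ) : PhaseSpace E N k := ⟨y, q⟩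
  have hγ : γ = fun t => mk (φ t x) (p'.compContinuousLinearMap (J t).inverse) := rfl
  have hγ0 : γ 0 = mk x p' := by
    rw [hγ]
    show mk (φ 0 x) (p'.compContinuousLinearMap (J 0).inverse) = mk x p'
    rw [hJ0, h0.self_of_nhds, ContinuousLinearMap.inverse_id]
    rfl
  refine ⟨hγ0, ?_⟩
  let c := extChartAt 𝓘(ℝ, E) x
  let Φ : ℝ → E → E := fun t z => c (φ t (c.symm z))
  let v : E → E := fun z => (mfderiv 𝓘(ℝ, E) 𝓘(ℝ, E) c.symm z).inverse (Y (c.symm z))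
  have hcx : c.symm (c x) = x := extChartAt_to_inv x
  have hx : φ 0 x = x := h0.self_of_nhds
  have hsrc : c.source ∈ 𝓝 x := extChartAt_source_mem_nhds x
  have htgt : c.target ∈ 𝓝 (c x) := extChartAt_target_mem_nhds x
  have hcs : ContinuousAt c.symm (c x) := continuousAt_extChartAt_symm x
  have hcs' : Filter.Tendsto c.symm (𝓝 (c x)) (𝓝 x) := by
    have := hcs.tendsto
    rwa [hcx] at this
  have hrange : range 𝓘(ℝ, E) = univ := ModelWithCorners.range_eq_univ _
  have hΦ : ContDiffAt ℝ ∞ (fun q : ℝ × E => Φ q.1 q.2) (0, c x) := by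
    rw [← contMDiffAt_iff_contDiffAt]
    have a1 : ContMDiffAt 𝓘(ℝ, E) 𝓘(ℝ, E) ∞ c.symm (c x) := by
      have := contMDiffWithinAt_extChartAt_symm_range (I := 𝓘(ℝ, E)) (n := ∞) x
        (mem_extChartAt_target x)
      rw [hrange] at this
      exact this.contMDiffAt Filter.univ_mem
    have a2 : ContMDiffAt 𝓘(ℝ, ℝ × E) (𝓘(ℝ, ℝ).prod 𝓘(ℝ, E)) ∞
        (fun q : ℝ × E => (q.1, c.symm q.2)) (0, c x) :=
      contDiff_fst.contMDiff.contMDiffAt.prodMk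
        (ContMDiffAt.comp (0, c x) a1 contDiff_snd.contMDiff.contMDiffAt)
    have a3 : ContMDiffAt (𝓘(ℝ, ℝ).prod 𝓘(ℝ, E)) 𝓘(ℝ, E) ∞ (fun q : ℝ × N => c (φ q.1 q.2))
        (0, x) := by
      refine ContMDiffAt.comp (0, x) ?_ hφ
      show ContMDiffAt _ _ _ _ (φ 0 x)
      rw [hx]
      exact contMDiffAt_extChartAt
    have a4 : ContMDiffAt (𝓘(ℝ, ℝ).prod 𝓘(ℝ, E)) 𝓘(ℝ, E) ∞ (fun q : ℝ × N => c (φ q.1 q.2))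
        ((0 : ℝ), c.symm (c x)) := by rw [hcx]; exact a3
    exact ContMDiffAt.comp (g := fun q : ℝ × N => c (φ q.1 q.2))
      (f := fun q : ℝ × E => (q.1, c.symm q.2)) ((0 : ℝ), c x) a4 a2
  have hΦ0 : ∀ᶠ z in 𝓝 (c x), Φ 0 z = z := by
    filter_upwards [hcs'.eventually h0, htgt] with z hz hz'
    show c (φ 0 (c.symm z)) = z
    rw [hz, c.right_inv hz']
  have hΦd : ∀ᶠ z in 𝓝 (c x), HasDerivAt (fun t => Φ t z) (v z) 0 := by
    filter_upwards [hcs'.eventually h0, hcs'.eventually hd, htgt] with z hz hz' hzt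
    have b1 : MDifferentiableAt 𝓘(ℝ, E) 𝓘(ℝ, E) c (φ 0 (c.symm z)) := by
      rw [hz]
      exact mdifferentiableAt_extChartAt (by simpa [c] using c.map_target hzt)
    have b2 := b1.hasMFDerivAt.comp (0 : ℝ) hz'
    obtain ⟨A, hA⟩ : ∃ A : E →L[ℝ] E, A = mfderiv 𝓘(ℝ, E) 𝓘(ℝ, E) c (φ 0 (c.symm z)) :=
      ⟨_, rfl⟩
    obtain ⟨w, hw⟩ : ∃ w : E, w = Y (φ 0 (c.symm z)) := ⟨_, rfl⟩
    have b3 : HasFDerivAt (fun t => Φ t z) (A.comp ((ContinuousLinearMap.id ℝ ℝ).smulRight w)) 0 := by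
      rw [hA, hw]
      exact hasMFDerivAt_iff_hasFDerivAt.1 b2
    have b4 : HasDerivAt (fun t => Φ t z) (A w) 0 := by
      have := b3.hasDerivAt
      simpa using this
    refine b4.congr_deriv ?_
    rw [hA, hw, hz]
    have b5 : (mfderiv 𝓘(ℝ, E) 𝓘(ℝ, E) c.symm z).inverse =
        mfderiv 𝓘(ℝ, E) 𝓘(ℝ, E) c (c.symm z) := by
      have d1 := mfderiv_extChartAt_comp_mfderivWithin_extChartAt_symm (I := 𝓘(ℝ, E)) hzt
      have d2 := mfderivWithin_extChartAt_symm_comp_mfderiv_extChartAt (I := 𝓘(ℝ, E)) hzt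
      rw [hrange, mfderivWithin_univ] at d1 d2
      exact ContinuousLinearMap.inverse_eq d2 d1
    show _ = (mfderiv 𝓘(ℝ, E) 𝓘(ℝ, E) c.symm z).inverse (Y (c.symm z))
    rw [b5]
    rfl
  have key := hasDerivAt_comp_inverse_fderiv Φ (c x) v p' hΦ hΦ0 hΦd
  let S : N → E →L[ℝ] E := fun y =>
    (trivializationAt E (TangentSpace 𝓘(ℝ, E) : N → Type _) x).symmL ℝ y
  have hchart : ∀ (y : N) (q : E [⋀^Fin k]→L[ℝ] ℝ),
      extChartAt (phaseModel E k) (mk x p') (mk y q) = (c y, q.compContinuousLinearMap (S y)) := by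
    intro y q
    rw [FiberBundle.extChartAt]
    refine Prod.ext rfl ?_
    show (trivializationAt (E [⋀^Fin k]→L[ℝ] ℝ) (fun x : N => TangentSpace 𝓘(ℝ, E) x [⋀^Fin k]→L[ℝ]
      Bundle.Trivial N ℝ x) x (mk y q)).2 = _
    rw [FiberBundle.trivializationAt_continuousAlternatingMap_apply]
    ext w
    simp [ContinuousAlternatingMap.inCoordinates]
    rfl
  have hφx : ContinuousAt (fun t => φ t x) 0 :=
    ContinuousAt.comp (g := fun q : ℝ × N => φ q.1 q.2) (f := fun t : ℝ => (t, x)) hφ.continuousAt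
      (by fun_prop)
  have hφs : ∀ᶠ t in 𝓝 (0 : ℝ), φ t x ∈ c.source :=
    hφx.eventually (by show c.source ∈ 𝓝 (φ 0 x); rw [hx]; exact hsrc)
  have hφd : ∀ᶠ t in 𝓝 (0 : ℝ), MDifferentiableAt 𝓘(ℝ, E) 𝓘(ℝ, E) (φ t) x := by
    have h1 := (contMDiffAt_iff_contMDiffAt_nhds (n := 1) (by simp)).1
      (hφ.of_le (m := 1) (by simp))
    have hc : Filter.Tendsto (fun t : ℝ => (t, x)) (𝓝 0) (𝓝 (0, x)) :=
      (by fun_prop : Continuous fun t : ℝ => (t, x)).tendsto 0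
    filter_upwards [hc.eventually h1] with t ht
    have h2 := ht.mdifferentiableAt one_ne_zero
    exact MDifferentiableAt.comp (g := fun q : ℝ × N => φ q.1 q.2) (f := fun y : N => (t, y)) x h2
      (mdifferentiableAt_const.prodMk mdifferentiableAt_id)
  have hsymm : mfderiv 𝓘(ℝ, E) 𝓘(ℝ, E) c.symm (c x) = ContinuousLinearMap.id ℝ E := by
    have h1 := mfderivWithin_range_extChartAt_symm (I := 𝓘(ℝ, E)) (x := x)
    rwa [hrange, mfderivWithin_univ] at h1
  have hsymmd : MDifferentiableAt 𝓘(ℝ, E) 𝓘(ℝ, E) c.symm (c x) := by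
    have h1 := mdifferentiableWithinAt_extChartAt_symm (I := 𝓘(ℝ, E)) (mem_extChartAt_target x)
    rwa [hrange, mdifferentiableWithinAt_univ] at h1
  have hJ : ∀ᶠ t in 𝓝 (0 : ℝ), (J t).inverse.comp (S (φ t x)) =
      (fderiv ℝ (Φ t) (c x)).inverse := by
    filter_upwards [hφs, hφd] with t ht ht'
    have ht'' : φ t x ∈ (chartAt E x).source := by simpa [c] using ht
    obtain ⟨A, hA⟩ : ∃ A : E →L[ℝ] E, A = mfderiv 𝓘(ℝ, E) 𝓘(ℝ, E) c (φ t x) := ⟨_, rfl⟩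
    have e1 : A.comp (S (φ t x)) = ContinuousLinearMap.id ℝ E ∧
        (S (φ t x)).comp A = ContinuousLinearMap.id ℝ E := by
      have hS : S (φ t x) = mfderivWithin 𝓘(ℝ, E) 𝓘(ℝ, E) c.symm (range 𝓘(ℝ, E)) (c (φ t x)) :=
        TangentBundle.symmL_trivializationAt ht''
      rw [hS, hA]
      exact ⟨mfderiv_extChartAt_comp_mfderivWithin_extChartAt_symm' ht,
        mfderivWithin_extChartAt_symm_comp_mfderiv_extChartAt' ht⟩
    have e2 : HasMFDerivAt 𝓘(ℝ, E) 𝓘(ℝ, E) (fun y => c (φ t y)) x (A.comp (J t)) := by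
      rw [hA]
      exact (mdifferentiableAt_extChartAt ht'').hasMFDerivAt.comp x ht'.hasMFDerivAt
    have e3 : HasMFDerivAt 𝓘(ℝ, E) 𝓘(ℝ, E) (fun y => c (φ t y)) (c.symm (c x)) (A.comp (J t)) := by
      rw [hcx]
      exact e2
    have e4 : HasMFDerivAt 𝓘(ℝ, E) 𝓘(ℝ, E) c.symm (c x) (ContinuousLinearMap.id ℝ E) := by
      rw [← hsymm]
      exact hsymmd.hasMFDerivAt
    have e5 : HasFDerivAt (Φ t) ((A.comp (J t)).comp (ContinuousLinearMap.id ℝ E)) (c x) :=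
      hasMFDerivAt_iff_hasFDerivAt.1 (e3.comp (c x) e4)
    rw [e5.fderiv, ContinuousLinearMap.comp_id,
      (ContinuousLinearMap.IsInvertible.of_inverse e1.1 e1.2).inverse_comp_of_left,
      ContinuousLinearMap.inverse_eq e1.1 e1.2]
  have hΦx : HasDerivAt (fun t => Φ t (c x)) (Y x : E) 0 := by
    refine hΦd.self_of_nhds.congr_deriv ?_
    show (mfderiv 𝓘(ℝ, E) 𝓘(ℝ, E) c.symm (c x)).inverse (Y (c.symm (c x))) = Y x
    refine Eq.trans (congrArg (fun A : E →L[ℝ] E => A.inverse (Y (c.symm (c x)) : E)) hsymm) ?_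
    refine Eq.trans (congrArg (fun A : E →L[ℝ] E => A (Y (c.symm (c x)) : E))
      ContinuousLinearMap.inverse_id) ?_
    exact congrArg (fun y => (Y y : E)) hcx
  have hcγ : (fun t => extChartAt (phaseModel E k) (mk x p') (γ t)) =ᶠ[𝓝 0]
      fun t => (Φ t (c x), p'.compContinuousLinearMap (fderiv ℝ (Φ t) (c x)).inverse) := by
    filter_upwards [hJ] with t ht
    refine (hchart (φ t x) (p'.compContinuousLinearMap (J t).inverse)).trans ?_
    rw [← ht]
    refine Prod.ext ?_ rfl
    show c (φ t x) = c (φ t (c.symm (c x)))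
    rw [hcx]
  have hder : HasDerivAt (fun t => extChartAt (phaseModel E k) (mk x p') (γ t))
      (completeLiftAt (mk x p') Y : E × (E [⋀^Fin k]→L[ℝ] ℝ)) 0 :=
    (hΦx.prodMk key).congr_of_eventuallyEq hcγ
  have hcont : ContinuousAt γ 0 := by
    have h1 : ContinuousAt (extChartAt (phaseModel E k) (mk x p')).symm
        (extChartAt (phaseModel E k) (mk x p') (γ 0)) := by
      rw [hγ0]
      exact continuousAt_extChartAt_symm _
    refine (ContinuousAt.comp (f := fun t => extChartAt (phaseModel E k) (mk x p') (γ t)) h1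
      hder.continuousAt).congr ?_
    filter_upwards [hφs] with t ht
    refine (extChartAt (phaseModel E k) (mk x p')).left_inv ?_
    have ht' : φ t x ∈ (chartAt E x).source := by simpa [c] using ht
    rw [extChartAt_source, FiberBundle.chartedSpace_chartAt]
    simp only [mfld_simps]
    exact ⟨⟨ht', mem_univ _⟩, ht'⟩
  refine ⟨hcont, ?_⟩
  have hfin : ∀ ν : PhaseSpace E N k, ν = mk x p' →
      HasFDerivAt (fun t => extChartAt (phaseModel E k) ν (γ t))
        ((ContinuousLinearMap.id ℝ ℝ).smulRight
          (completeLiftAt ν Y : E × (E [⋀^Fin k]→L[ℝ] ℝ))) 0 := by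
    rintro _ rfl
    exact hder.hasFDerivAt
  exact (hfin _ hγ0).hasFDerivWithinAt

end PhaseSpace

end MultiPhase

end

/-!
The momentum forms rest on the Cartan-type formula `d(Y ⌟ θ) = (ε Y)^♯ ⌟ dθ + (∂ ε Y) ⌟ θ`, where
`ε` is the grading involution of the exterior algebra and `∂` the Chevalley–Eilenberg boundary. It
follows by induction on the wedge product from Cartan's formula and the invariance of `θ` under
complete lifts, and only the 1-jets of the vector fields at a point enter, so it can be verified in
a chart, where the phase space is `E × Λᵏ E*`. The boundary term vanishes on the Lie kernel. The
Schouten bracket is the defect of `∂` from being a derivation of the wedge product, so that the same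
formula for `Y₁ ∧ Y₂` computes the bracket of two momentum forms.

For a position form `π^* α` one has to solve `X ⌟ dθ = π^* γ` with `γ = dα`. A vertical field `η^v`
satisfies `η^v ⌟ dθ = π^* η`, so `η^v ∧ Y^♯` solves it for `γ = Y ⌟ η`. Locally every form of degree
`p ≤ k ≤ dim N` is a sum of such contractions, since `(dim N - p) γ = ∑ₐ bₐ ⌟ (bᵃ ∧ γ)` in a local
frame `b` with dual coframe `bᵃ`; a partition of unity on `N` glues the local solutions. The
vertical factors make `X` annihilate all pulled back forms, hence position forms commute.
-/

noncomputable section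

namespace MultiPhase

section Exterior

variable {R L : Type*} [CommRing R] [AddCommGroup L] [Module R L]

@[elab_as_elim]
theorem exteriorAlgebra_left_induction {P : ExteriorAlgebra R L → Prop} (one : P 1)
    (smul : ∀ (r : R) x, P x → P (r • x)) (add : ∀ x y, P x → P y → P (x + y))
    (ι_mul : ∀ m x, P x → P (ExteriorAlgebra.ι R m * x)) (x : ExteriorAlgebra R L) : P x :=
  CliffordAlgebra.left_induction (0 : QuadraticForm R L)
    (fun r => by rw [Algebra.algebraMap_eq_smul_one]; exact smul r 1 one) add
    (fun x m hx => ι_mul m x hx) x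

@[elab_as_elim]
theorem exteriorAlgebra_right_induction {P : ExteriorAlgebra R L → Prop} (one : P 1)
    (smul : ∀ (r : R) x, P x → P (r • x)) (add : ∀ x y, P x → P y → P (x + y))
    (mul_ι : ∀ x m, P x → P (x * ExteriorAlgebra.ι R m)) (x : ExteriorAlgebra R L) : P x :=
  CliffordAlgebra.right_induction (0 : QuadraticForm R L)
    (fun r => by rw [Algebra.algebraMap_eq_smul_one]; exact smul r 1 one) add
    (fun m x hx => mul_ι x m hx) x

/-- The grading involution `x ↦ (-1)ˡ x`, `x ∈ ⋀ˡ L`, of the exterior algebra. -/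
def gradeInvolution (R : Type*) {L : Type*} [CommRing R] [AddCommGroup L] [Module R L] :
    ExteriorAlgebra R L →ₐ[R] ExteriorAlgebra R L :=
  CliffordAlgebra.involute (Q := (0 : QuadraticForm R L))

@[simp] theorem gradeInvolution_ι (m : L) :
    gradeInvolution R (ExteriorAlgebra.ι R m) = -ExteriorAlgebra.ι R m :=
  CliffordAlgebra.involute_ι m

@[simp] theorem gradeInvolution_gradeInvolution (x : ExteriorAlgebra R L) :
    gradeInvolution R (gradeInvolution R x) = x :=
  CliffordAlgebra.involute_involute x

theorem gradeInvolution_eq_smul {l : ℕ} {x : ExteriorAlgebra R L} (hx : x ∈ ⋀[R]^l L) :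
    gradeInvolution R x = (-1 : R) ^ l • x := by
  induction hx using Submodule.pow_induction_on_left' with
  | algebraMap r => simp
  | add x y i _ _ hx hy => rw [map_add, hx, hy, smul_add]
  | mem_mul m hm i x _ hx =>
    obtain ⟨v, rfl⟩ := hm
    rw [map_mul, hx, gradeInvolution_ι, neg_mul, mul_smul_comm, pow_succ', neg_one_mul, neg_smul]

theorem ι_mul_gradeInvolution (m : L) (x : ExteriorAlgebra R L) :
    ExteriorAlgebra.ι R m * gradeInvolution R x = x * ExteriorAlgebra.ι R m := by
  induction x using exteriorAlgebra_right_induction with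
  | one => simp
  | smul r x hx => rw [map_smul, mul_smul_comm, hx, smul_mul_assoc]
  | add x y hx hy => rw [map_add, mul_add, hx, hy, add_mul]
  | mul_ι x a hx =>
    rw [map_mul, gradeInvolution_ι, ← mul_assoc, hx, mul_assoc, mul_assoc, mul_neg,
      eq_neg_of_add_eq_zero_left (ExteriorAlgebra.ι_add_mul_swap m a), neg_neg]

theorem exteriorAlgebra_map_mem_exteriorPower {L' : Type*} [AddCommGroup L'] [Module R L']
    (f : L →ₗ[R] L') {l : ℕ} {x : ExteriorAlgebra R L} (hx : x ∈ ⋀[R]^l L) :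
    ExteriorAlgebra.map f x ∈ ⋀[R]^l L' := by
  have h := Submodule.mem_map_of_mem (f := (ExteriorAlgebra.map f).toLinearMap) hx
  rw [Submodule.map_pow, ExteriorAlgebra.ι_range_map_map] at h
  exact pow_le_pow_left' LinearMap.map_le_range l h

end Exterior

section LieAlgebra

variable {R L : Type*} [CommRing R] [LieRing L] [LieAlgebra R L]

theorem adExt_mul (ξ : L) (x y : ExteriorAlgebra R L) :
    adExt ξ (x * y) = adExt ξ x * y + x * adExt ξ y := by
  induction x using exteriorAlgebra_left_induction with
  | one => simp
  | smul r x hx => simp only [smul_mul_assoc, map_smul, hx, smul_add]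
  | add x z hx hz => rw [add_mul, map_add, hx, hz, map_add, add_mul, add_mul]; abel
  | ι_mul m x hx => simp only [mul_assoc, adExt_ι_mul, hx, mul_add, add_mul, add_assoc]

@[simp] theorem adExt_ι (ξ m : L) :
    adExt ξ (ExteriorAlgebra.ι R m) = ExteriorAlgebra.ι R ⁅ξ, m⁆ := by
  simpa using adExt_ι_mul (R := R) ξ m 1

theorem schouten_add_left (X X' Y : ExteriorAlgebra R L) :
    schouten (X + X') Y = schouten X Y + schouten X' Y := by
  simp [schouten]

theorem schouten_smul_left (c : R) (X Y : ExteriorAlgebra R L) :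
    schouten (c • X) Y = c • schouten X Y := by
  simp [schouten]

theorem ceBoundary_mul (x y : ExteriorAlgebra R L) :
    ceBoundary R L (x * y) = ceBoundary R L x * y + gradeInvolution R x * ceBoundary R L y +
      schouten (gradeInvolution R x) y := by
  induction x using exteriorAlgebra_left_induction with
  | one => simp
  | smul r x hx => simp only [smul_mul_assoc, map_smul, hx, smul_add, schouten_smul_left]
  | add x z hx hz =>
    simp only [add_mul, map_add, hx, hz, schouten_add_left]
    abel
  | ι_mul m x hx =>
    have h_schouten : schouten (gradeInvolution R (ExteriorAlgebra.ι R m * x)) y =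
        -(ExteriorAlgebra.ι R m * schouten (gradeInvolution R x) y) - x * adExt m y := by
      rw [map_mul, gradeInvolution_ι, neg_mul, ← neg_one_smul R, schouten_smul_left,
        schouten_ι_mul, neg_one_smul, neg_add, ← sub_eq_add_neg]
      congr 2
      exact gradeInvolution_gradeInvolution x
    rw [h_schouten]
    simp only [mul_assoc, ceBoundary_ι_mul, map_mul, gradeInvolution_ι, neg_mul, hx, adExt_mul,
      mul_add, sub_mul]
    abel

theorem ceBoundary_mul_ι (x : ExteriorAlgebra R L) (m : L) :
    ceBoundary R L (x * ExteriorAlgebra.ι R m) =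
      ceBoundary R L x * ExteriorAlgebra.ι R m - adExt m (gradeInvolution R x) := by
  induction x using exteriorAlgebra_left_induction with
  | one => simpa using ceBoundary_ι_mul (R := R) m 1
  | smul r x hx => simp only [smul_mul_assoc, map_smul, hx, smul_sub]
  | add x z hx hz =>
    simp only [add_mul, map_add, hx, hz]
    abel
  | ι_mul a x hx =>
    have h_skew : ExteriorAlgebra.ι R ⁅m, a⁆ = -ExteriorAlgebra.ι R ⁅a, m⁆ := by
      rw [← lie_skew, map_neg]
    simp only [mul_assoc, ceBoundary_ι_mul, map_mul, gradeInvolution_ι, neg_mul, hx, adExt_mul,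
      sub_mul, mul_sub, map_neg, adExt_ι, h_skew, ← ι_mul_gradeInvolution ⁅a, m⁆]
    abel

end LieAlgebra

section LinearForms

variable {V W : Type*} [AddCommGroup V] [Module ℝ V] [TopologicalSpace V]
  [AddCommGroup W] [Module ℝ W] [TopologicalSpace W]

theorem contract_zero (α : GradedForms V) : contract (0 : ExteriorAlgebra ℝ V) α = 0 := by
  simp [contract]

theorem contract_neg (X : ExteriorAlgebra ℝ V) (α : GradedForms V) :
    contract (-X) α = -contract X α := by
  simp [contract]

theorem contract_sub (X Y : ExteriorAlgebra ℝ V) (α : GradedForms V) :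
    contract (X - Y) α = contract X α - contract Y α := by
  simp [contract]

theorem contract_sum {ι : Type*} (s : Finset ι) (X : ι → ExteriorAlgebra ℝ V)
    (α : GradedForms V) : contract (∑ i ∈ s, X i) α = ∑ i ∈ s, contract (X i) α := by
  simp [contract]

theorem interior_interior_comm (v w : V) (α : GradedForms V) :
    interior v (interior w α) = -interior w (interior v α) := by
  have h := interior_interior (v + w) α
  simp only [map_add, LinearMap.add_apply, interior_interior, zero_add, add_zero] at h
  exact eq_neg_of_add_eq_zero_right h

theorem contract_apply_eq_zero {j k : ℕ} {X : ExteriorAlgebra ℝ V} (hX : X ∈ ⋀[ℝ]^j V)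
    {α : GradedForms V} (hα : ∀ m, m ≠ k → α m = 0) {m : ℕ} (hm : m + j ≠ k) :
    contract X α m = 0 := by
  induction hX using Submodule.pow_induction_on_right' generalizing m with
  | algebraMap r =>
    rw [Algebra.algebraMap_eq_smul_one, contract_smul, contract_one, Pi.smul_apply, hα m hm,
      smul_zero]
  | add x y i _ _ hx hy => rw [contract_add, Pi.add_apply, hx hm, hy hm, add_zero]
  | mul_mem i x _ hx v hv =>
    obtain ⟨v, rfl⟩ := hv
    have h : contract x α (m + 1) = 0 := hx (by omega)
    ext w
    rw [contract_mul, contract_ι, interior_apply, h]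
    rfl

@[simp] theorem pullback_apply (f : V →L[ℝ] W) (α : GradedForms W) (m : ℕ) :
    pullback f α m = (α m).compContinuousLinearMap f := rfl

theorem pullback_single (f : V →L[ℝ] W) (k : ℕ) (p : W [⋀^Fin k]→L[ℝ] ℝ) :
    pullback f (Pi.single k p) = Pi.single k (p.compContinuousLinearMap f) := by
  funext m
  by_cases h : m = k
  · subst h
    rw [pullback_apply, Pi.single_eq_same, Pi.single_eq_same]
  · rw [pullback_apply, Pi.single_eq_of_ne h, Pi.single_eq_of_ne h]
    rfl

theorem interior_pullback (f : V →L[ℝ] W) (v : V) (α : GradedForms W) :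
    interior v (pullback f α) = pullback f (interior (f v) α) := by
  funext m
  ext w
  change α (m + 1) (fun i => f ((Fin.cons v w : Fin (m + 1) → V) i)) =
    α (m + 1) (Fin.cons (f v) fun i => f (w i))
  congr 1
  funext i
  refine Fin.cases ?_ (fun i => ?_) i <;> simp

theorem contract_pullback (f : V →L[ℝ] W) (X : ExteriorAlgebra ℝ V) (α : GradedForms W) :
    contract X (pullback f α) =
      pullback f (contract (ExteriorAlgebra.map (f : V →ₗ[ℝ] W) X) α) := by
  induction X using exteriorAlgebra_right_induction generalizing α with
  | one => simp
  | smul r x hx => rw [contract_smul, map_smul, contract_smul, hx, map_smul]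
  | add x y hx hy => rw [contract_add, map_add, contract_add, hx, hy, map_add]
  | mul_ι x m hx =>
    rw [map_mul, contract_mul, contract_mul, hx, ExteriorAlgebra.map_apply_ι, contract_ι,
      contract_ι, interior_pullback]
    rfl

theorem contract_map_mul_ι {L : Type*} [AddCommGroup L] [Module ℝ L] (f : L →ₗ[ℝ] V)
    (x : ExteriorAlgebra ℝ L) (n : L) (α : GradedForms V) :
    contract (ExteriorAlgebra.map f (x * ExteriorAlgebra.ι ℝ n)) α =
      interior (f n) (contract (ExteriorAlgebra.map f x) α) := by
  rw [map_mul, contract_mul, ExteriorAlgebra.map_apply_ι, contract_ι]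

end LinearForms

section GradedCalculus

variable {V W : Type*} [NormedAddCommGroup V] [NormedSpace ℝ V] [NormedAddCommGroup W]
  [NormedSpace ℝ W]

theorem interior_eq_curryLeft (v : V) (α : GradedForms V) (m : ℕ) :
    interior v α m = (α (m + 1)).curryLeft v := rfl

/-- The interior product `ι_v` from forms of degree `m + 1` to forms of degree `m`, as a continuous
linear map. -/
def interiorCLM (v : V) (m : ℕ) : (V [⋀^Fin (m + 1)]→L[ℝ] ℝ) →L[ℝ] (V [⋀^Fin m]→L[ℝ] ℝ) :=
  (ContinuousLinearMap.apply ℝ (V [⋀^Fin m]→L[ℝ] ℝ) v).comp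
    (ContinuousAlternatingMap.curryLeftLI (𝕜 := ℝ) (E := V) (F := ℝ)
      (n := m)).toContinuousLinearMap

theorem isBoundedBilinearMap_curryLeft (m : ℕ) : IsBoundedBilinearMap ℝ
    (fun q : (V [⋀^Fin (m + 1)]→L[ℝ] ℝ) × V => q.1.curryLeft q.2) where
  add_left _ _ _ := rfl
  smul_left _ _ _ := rfl
  add_right f v w := map_add f.curryLeft v w
  smul_right c f w := map_smul f.curryLeft c w
  bound := ⟨1, one_pos, fun f v => by
    rw [one_mul, ← ContinuousAlternatingMap.norm_curryLeft]
    exact f.curryLeft.le_opNorm v⟩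

theorem hasFDerivAt_curryLeft_apply {m : ℕ} {f : W → V [⋀^Fin (m + 1)]→L[ℝ] ℝ} {v : W → V}
    {f' : W →L[ℝ] V [⋀^Fin (m + 1)]→L[ℝ] ℝ} {v' : W →L[ℝ] V} {x : W}
    (hf : HasFDerivAt f f' x) (hv : HasFDerivAt v v' x) :
    HasFDerivAt (fun y => (f y).curryLeft (v y))
      ((interiorCLM (v x) m).comp f' + (f x).curryLeft.comp v') x := by
  have h_bilin := (isBoundedBilinearMap_curryLeft m).hasFDerivAt (f x, v x)
  refine (HasFDerivAt.comp (g := fun q : (V [⋀^Fin (m + 1)]→L[ℝ] ℝ) × V => q.1.curryLeft q.2) x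
    h_bilin (hf.prodMk hv)).congr_fderiv (ContinuousLinearMap.ext fun w => ?_)
  exact add_comm _ _

/-- The pullback by `f` of forms of degree `m`, as a continuous linear map. -/
abbrev pullbackCLM (f : V →L[ℝ] W) (m : ℕ) : (W [⋀^Fin m]→L[ℝ] ℝ) →L[ℝ] (V [⋀^Fin m]→L[ℝ] ℝ) :=
  ContinuousAlternatingMap.compContinuousLinearMapCLM f

/-- The inclusion of `k`-forms into graded forms, followed by the projection to degree `m`: the
identity if `m = k` and zero otherwise. -/
def singleCLM (V : Type*) [NormedAddCommGroup V] [NormedSpace ℝ V] (k m : ℕ) :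
    (V [⋀^Fin k]→L[ℝ] ℝ) →L[ℝ] (V [⋀^Fin m]→L[ℝ] ℝ) :=
  (ContinuousLinearMap.proj (R := ℝ) (φ := fun m : ℕ => V [⋀^Fin m]→L[ℝ] ℝ) m).comp
    (ContinuousLinearMap.single ℝ (fun m : ℕ => V [⋀^Fin m]→L[ℝ] ℝ) k)

/-- The antisymmetrization of a linear map with values in graded forms: the form
`(w₀, …, w_m) ↦ ∑ᵢ (-1)ⁱ T wᵢ (w₀, …, ŵᵢ, …, w_m)`. If `T` is the derivative of a field of forms,
this is its exterior derivative. -/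
def gradedAlt (T : ∀ m : ℕ, V →L[ℝ] V [⋀^Fin m]→L[ℝ] ℝ) : GradedForms V
  | 0 => 0
  | m + 1 => ContinuousAlternatingMap.alternatizeUncurryFin (T m)

@[simp] theorem gradedAlt_zero_apply (T : ∀ m : ℕ, V →L[ℝ] V [⋀^Fin m]→L[ℝ] ℝ) :
    gradedAlt T 0 = 0 := rfl

@[simp] theorem gradedAlt_succ_apply (T : ∀ m : ℕ, V →L[ℝ] V [⋀^Fin m]→L[ℝ] ℝ) (m : ℕ) :
    gradedAlt T (m + 1) = ContinuousAlternatingMap.alternatizeUncurryFin (T m) := rfl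

theorem gradedAlt_add (S T : ∀ m : ℕ, V →L[ℝ] V [⋀^Fin m]→L[ℝ] ℝ) :
    gradedAlt (S + T) = gradedAlt S + gradedAlt T := by
  funext m
  cases m with
  | zero => simp
  | succ m => exact ContinuousAlternatingMap.alternatizeUncurryFin_add _ _

theorem gradedAlt_smul (c : ℝ) (T : ∀ m : ℕ, V →L[ℝ] V [⋀^Fin m]→L[ℝ] ℝ) :
    gradedAlt (c • T) = c • gradedAlt T := by
  funext m
  cases m with
  | zero => simp
  | succ m => exact ContinuousAlternatingMap.alternatizeUncurryFin_smul _ _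

theorem gradedAlt_zero : gradedAlt (0 : ∀ m : ℕ, V →L[ℝ] V [⋀^Fin m]→L[ℝ] ℝ) = 0 := by
  funext m
  cases m with
  | zero => rfl
  | succ m =>
    ext w
    simp [ContinuousAlternatingMap.alternatizeUncurryFin_apply]

theorem interior_gradedAlt (v : V) (T : ∀ m : ℕ, V →L[ℝ] V [⋀^Fin m]→L[ℝ] ℝ) :
    interior v (gradedAlt T) =
      (fun m => T m v) - gradedAlt fun m => (interiorCLM v m).comp (T (m + 1)) := by
  funext m
  ext w
  rw [interior_apply, gradedAlt_succ_apply, ContinuousAlternatingMap.alternatizeUncurryFin_apply,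
    Fin.sum_univ_succ]
  have h_zero : Fin.removeNth 0 (Fin.cons v w : Fin (m + 1) → V) = w := Fin.tail_cons _ _
  rw [h_zero]
  cases m with
  | zero => simp
  | succ m =>
    have h_succ : ∀ i : Fin (m + 1), Fin.removeNth i.succ (Fin.cons v w : Fin (m + 2) → V) =
        Fin.cons v (Fin.removeNth i w) := by
      intro i
      funext j
      refine Fin.cases ?_ (fun j => ?_) j <;> simp [Fin.removeNth]
    simp only [h_succ]
    simp [ContinuousAlternatingMap.alternatizeUncurryFin_apply, pow_succ, sub_eq_add_neg]
    rfl

theorem pullback_gradedAlt (f : V →L[ℝ] W) (T : ∀ m : ℕ, W →L[ℝ] W [⋀^Fin m]→L[ℝ] ℝ) :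
    pullback f (gradedAlt T) = gradedAlt fun m => (pullbackCLM f m).comp ((T m).comp f) := by
  funext m
  cases m with
  | zero => rfl
  | succ m =>
    ext w
    simp [ContinuousAlternatingMap.alternatizeUncurryFin_apply]
    rfl

/-- The derivation `(B · α) (w₁, …, w_m) = ∑ᵢ α (w₁, …, B wᵢ, …, w_m)` of graded forms given by an
endomorphism `B`. -/
def formDerivation (B : V →L[ℝ] V) (α : GradedForms V) : GradedForms V :=
  gradedAlt fun m => (α (m + 1)).curryLeft.comp B

theorem formDerivation_add (B : V →L[ℝ] V) (α β : GradedForms V) :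
    formDerivation B (α + β) = formDerivation B α + formDerivation B β := by
  rw [formDerivation, formDerivation, formDerivation, ← gradedAlt_add]
  rfl

theorem formDerivation_smul (c : ℝ) (B : V →L[ℝ] V) (α : GradedForms V) :
    formDerivation B (c • α) = c • formDerivation B α := by
  rw [formDerivation, formDerivation, ← gradedAlt_smul]
  rfl

theorem interior_formDerivation (B : V →L[ℝ] V) (v : V) (α : GradedForms V) :
    interior v (formDerivation B α) = interior (B v) α + formDerivation B (interior v α) := by
  rw [formDerivation, interior_gradedAlt, sub_eq_add_neg]
  congr 1
  rw [← neg_one_smul ℝ, ← gradedAlt_smul, formDerivation]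
  congr 1
  funext m
  refine ContinuousLinearMap.ext fun w => ?_
  have h := congrFun (interior_interior_comm (B w) v α) m
  exact (neg_one_smul ℝ _).trans h.symm

theorem formDerivation_single (B : V →L[ℝ] V) (k : ℕ) (p : V [⋀^Fin k]→L[ℝ] ℝ) :
    formDerivation B (Pi.single k p) =
      Pi.single k (p.fderivCompContinuousLinearMap (ContinuousLinearMap.id ℝ V) B) := by
  funext m
  by_cases h : m = k
  · subst h
    rw [Pi.single_eq_same, formDerivation]
    cases m with
    | zero => ext; simp
    | succ m =>
      rw [gradedAlt_succ_apply, Pi.single_eq_same,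
        ContinuousAlternatingMap.fderivCompContinuousLinearMap_eq_alternatizeUncurryFin]
      rfl
  · rw [Pi.single_eq_of_ne h, formDerivation]
    cases m with
    | zero => rfl
    | succ m =>
      rw [gradedAlt_succ_apply, Pi.single_eq_of_ne h]
      ext w
      simp [ContinuousAlternatingMap.alternatizeUncurryFin_apply]

theorem formDerivation_id (α : GradedForms V) (m : ℕ) :
    formDerivation (ContinuousLinearMap.id ℝ V) α m = m • α m := by
  rw [formDerivation]
  cases m with
  | zero => simp
  | succ m =>
    rw [gradedAlt_succ_apply, ContinuousLinearMap.comp_id]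
    exact ContinuousAlternatingMap.alternatizeUncurryFin_curryLeft _

end GradedCalculus

section FlatPhaseSpace

variable {E : Type*} [NormedAddCommGroup E] [NormedSpace ℝ E]

/-- The projection `E × Λᵏ E* → E` of the flat phase space. -/
abbrev baseProj (E : Type*) [NormedAddCommGroup E] [NormedSpace ℝ E] (k : ℕ) :
    E × (E [⋀^Fin k]→L[ℝ] ℝ) →L[ℝ] E :=
  ContinuousLinearMap.fst ℝ E (E [⋀^Fin k]→L[ℝ] ℝ)

/-- The exterior derivative of the canonical form `θ_(z,p) = p ∘ fst` on `E × Λᵏ E*`; it has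
constant coefficients. -/
def flatDTheta (E : Type*) [NormedAddCommGroup E] [NormedSpace ℝ E] (k : ℕ) :
    GradedForms (E × (E [⋀^Fin k]→L[ℝ] ℝ)) :=
  gradedAlt fun m => (pullbackCLM (baseProj E k) m).comp
    ((singleCLM E k m).comp (ContinuousLinearMap.snd ℝ E (E [⋀^Fin k]→L[ℝ] ℝ)))

variable {k : ℕ}

/-- The contraction of a pullback with a vector field, differentiated: `u` is the value and `B` the
derivative of the vector field, `s` is the value and `S` the derivative of the form. -/
theorem gradedAlt_pullback_interior {v : E × (E [⋀^Fin k]→L[ℝ] ℝ)} {u : E} (hv : v.1 = u)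
    (S : ∀ m : ℕ, (E × (E [⋀^Fin k]→L[ℝ] ℝ)) →L[ℝ] E [⋀^Fin m]→L[ℝ] ℝ) (B : E →L[ℝ] E)
    (s : GradedForms E) :
    gradedAlt (fun m => (pullbackCLM (baseProj E k) m).comp ((interiorCLM u m).comp (S (m + 1)) +
      ((s (m + 1)).curryLeft.comp B).comp (baseProj E k))) =
    pullback (baseProj E k) ((fun m => S m v) + formDerivation B s) -
      interior v (gradedAlt fun m => (pullbackCLM (baseProj E k) m).comp (S m)) := by
  have h_split : (fun m => (pullbackCLM (baseProj E k) m).comp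
      ((interiorCLM u m).comp (S (m + 1)) +
        ((s (m + 1)).curryLeft.comp B).comp (baseProj E k))) =
      (fun m => (interiorCLM v m).comp ((pullbackCLM (baseProj E k) (m + 1)).comp (S (m + 1)))) +
      fun m => (pullbackCLM (baseProj E k) m).comp
        (((s (m + 1)).curryLeft.comp B).comp (baseProj E k)) := by
    subst hv
    funext m
    refine ContinuousLinearMap.ext fun w => ?_
    change (pullbackCLM (baseProj E k) m) (_ + _) = _ + _
    rw [map_add]
    congr 1
    exact (ContinuousAlternatingMap.curryLeft_compContinuousLinearMap (S (m + 1) w)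
      (baseProj E k) v).symm
  have h_deriv : gradedAlt (fun m => (pullbackCLM (baseProj E k) m).comp
      (((s (m + 1)).curryLeft.comp B).comp (baseProj E k))) =
      pullback (baseProj E k) (formDerivation B s) :=
    (pullback_gradedAlt _ _).symm
  have h_value : (fun m => (pullbackCLM (baseProj E k) m).comp (S m) v) =
      pullback (baseProj E k) (fun m => S m v) := rfl
  rw [h_split, gradedAlt_add, h_deriv, interior_gradedAlt, map_add, h_value]
  abel

/-- The 1-jet at `z₀` of a Lie algebra `L` of vector fields on the vector space `E`: `val z ξ` is
the value at `z` of the vector field `ξ`, and brackets are only evaluated at `z₀`. -/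
structure VectorFieldJet (L : Type*) [LieRing L] [LieAlgebra ℝ L] {E : Type*}
    [NormedAddCommGroup E] [NormedSpace ℝ E] (z₀ : E) where
  val : E → L →ₗ[ℝ] E
  differentiableAt : ∀ ξ, DifferentiableAt ℝ (fun z => val z ξ) z₀
  val_lie : ∀ ξ η, val z₀ ⁅ξ, η⁆ =
    fderiv ℝ (fun z => val z η) z₀ (val z₀ ξ) - fderiv ℝ (fun z => val z ξ) z₀ (val z₀ η)

namespace VectorFieldJet

variable {L : Type*} [LieRing L] [LieAlgebra ℝ L] {z₀ : E} (J : VectorFieldJet L z₀)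

/-- The derivatives at `z₀` of the vector fields of a jet. -/
def deriv : L →ₗ[ℝ] E →L[ℝ] E where
  toFun ξ := fderiv ℝ (fun z => J.val z ξ) z₀
  map_add' ξ η := by
    simp only [map_add]
    exact fderiv_add (J.differentiableAt ξ) (J.differentiableAt η)
  map_smul' c ξ := by
    simp only [map_smul]
    exact fderiv_const_smul (J.differentiableAt ξ) c

theorem hasFDerivAt (ξ : L) : HasFDerivAt (fun z => J.val z ξ) (J.deriv ξ) z₀ :=
  (J.differentiableAt ξ).hasFDerivAt

/-- The complete lift `ξ ↦ (ξ z₀, -Dξ(z₀) · p₀)` of a jet of vector fields to the flat phase space,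
at the point `(z₀, p₀)`. -/
def lift (p₀ : E [⋀^Fin k]→L[ℝ] ℝ) : L →ₗ[ℝ] E × (E [⋀^Fin k]→L[ℝ] ℝ) :=
  (J.val z₀).prod (-((p₀.fderivCompContinuousLinearMap
    (ContinuousLinearMap.id ℝ E)).toLinearMap ∘ₗ J.deriv))

/-- The form `Y ⌟ p` on `E`, as a function of the point `(z, p)` of the flat phase space. -/
def fiberContract (Y : ExteriorAlgebra ℝ L) (q : E × (E [⋀^Fin k]→L[ℝ] ℝ)) : GradedForms E :=
  contract (ExteriorAlgebra.map (J.val q.1) Y) (Pi.single k q.2)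

/-- The derivative of `fiberContract` at `(z₀, p₀)`. -/
def fiberContractDeriv (Y : ExteriorAlgebra ℝ L) (p₀ : E [⋀^Fin k]→L[ℝ] ℝ) (m : ℕ) :
    (E × (E [⋀^Fin k]→L[ℝ] ℝ)) →L[ℝ] E [⋀^Fin m]→L[ℝ] ℝ :=
  fderiv ℝ (fun q => J.fiberContract Y q m) (z₀, p₀)

variable (p₀ : E [⋀^Fin k]→L[ℝ] ℝ) (x y : ExteriorAlgebra ℝ L)

theorem fiberContract_one (q : E × (E [⋀^Fin k]→L[ℝ] ℝ)) :
    J.fiberContract 1 q = Pi.single k q.2 := by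
  rw [fiberContract, map_one, contract_one]

theorem fiberContract_smul (r : ℝ) (q : E × (E [⋀^Fin k]→L[ℝ] ℝ)) :
    J.fiberContract (r • x) q = r • J.fiberContract x q := by
  rw [fiberContract, map_smul, contract_smul, fiberContract]

theorem fiberContract_add (q : E × (E [⋀^Fin k]→L[ℝ] ℝ)) :
    J.fiberContract (x + y) q = J.fiberContract x q + J.fiberContract y q := by
  rw [fiberContract, map_add, contract_add, fiberContract, fiberContract]

theorem fiberContract_sub (q : E × (E [⋀^Fin k]→L[ℝ] ℝ)) :
    J.fiberContract (x - y) q = J.fiberContract x q - J.fiberContract y q := by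
  rw [fiberContract, map_sub, contract_sub, fiberContract, fiberContract]

theorem fiberContract_mul_ι (n : L) (q : E × (E [⋀^Fin k]→L[ℝ] ℝ)) :
    J.fiberContract (x * ExteriorAlgebra.ι ℝ n) q =
      interior (J.val q.1 n) (J.fiberContract x q) :=
  contract_map_mul_ι _ x n _

theorem hasFDerivAt_fiberContract_one (m : ℕ) :
    HasFDerivAt (fun q => J.fiberContract 1 q m)
      ((singleCLM E k m).comp (ContinuousLinearMap.snd ℝ E _)) (z₀, p₀) := by
  simp only [fiberContract_one]
  exact ((singleCLM E k m).comp (ContinuousLinearMap.snd ℝ E _)).hasFDerivAt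

variable {p₀ x} in
theorem hasFDerivAt_fiberContract_mul_ι {m : ℕ}
    {S : (E × (E [⋀^Fin k]→L[ℝ] ℝ)) →L[ℝ] E [⋀^Fin (m + 1)]→L[ℝ] ℝ}
    (hS : HasFDerivAt (fun q => J.fiberContract x q (m + 1)) S (z₀, p₀)) (n : L) :
    HasFDerivAt (fun q => J.fiberContract (x * ExteriorAlgebra.ι ℝ n) q m)
      ((interiorCLM (J.val z₀ n) m).comp S +
        ((J.fiberContract x (z₀, p₀) (m + 1)).curryLeft.comp (J.deriv n)).comp (baseProj E k))
      (z₀, p₀) := by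
  have h_val : HasFDerivAt (fun q : E × (E [⋀^Fin k]→L[ℝ] ℝ) => J.val q.1 n)
      ((J.deriv n).comp (baseProj E k)) (z₀, p₀) :=
    HasFDerivAt.comp (g := fun z => J.val z n) (z₀, p₀) (J.hasFDerivAt n) hasFDerivAt_fst
  have h := hasFDerivAt_curryLeft_apply
    (f := fun q : E × (E [⋀^Fin k]→L[ℝ] ℝ) => J.fiberContract x q (m + 1))
    (v := fun q : E × (E [⋀^Fin k]→L[ℝ] ℝ) => J.val q.1 n) hS h_val
  refine h.congr_of_eventuallyEq (Filter.Eventually.of_forall fun q => ?_)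
  exact congrFun (J.fiberContract_mul_ι x n q) m

theorem hasFDerivAt_fiberContract (m : ℕ) :
    HasFDerivAt (fun q => J.fiberContract x q m) (J.fiberContractDeriv x p₀ m) (z₀, p₀) := by
  refine DifferentiableAt.hasFDerivAt ?_
  induction x using exteriorAlgebra_right_induction generalizing m with
  | one => exact (J.hasFDerivAt_fiberContract_one p₀ m).differentiableAt
  | smul r x hx =>
    simp only [fiberContract_smul]
    exact (hx m).const_smul r
  | add x y hx hy =>
    simp only [fiberContract_add]
    exact (hx m).add (hy m)
  | mul_ι x n hx =>
    exact (J.hasFDerivAt_fiberContract_mul_ι (hx (m + 1)).hasFDerivAt n).differentiableAt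

theorem fiberContractDeriv_one : J.fiberContractDeriv 1 p₀ = fun m =>
    (singleCLM E k m).comp (ContinuousLinearMap.snd ℝ E _) :=
  funext fun m => (J.hasFDerivAt_fiberContract_one p₀ m).fderiv

theorem fiberContractDeriv_smul (r : ℝ) :
    J.fiberContractDeriv (r • x) p₀ = r • J.fiberContractDeriv x p₀ := by
  funext m
  rw [fiberContractDeriv]
  simp only [fiberContract_smul]
  exact ((J.hasFDerivAt_fiberContract p₀ x m).const_smul r).fderiv

theorem fiberContractDeriv_add :
    J.fiberContractDeriv (x + y) p₀ = J.fiberContractDeriv x p₀ + J.fiberContractDeriv y p₀ := by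
  funext m
  rw [fiberContractDeriv]
  simp only [fiberContract_add]
  exact ((J.hasFDerivAt_fiberContract p₀ x m).add (J.hasFDerivAt_fiberContract p₀ y m)).fderiv

theorem fiberContractDeriv_mul_ι (n : L) :
    J.fiberContractDeriv (x * ExteriorAlgebra.ι ℝ n) p₀ = fun m =>
      (interiorCLM (J.val z₀ n) m).comp (J.fiberContractDeriv x p₀ (m + 1)) +
        ((J.fiberContract x (z₀, p₀) (m + 1)).curryLeft.comp (J.deriv n)).comp (baseProj E k) :=
  funext fun m =>
    (J.hasFDerivAt_fiberContract_mul_ι (J.hasFDerivAt_fiberContract p₀ x (m + 1)) n).fderiv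

/-- The Lie derivative of `Y ⌟ θ` along the complete lift of `ξ` is `(ad ξ Y) ⌟ θ`, because `θ` is
invariant under complete lifts. -/
theorem fiberContractDeriv_lift_add_formDerivation (ξ : L) :
    (fun m => J.fiberContractDeriv x p₀ m (J.lift p₀ ξ)) +
      formDerivation (J.deriv ξ) (J.fiberContract x (z₀, p₀)) =
        J.fiberContract (adExt ξ x) (z₀, p₀) := by
  induction x using exteriorAlgebra_right_induction with
  | one =>
    rw [adExt_one, fiberContract_one, formDerivation_single, fiberContractDeriv_one,
      fiberContract, map_zero, contract_zero]
    funext m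
    refine (congrArg (· + _) (map_neg (singleCLM E k m) _)).trans ?_
    exact neg_add_cancel _
  | smul r x hx =>
    rw [fiberContractDeriv_smul, fiberContract_smul, formDerivation_smul, map_smul,
      fiberContract_smul, ← hx, smul_add]
    rfl
  | add x y hx hy =>
    rw [fiberContractDeriv_add, fiberContract_add, formDerivation_add, map_add,
      fiberContract_add, ← hx, ← hy, add_add_add_comm]
    rfl
  | mul_ι x n hx =>
    have h_deriv : (fun m => J.fiberContractDeriv (x * ExteriorAlgebra.ι ℝ n) p₀ m
        (J.lift p₀ ξ)) =
        interior (J.val z₀ n) (fun m => J.fiberContractDeriv x p₀ m (J.lift p₀ ξ)) +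
          interior (J.deriv n (J.val z₀ ξ)) (J.fiberContract x (z₀, p₀)) := by
      rw [fiberContractDeriv_mul_ι]
      rfl
    have h_lie : J.val z₀ ⁅ξ, n⁆ = J.deriv n (J.val z₀ ξ) - J.deriv ξ (J.val z₀ n) :=
      J.val_lie ξ n
    rw [h_deriv, adExt_mul, adExt_ι, fiberContract_add, fiberContract_mul_ι, fiberContract_mul_ι,
      fiberContract_mul_ι, ← hx, h_lie, map_add, interior_formDerivation, map_sub,
      LinearMap.sub_apply]
    abel

/-- The exterior derivative of `Y ⌟ θ`, for `Y = Y₁ ∧ ⋯ ∧ Yₗ`. The induction step is Cartan's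
formula `d ι_Z + ι_Z d = L_Z` for the complete lift `Z` of the last factor. -/
theorem gradedAlt_pullback_fiberContractDeriv :
    gradedAlt (fun m => (pullbackCLM (baseProj E k) m).comp (J.fiberContractDeriv x p₀ m)) =
      contract (ExteriorAlgebra.map (J.lift p₀) (gradeInvolution ℝ x)) (flatDTheta E k) +
      pullback (baseProj E k)
        (J.fiberContract (ceBoundary ℝ L (gradeInvolution ℝ x)) (z₀, p₀)) := by
  induction x using exteriorAlgebra_right_induction with
  | one =>
    rw [fiberContractDeriv_one, map_one, map_one, contract_one, ceBoundary_one, fiberContract,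
      map_zero, contract_zero, map_zero, add_zero]
    rfl
  | smul r x hx =>
    rw [fiberContractDeriv_smul, map_smul, map_smul, contract_smul, map_smul, fiberContract_smul,
      map_smul, ← smul_add, ← hx, ← gradedAlt_smul]
    congr 1
  | add x y hx hy =>
    rw [fiberContractDeriv_add, map_add, map_add, contract_add, map_add, fiberContract_add,
      map_add, add_add_add_comm, ← hx, ← hy, ← gradedAlt_add]
    congr 1
  | mul_ι x n hx =>
    have h_base : baseProj E k (J.lift p₀ n) = J.val z₀ n := rfl
    have h_boundary : ceBoundary ℝ L (gradeInvolution ℝ (x * ExteriorAlgebra.ι ℝ n)) =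
        adExt n x - ceBoundary ℝ L (gradeInvolution ℝ x) * ExteriorAlgebra.ι ℝ n := by
      rw [map_mul, gradeInvolution_ι, mul_neg, map_neg, ceBoundary_mul_ι,
        gradeInvolution_gradeInvolution]
      abel
    rw [fiberContractDeriv_mul_ι, gradedAlt_pullback_interior h_base, hx,
      fiberContractDeriv_lift_add_formDerivation, h_boundary, fiberContract_sub,
      fiberContract_mul_ι, map_mul, gradeInvolution_ι, mul_neg, map_neg,
      contract_neg, contract_map_mul_ι, map_add, map_sub, interior_pullback, h_base]
    abel

end VectorFieldJet

end FlatPhaseSpace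

section Charts

variable {E H : Type*} [NormedAddCommGroup E] [NormedSpace ℝ E] [TopologicalSpace H]
  {I : ModelWithCorners ℝ E H} {M : Type*} [TopologicalSpace M] [ChartedSpace H M]

/-- A graded form on the tangent space at a point, as a graded form on the model space `E`: tangent
spaces are copies of `E`, and this fixes on which of the two types the form lives. -/
def toModel {x : M} (α : GradedForms (TangentSpace I x)) : GradedForms E := α

variable (I) in
/-- The derivative at `y` of the chart at `x`. -/
def toChart (x y : M) : E →L[ℝ] E := mfderiv I 𝓘(ℝ, E) (extChartAt I x) y

variable (I) in
/-- The derivative at `z` of the inverse of the chart at `x`. -/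
def ofChart (x : M) (z : E) : E →L[ℝ] E := mfderiv 𝓘(ℝ, E) I (extChartAt I x).symm z

/-- The representative of the degree `m` component of a field of forms in the chart at `x`. -/
def chartForm (x : M) (m : ℕ) (α : FormField I M) (z : E) : E [⋀^Fin m]→L[ℝ] ℝ :=
  (toModel (α ((extChartAt I x).symm z)) m).compContinuousLinearMap (ofChart I x z)

/-- The representative of a vector field in the chart at `x`. -/
def chartVF (x : M) (X : ∀ y : M, TangentSpace I y) (z : E) : E :=
  toChart I x ((extChartAt I x).symm z) (X ((extChartAt I x).symm z))

theorem chartForm_eq_zero {m : ℕ} {α : FormField I M} (h : ∀ y, α y m = 0) (x : M) :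
    chartForm x m α = fun _ => 0 := by
  funext z
  have h_zero : toModel (α ((extChartAt I x).symm z)) m = 0 := h _
  rw [chartForm, h_zero]
  rfl

theorem toModel_extD_succ (α : FormField I M) (x : M) (m : ℕ) :
    toModel (extD α x) (m + 1) = (extDeriv (chartForm x m α)
      (extChartAt I x x)).compContinuousLinearMap (toChart I x x) := rfl

theorem extD_apply_eq_zero {p : ℕ} {α : FormField I M} (hα : ∀ x m, m ≠ p → α x m = 0) (x : M)
    (m : ℕ) (hm : m ≠ p + 1) : extD α x m = 0 := by
  cases m with
  | zero => rfl
  | succ m =>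
    change toModel (extD α x) (m + 1) = 0
    rw [toModel_extD_succ, chartForm_eq_zero (fun y => hα y m (by omega)) x, extDeriv,
      fderiv_fun_const]
    ext w
    simp [ContinuousAlternatingMap.alternatizeUncurryFin_apply]

theorem target_mem_nhds [I.Boundaryless] {x : M} {z : E} (hz : z ∈ (extChartAt I x).target) :
    (extChartAt I x).target ∈ 𝓝 z := (isOpen_extChartAt_target x).mem_nhds hz

variable [IsManifold I ∞ M]

theorem isManifold_one : IsManifold I 1 M := .of_le (n := ∞) (by simp)

theorem contMDiffAt_chart {x y : M} (hy : y ∈ (extChartAt I x).source) :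
    ContMDiffAt I 𝓘(ℝ, E) ∞ (extChartAt I x) y :=
  contMDiffAt_extChartAt' (by rwa [extChartAt_source] at hy)

theorem hasMFDerivAt_chart {x y : M} (hy : y ∈ (extChartAt I x).source) :
    HasMFDerivAt I 𝓘(ℝ, E) (extChartAt I x) y (toChart I x y :) :=
  ((contMDiffAt_chart hy).mdifferentiableAt (by simp)).hasMFDerivAt

variable [I.Boundaryless]

theorem contMDiffAt_chart_symm {x : M} {z : E} (hz : z ∈ (extChartAt I x).target) :
    ContMDiffAt 𝓘(ℝ, E) I ∞ (extChartAt I x).symm z :=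
  (contMDiffOn_extChartAt_symm (n := ∞) x).contMDiffAt (target_mem_nhds hz)

theorem hasMFDerivAt_chart_symm {x : M} {z : E} (hz : z ∈ (extChartAt I x).target) :
    HasMFDerivAt 𝓘(ℝ, E) I (extChartAt I x).symm z (ofChart I x z :) :=
  ((contMDiffAt_chart_symm hz).mdifferentiableAt (by simp)).hasMFDerivAt

theorem toChart_comp_ofChart {x : M} {z : E} (hz : z ∈ (extChartAt I x).target) :
    (toChart I x ((extChartAt I x).symm z)).comp (ofChart I x z) = ContinuousLinearMap.id ℝ E := by
  have := isManifold_one (I := I) (M := M)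
  have h := mfderiv_extChartAt_comp_mfderivWithin_extChartAt_symm (I := I) hz
  rwa [I.range_eq_univ, mfderivWithin_univ] at h

theorem ofChart_comp_toChart {x : M} {z : E} (hz : z ∈ (extChartAt I x).target) :
    (ofChart I x z).comp (toChart I x ((extChartAt I x).symm z)) = ContinuousLinearMap.id ℝ E := by
  have := isManifold_one (I := I) (M := M)
  have h := mfderivWithin_extChartAt_symm_comp_mfderiv_extChartAt (I := I) hz
  rwa [I.range_eq_univ, mfderivWithin_univ] at h

theorem toChart_comp_ofChart_of_mem_source {x y : M} (hy : y ∈ (extChartAt I x).source) :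
    (toChart I x y).comp (ofChart I x (extChartAt I x y)) = ContinuousLinearMap.id ℝ E := by
  have h := toChart_comp_ofChart ((extChartAt I x).map_source hy)
  rwa [(extChartAt I x).left_inv hy] at h

theorem ofChart_comp_toChart_of_mem_source {x y : M} (hy : y ∈ (extChartAt I x).source) :
    (ofChart I x (extChartAt I x y)).comp (toChart I x y) = ContinuousLinearMap.id ℝ E := by
  have h := ofChart_comp_toChart ((extChartAt I x).map_source hy)
  rwa [(extChartAt I x).left_inv hy] at h

theorem compContinuousLinearMap_toChart_ofChart {x : M} {z : E}
    (hz : z ∈ (extChartAt I x).target) {m : ℕ} (p : E [⋀^Fin m]→L[ℝ] ℝ) :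
    (p.compContinuousLinearMap (toChart I x ((extChartAt I x).symm z))).compContinuousLinearMap
      (ofChart I x z) = p := by
  ext w
  change p (fun i => ((toChart I x ((extChartAt I x).symm z)).comp (ofChart I x z)) (w i)) = p w
  rw [toChart_comp_ofChart hz]
  rfl

theorem ofChart_self (x : M) : ofChart I x (extChartAt I x x) = ContinuousLinearMap.id ℝ E := by
  have := isManifold_one (I := I) (M := M)
  have h := mfderivWithin_range_extChartAt_symm (I := I) (x := x)
  rwa [I.range_eq_univ, mfderivWithin_univ] at h

theorem toChart_self (x : M) : toChart I x x = ContinuousLinearMap.id ℝ E := by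
  have h := ofChart_comp_toChart_of_mem_source (I := I) (mem_extChartAt_source x)
  rwa [ofChart_self, ContinuousLinearMap.id_comp] at h

theorem ofChart_inverse {x : M} {z : E} (hz : z ∈ (extChartAt I x).target) :
    (ofChart I x z).inverse = toChart I x ((extChartAt I x).symm z) :=
  ContinuousLinearMap.inverse_eq (ofChart_comp_toChart hz) (toChart_comp_ofChart hz)

theorem symmL_trivializationAt_eq_ofChart {x y : M} (hy : y ∈ (extChartAt I x).source) :
    ((trivializationAt E (TangentSpace I) x).symmL ℝ y : E →L[ℝ] E) =
      ofChart I x (extChartAt I x y) := by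
  have := isManifold_one (I := I) (M := M)
  have h := TangentBundle.symmL_trivializationAt (I := I) (by rwa [extChartAt_source] at hy)
  rwa [I.range_eq_univ, mfderivWithin_univ] at h

theorem contDiffAt_transition {x x₀ : M} {z : E} (hz : z ∈ (extChartAt I x).target)
    (hz' : (extChartAt I x).symm z ∈ (extChartAt I x₀).source) :
    ContDiffAt ℝ ∞ (fun z => extChartAt I x₀ ((extChartAt I x).symm z)) z := by
  rw [← contMDiffAt_iff_contDiffAt]
  exact (contMDiffAt_chart hz').comp z (contMDiffAt_chart_symm hz)

theorem fderiv_transition {x x₀ : M} {z : E} (hz : z ∈ (extChartAt I x).target)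
    (hz' : (extChartAt I x).symm z ∈ (extChartAt I x₀).source) :
    fderiv ℝ (fun z => extChartAt I x₀ ((extChartAt I x).symm z)) z =
      (toChart I x₀ ((extChartAt I x).symm z)).comp (ofChart I x z) :=
  HasFDerivAt.fderiv (hasMFDerivAt_iff_hasFDerivAt.1
    ((hasMFDerivAt_chart hz').comp z (hasMFDerivAt_chart_symm hz)))

theorem chartForm_transition {x x₀ : M} {z : E} (hz : z ∈ (extChartAt I x).target)
    (hz' : (extChartAt I x).symm z ∈ (extChartAt I x₀).source) (m : ℕ) (α : FormField I M) :
    chartForm x m α z = (chartForm x₀ m α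
      (extChartAt I x₀ ((extChartAt I x).symm z))).compContinuousLinearMap
        (fderiv ℝ (fun z => extChartAt I x₀ ((extChartAt I x).symm z)) z) := by
  rw [fderiv_transition hz hz', chartForm, chartForm, (extChartAt I x₀).left_inv hz']
  have h : (ofChart I x₀ (extChartAt I x₀ ((extChartAt I x).symm z))).comp
      ((toChart I x₀ ((extChartAt I x).symm z)).comp (ofChart I x z)) = ofChart I x z := by
    rw [← ContinuousLinearMap.comp_assoc, ofChart_comp_toChart_of_mem_source hz',
      ContinuousLinearMap.id_comp]
  conv_lhs => rw [← h]
  rfl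

theorem chartForm_eventuallyEq_transition {x x₀ : M} (hx : x ∈ (extChartAt I x₀).source) (m : ℕ)
    (α : FormField I M) :
    chartForm x m α =ᶠ[𝓝 (extChartAt I x x)] fun z => (chartForm x₀ m α
      (extChartAt I x₀ ((extChartAt I x).symm z))).compContinuousLinearMap
        (fderiv ℝ (fun z => extChartAt I x₀ ((extChartAt I x).symm z)) z) := by
  have h_source : ∀ᶠ z in 𝓝 (extChartAt I x x),
      (extChartAt I x).symm z ∈ (extChartAt I x₀).source :=
    (continuousAt_extChartAt_symm x).eventually
      ((isOpen_extChartAt_source x₀).mem_nhds (by rwa [extChartAt_to_inv]))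
  filter_upwards [h_source, target_mem_nhds (mem_extChartAt_target x)] with z hz' hz
  exact chartForm_transition hz hz' m α

theorem toModel_extD_succ_eq {x x₀ : M} (hx : x ∈ (extChartAt I x₀).source) (m : ℕ)
    (α : FormField I M) (hα : DifferentiableAt ℝ (chartForm x₀ m α) (extChartAt I x₀ x)) :
    toModel (extD α x) (m + 1) = (extDeriv (chartForm x₀ m α)
      (extChartAt I x₀ x)).compContinuousLinearMap (toChart I x₀ x) := by
  have hz := mem_extChartAt_target (I := I) x
  have h_inv : (extChartAt I x).symm (extChartAt I x x) = x := extChartAt_to_inv x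
  have hz' : (extChartAt I x).symm (extChartAt I x x) ∈ (extChartAt I x₀).source := by rwa [h_inv]
  rw [toModel_extD_succ, (chartForm_eventuallyEq_transition hx m α).extDeriv_eq, toChart_self,
    extDeriv_pullback (f := fun z => extChartAt I x₀ ((extChartAt I x).symm z))
      (by rwa [h_inv]) (contDiffAt_transition hz hz')
      (by simpa using WithTop.coe_le_coe.2 (le_top : (2 : ℕ∞) ≤ ⊤)),
    fderiv_transition hz hz', h_inv, ofChart_self, ContinuousLinearMap.comp_id]
  rfl

theorem chartForm_extD {α : FormField I M} {x : M} {z : E} (hz : z ∈ (extChartAt I x).target)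
    (m : ℕ) (hα : DifferentiableAt ℝ (chartForm x m α) z) :
    chartForm x (m + 1) (extD α) z = extDeriv (chartForm x m α) z := by
  rw [chartForm, toModel_extD_succ_eq ((extChartAt I x).map_target hz) m α
    (by rwa [(extChartAt I x).right_inv hz]), (extChartAt I x).right_inv hz]
  exact compContinuousLinearMap_toChart_ofChart hz _

theorem toModel_extD_eq_gradedAlt {α : FormField I M} {x : M}
    {T : ∀ m, E →L[ℝ] E [⋀^Fin m]→L[ℝ] ℝ}
    (hT : ∀ m, HasFDerivAt (chartForm x m α) (T m) (extChartAt I x x)) :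
    toModel (extD α x) = gradedAlt T := by
  funext m
  cases m with
  | zero => rfl
  | succ m =>
    rw [toModel_extD_succ, toChart_self, extDeriv, (hT m).fderiv, gradedAlt_succ_apply]
    rfl

theorem contMDiffAt_iff_contDiffAt_chart {F : Type*} [NormedAddCommGroup F] [NormedSpace ℝ F]
    {x₀ x : M} (hx : x ∈ (extChartAt I x₀).source) {f : M → F} {g : E → F}
    (hfg : ∀ y ∈ (extChartAt I x₀).source, f y = g (extChartAt I x₀ y)) :
    ContMDiffAt I 𝓘(ℝ, F) ∞ f x ↔ ContDiffAt ℝ ∞ g (extChartAt I x₀ x) := by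
  constructor
  · intro hf
    rw [← contMDiffAt_iff_contDiffAt]
    have hz := (extChartAt I x₀).map_source hx
    have hf' : ContMDiffAt I 𝓘(ℝ, F) ∞ f ((extChartAt I x₀).symm (extChartAt I x₀ x)) := by
      rwa [(extChartAt I x₀).left_inv hx]
    refine (hf'.comp (extChartAt I x₀ x) (contMDiffAt_chart_symm hz)).congr_of_eventuallyEq ?_
    filter_upwards [target_mem_nhds hz] with z hz
    rw [Function.comp_apply, hfg _ ((extChartAt I x₀).map_target hz),
      (extChartAt I x₀).right_inv hz]
  · intro hg
    refine (hg.contMDiffAt.comp x (contMDiffAt_chart hx)).congr_of_eventuallyEq ?_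
    filter_upwards [(isOpen_extChartAt_source x₀).mem_nhds hx] with y hy
    exact hfg y hy

theorem contMDiffAt_form_iff {p : ℕ} {α : FormField I M} (x₀ : M) {x : M}
    (hx : x ∈ (extChartAt I x₀).source) :
    ContMDiffAt I (I.prod 𝓘(ℝ, E [⋀^Fin p]→L[ℝ] ℝ)) ∞ (fun x =>
      TotalSpace.mk' (E := fun x : M => TangentSpace I x [⋀^Fin p]→L[ℝ] Bundle.Trivial M ℝ x)
        (E [⋀^Fin p]→L[ℝ] ℝ) x (α x p)) x ↔
    ContDiffAt ℝ ∞ (chartForm x₀ p α) (extChartAt I x₀ x) := by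
  have hx' : x ∈ (chartAt H x₀).source := by rwa [extChartAt_source] at hx
  rw [Bundle.Trivialization.contMDiffAt_section_iff
    (trivializationAt (E [⋀^Fin p]→L[ℝ] ℝ) (fun x : M => TangentSpace I x [⋀^Fin p]→L[ℝ]
      Bundle.Trivial M ℝ x) x₀) ⟨hx', mem_univ _⟩]
  refine contMDiffAt_iff_contDiffAt_chart hx fun y hy => ?_
  rw [FiberBundle.trivializationAt_continuousAlternatingMap_apply,
    ContinuousAlternatingMap.inCoordinates, chartForm, (extChartAt I x₀).left_inv hy,
    ← symmL_trivializationAt_eq_ofChart hy]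
  ext w
  simp
  rfl

theorem contMDiffAt_vectorField_iff {X : ∀ y : M, TangentSpace I y} (x₀ : M) {x : M}
    (hx : x ∈ (extChartAt I x₀).source) :
    ContMDiffAt I (I.prod 𝓘(ℝ, E)) ∞ (fun x => TotalSpace.mk' E x (X x)) x ↔
      ContDiffAt ℝ ∞ (chartVF x₀ X) (extChartAt I x₀ x) := by
  have hx' : x ∈ (chartAt H x₀).source := by rwa [extChartAt_source] at hx
  rw [Bundle.Trivialization.contMDiffAt_section_iff (trivializationAt E (TangentSpace I) x₀) hx']
  refine contMDiffAt_iff_contDiffAt_chart hx fun y hy => ?_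
  have := isManifold_one (I := I) (M := M)
  have hy' : y ∈ (chartAt H x₀).source := by rwa [extChartAt_source] at hy
  have h_toChart : (trivializationAt E (TangentSpace I) x₀).continuousLinearMapAt ℝ y =
      toChart I x₀ y := TangentBundle.continuousLinearMapAt_trivializationAt (I := I) hy'
  rw [chartVF, (extChartAt I x₀).left_inv hy]
  refine Eq.trans ?_ (congrArg (fun A : E →L[ℝ] E => A (X y : E)) h_toChart)
  exact (congrFun (Bundle.Trivialization.coe_linearMapAt_of_mem (R := ℝ)
    (trivializationAt E (TangentSpace I) x₀) hy') (X y)).symm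

theorem isForm_of_contDiffAt {p : ℕ} {α : FormField I M} (h0 : ∀ x m, m ≠ p → α x m = 0)
    (h : ∀ x, ContDiffAt ℝ ∞ (chartForm x p α) (extChartAt I x x)) : IsForm p α :=
  ⟨h0, fun x => (contMDiffAt_form_iff x (mem_extChartAt_source x)).2 (h x)⟩

theorem IsForm.contDiffAt_chartForm {p : ℕ} {α : FormField I M} (h : IsForm p α) {x : M} {z : E}
    (hz : z ∈ (extChartAt I x).target) (m : ℕ) : ContDiffAt ℝ ∞ (chartForm x m α) z := by
  by_cases hm : m = p
  · subst hm
    have h_smooth := (contMDiffAt_form_iff x ((extChartAt I x).map_target hz)).1 (h.2 _)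
    rwa [(extChartAt I x).right_inv hz] at h_smooth
  · rw [chartForm_eq_zero (fun y => h.1 y m hm)]
    exact contDiffAt_const

theorem IsForm.extD {p : ℕ} {α : FormField I M} (h : IsForm p α) : IsForm (p + 1) (extD α) := by
  refine isForm_of_contDiffAt (extD_apply_eq_zero h.1) fun x => ?_
  have hz := mem_extChartAt_target (I := I) x
  have h_extDeriv : chartForm x (p + 1) (MultiPhase.extD α) =ᶠ[𝓝 (extChartAt I x x)]
      extDeriv (chartForm x p α) := by
    filter_upwards [target_mem_nhds hz] with z hz
    exact chartForm_extD hz p ((h.contDiffAt_chartForm hz p).differentiableAt (by simp))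
  have h_fderiv : ContDiffAt ℝ ∞ (fderiv ℝ (chartForm x p α)) (extChartAt I x x) :=
    (h.contDiffAt_chartForm hz p).fderiv_right (m := ∞) (by simp)
  refine ContDiffAt.congr_of_eventuallyEq ?_ h_extDeriv
  exact (ContinuousAlternatingMap.alternatizeUncurryFinCLM ℝ E ℝ).contDiff.contDiffAt.comp
    (extChartAt I x x) h_fderiv

/-- A vector field whose representatives in charts are smooth, as a smooth vector field. -/
def VF.ofContDiffAt (X : ∀ y : M, TangentSpace I y)
    (h : ∀ x, ContDiffAt ℝ ∞ (chartVF x X) (extChartAt I x x)) : VF I M where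
  toFun := X
  contMDiff_toFun x := (contMDiffAt_vectorField_iff x (mem_extChartAt_source x)).2 (h x)

theorem VF.contDiffAt_chartVF (X : VF I M) {x : M} {z : E} (hz : z ∈ (extChartAt I x).target) :
    ContDiffAt ℝ ∞ (chartVF x X) z := by
  have h := (contMDiffAt_vectorField_iff x ((extChartAt I x).map_target hz)).1
    (X.contMDiff_toFun _)
  rwa [(extChartAt I x).right_inv hz] at h

end Charts

section PhaseCharts

variable {E N : Type*} [NormedAddCommGroup E] [NormedSpace ℝ E] [TopologicalSpace N]
  [ChartedSpace E N] [IsManifold 𝓘(ℝ, E) ∞ N] {k : ℕ}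

/-- The point of the phase space over `y` given by a form on the model space. -/
def phasePoint (y : N) (q : E [⋀^Fin k]→L[ℝ] ℝ) : PhaseSpace E N k := ⟨y, q⟩

/-- The form on the model space given by a point of the phase space. -/
def PhaseSpace.fiber (μ : PhaseSpace E N k) : E [⋀^Fin k]→L[ℝ] ℝ := μ.2

theorem mem_source_phase {μ ν : PhaseSpace E N k} :
    ν ∈ (extChartAt (phaseModel E k) μ).source ↔ ν.1 ∈ (extChartAt 𝓘(ℝ, E) μ.1).source := by
  rw [extChartAt_source, FiberBundle.chartedSpace_chartAt, extChartAt_source]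
  simp only [mfld_simps]
  exact ⟨fun h => h.2, fun h => ⟨⟨h, mem_univ _⟩, h⟩⟩

theorem mem_target_phase {μ : PhaseSpace E N k} {q : E × (E [⋀^Fin k]→L[ℝ] ℝ)} :
    q ∈ (extChartAt (phaseModel E k) μ).target ↔ q.1 ∈ (extChartAt 𝓘(ℝ, E) μ.1).target := by
  rw [FiberBundle.extChartAt_target]
  refine ⟨fun h => h.1.1, fun h => ?_⟩
  have h_source := (extChartAt 𝓘(ℝ, E) μ.1).map_target h
  rw [extChartAt_source] at h_source
  exact ⟨⟨h, h_source, mem_univ _⟩, mem_univ _⟩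

theorem extChartAt_phase {μ ν : PhaseSpace E N k}
    (hν : ν.1 ∈ (extChartAt 𝓘(ℝ, E) μ.1).source) :
    extChartAt (phaseModel E k) μ ν = (extChartAt 𝓘(ℝ, E) μ.1 ν.1,
      ν.fiber.compContinuousLinearMap (ofChart 𝓘(ℝ, E) μ.1 (extChartAt 𝓘(ℝ, E) μ.1 ν.1))) := by
  rw [FiberBundle.extChartAt, ← symmL_trivializationAt_eq_ofChart hν]
  refine Prod.ext rfl ?_
  change (trivializationAt (E [⋀^Fin k]→L[ℝ] ℝ) (fun x : N => TangentSpace 𝓘(ℝ, E) x [⋀^Fin k]→L[ℝ]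
    Bundle.Trivial N ℝ x) μ.1 ν).2 = _
  rw [FiberBundle.trivializationAt_continuousAlternatingMap_apply]
  ext w
  simp [ContinuousAlternatingMap.inCoordinates]
  rfl

theorem extChartAt_phase_self (μ : PhaseSpace E N k) :
    extChartAt (phaseModel E k) μ μ = (extChartAt 𝓘(ℝ, E) μ.1 μ.1, μ.fiber) := by
  rw [extChartAt_phase (mem_extChartAt_source μ.1), ofChart_self]
  rfl

theorem extChartAt_phase_symm {μ : PhaseSpace E N k} {z : E} (p : E [⋀^Fin k]→L[ℝ] ℝ)
    (hz : z ∈ (extChartAt 𝓘(ℝ, E) μ.1).target) :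
    (extChartAt (phaseModel E k) μ).symm (z, p) =
      phasePoint ((extChartAt 𝓘(ℝ, E) μ.1).symm z)
        (p.compContinuousLinearMap
          (toChart 𝓘(ℝ, E) μ.1 ((extChartAt 𝓘(ℝ, E) μ.1).symm z))) := by
  set ν : PhaseSpace E N k := phasePoint ((extChartAt 𝓘(ℝ, E) μ.1).symm z)
    (p.compContinuousLinearMap (toChart 𝓘(ℝ, E) μ.1 ((extChartAt 𝓘(ℝ, E) μ.1).symm z)))
  have h_source : ν.1 ∈ (extChartAt 𝓘(ℝ, E) μ.1).source := (extChartAt 𝓘(ℝ, E) μ.1).map_target hz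
  have h_base : extChartAt 𝓘(ℝ, E) μ.1 ν.1 = z := (extChartAt 𝓘(ℝ, E) μ.1).right_inv hz
  have h_chart : extChartAt (phaseModel E k) μ ν = (z, p) := by
    rw [extChartAt_phase h_source, h_base]
    exact Prod.ext rfl (compContinuousLinearMap_toChart_ofChart hz p)
  rw [← h_chart, (extChartAt (phaseModel E k) μ).left_inv (mem_source_phase.2 h_source)]

/-- The derivative of the projection, as a map between model spaces. -/
def dprojModel (μ : PhaseSpace E N k) : E × (E [⋀^Fin k]→L[ℝ] ℝ) →L[ℝ] E := dproj μ

theorem hasMFDerivAt_proj (μ : PhaseSpace E N k) :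
    HasMFDerivAt (phaseModel E k) 𝓘(ℝ, E) (fun ν : PhaseSpace E N k => ν.1) μ (dprojModel μ) :=
  ((contMDiff_proj (n := ∞) (IB := 𝓘(ℝ, E)) (fun x : N => TangentSpace 𝓘(ℝ, E) x [⋀^Fin k]→L[ℝ]
    Bundle.Trivial N ℝ x)).contMDiffAt.mdifferentiableAt (by simp)).hasMFDerivAt

theorem dprojModel_comp_ofChart {μ : PhaseSpace E N k} {q : E × (E [⋀^Fin k]→L[ℝ] ℝ)}
    (hq : q.1 ∈ (extChartAt 𝓘(ℝ, E) μ.1).target) :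
    (dprojModel ((extChartAt (phaseModel E k) μ).symm q)).comp (ofChart (phaseModel E k) μ q) =
      (ofChart 𝓘(ℝ, E) μ.1 q.1).comp (baseProj E k) := by
  have hq' := mem_target_phase.2 hq
  have h_left : HasMFDerivAt 𝓘(ℝ, E × (E [⋀^Fin k]→L[ℝ] ℝ)) 𝓘(ℝ, E)
      (fun q => ((extChartAt (phaseModel E k) μ).symm q).1) q
      ((dprojModel ((extChartAt (phaseModel E k) μ).symm q)).comp (ofChart (phaseModel E k) μ q)) :=
    HasMFDerivAt.comp (g := fun ν : PhaseSpace E N k => ν.1) q (hasMFDerivAt_proj _)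
      (hasMFDerivAt_chart_symm hq')
  have h_right : HasMFDerivAt 𝓘(ℝ, E × (E [⋀^Fin k]→L[ℝ] ℝ)) 𝓘(ℝ, E)
      (fun q => (extChartAt 𝓘(ℝ, E) μ.1).symm q.1) q
      ((ofChart 𝓘(ℝ, E) μ.1 q.1).comp (baseProj E k)) :=
    HasMFDerivAt.comp (g := (extChartAt 𝓘(ℝ, E) μ.1).symm) q (hasMFDerivAt_chart_symm hq)
      (baseProj E k).hasMFDerivAt
  refine hasMFDerivAt_unique h_left (h_right.congr_of_eventuallyEq ?_)
  filter_upwards [target_mem_nhds hq'] with r hr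
  exact congrArg (fun ν : PhaseSpace E N k => ν.1)
    (extChartAt_phase_symm r.2 (mem_target_phase.1 hr))

theorem dprojModel_eq (μ : PhaseSpace E N k) : dprojModel μ = baseProj E k := by
  have h := dprojModel_comp_ofChart (μ := μ) (q := extChartAt (phaseModel E k) μ μ)
    (mem_target_phase.1 (mem_extChartAt_target μ))
  rw [extChartAt_to_inv, ofChart_self, ContinuousLinearMap.comp_id, extChartAt_phase_self] at h
  rw [h, ofChart_self]
  rfl

theorem chartForm_pullback_dproj {μ : PhaseSpace E N k} {q : E × (E [⋀^Fin k]→L[ℝ] ℝ)}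
    (hq : q.1 ∈ (extChartAt 𝓘(ℝ, E) μ.1).target) (m : ℕ)
    (s : ∀ ν : PhaseSpace E N k, GradedForms (TangentSpace 𝓘(ℝ, E) ν.1)) :
    chartForm (I := phaseModel E k) μ m (fun ν => pullback (dproj ν) (s ν)) q =
      ((toModel (s ((extChartAt (phaseModel E k) μ).symm q)) m).compContinuousLinearMap
        (ofChart 𝓘(ℝ, E) μ.1 q.1)).compContinuousLinearMap (baseProj E k) := by
  ext w
  change toModel (s ((extChartAt (phaseModel E k) μ).symm q)) m
    (fun i => ((dprojModel ((extChartAt (phaseModel E k) μ).symm q)).comp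
      (ofChart (phaseModel E k) μ q)) (w i)) = _
  rw [dprojModel_comp_ofChart hq]
  rfl

theorem chartForm_positionForm {μ : PhaseSpace E N k} {q : E × (E [⋀^Fin k]→L[ℝ] ℝ)}
    (hq : q.1 ∈ (extChartAt 𝓘(ℝ, E) μ.1).target) (m : ℕ) (α : FormField 𝓘(ℝ, E) N) :
    chartForm μ m (positionForm k α) q =
      (chartForm μ.1 m α q.1).compContinuousLinearMap (baseProj E k) := by
  refine (chartForm_pullback_dproj hq m fun ν => α ν.1).trans ?_
  rw [extChartAt_phase_symm q.2 hq]
  rfl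

/-- The value at a point, as a linear map to the model space. -/
def evalVF (y : N) : VF 𝓘(ℝ, E) N →ₗ[ℝ] E where
  toFun ξ := ξ y
  map_add' _ _ := rfl
  map_smul' _ _ := rfl

/-- The representatives of vector fields in the chart at `x`. -/
def chartVFs (x : N) (z : E) : VF 𝓘(ℝ, E) N →ₗ[ℝ] E :=
  (toChart 𝓘(ℝ, E) x ((extChartAt 𝓘(ℝ, E) x).symm z)).toLinearMap ∘ₗ
    evalVF ((extChartAt 𝓘(ℝ, E) x).symm z)

theorem chartVFs_self (x : N) : chartVFs x (extChartAt 𝓘(ℝ, E) x x) = evalVF x := by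
  rw [chartVFs, extChartAt_to_inv, toChart_self]
  rfl

theorem ofChart_comp_chartVFs {x : N} {z : E} (hz : z ∈ (extChartAt 𝓘(ℝ, E) x).target) :
    (ofChart 𝓘(ℝ, E) x z : E →ₗ[ℝ] E) ∘ₗ chartVFs x z =
      evalVF ((extChartAt 𝓘(ℝ, E) x).symm z) := by
  ext ξ
  exact DFunLike.congr_fun (ofChart_comp_toChart hz) (evalVF ((extChartAt 𝓘(ℝ, E) x).symm z) ξ)

/-- The form `Y ⌟ θ`, that is `μ ↦ (Y ⌟ μ) ∘ π_*`, for a multivector `Y` of vector fields on the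
base. -/
def contractTheta (k : ℕ) (Y : ExteriorAlgebra ℝ (VF 𝓘(ℝ, E) N)) :
    FormField (phaseModel E k) (PhaseSpace E N k) :=
  fun μ => pullback (dproj μ) (contract (evalAt μ.1 Y) μ.form)

theorem contractTheta_one : contractTheta (E := E) (N := N) k 1 = theta E N k := by
  funext μ
  rw [contractTheta, map_one, contract_one]
  rfl

theorem chartForm_contractTheta {μ : PhaseSpace E N k} {q : E × (E [⋀^Fin k]→L[ℝ] ℝ)}
    (hq : q.1 ∈ (extChartAt 𝓘(ℝ, E) μ.1).target) (m : ℕ)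
    (Y : ExteriorAlgebra ℝ (VF 𝓘(ℝ, E) N)) :
    chartForm μ m (contractTheta k Y) q =
      (contract (ExteriorAlgebra.map (chartVFs μ.1 q.1) Y)
        (Pi.single k q.2 : GradedForms E) m).compContinuousLinearMap (baseProj E k) := by
  refine (chartForm_pullback_dproj hq m fun ν => contract (evalAt ν.1 Y) ν.form).trans ?_
  congr 1
  rw [extChartAt_phase_symm q.2 hq]
  set y := (extChartAt 𝓘(ℝ, E) μ.1).symm q.1 with hy
  have h_contract := contract_pullback (ofChart 𝓘(ℝ, E) μ.1 q.1)
    (ExteriorAlgebra.map (chartVFs μ.1 q.1) Y)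
    (Pi.single k (q.2.compContinuousLinearMap (toChart 𝓘(ℝ, E) μ.1 y)))
  have h_eval : ExteriorAlgebra.map (ofChart 𝓘(ℝ, E) μ.1 q.1 : E →ₗ[ℝ] E)
      (ExteriorAlgebra.map (chartVFs μ.1 q.1) Y) = ExteriorAlgebra.map (evalVF y) Y := by
    rw [hy, ← ofChart_comp_chartVFs hq, ← ExteriorAlgebra.map_comp_map]
    rfl
  rw [h_eval, pullback_single, hy, compContinuousLinearMap_toChart_ofChart hq] at h_contract
  exact (congrFun h_contract m).symm

end PhaseCharts

section ChartFields

variable {E H : Type*} [NormedAddCommGroup E] [NormedSpace ℝ E] [TopologicalSpace H]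
  {I : ModelWithCorners ℝ E H} {M : Type*} [TopologicalSpace M] [ChartedSpace H M]
  [IsManifold I ∞ M] [I.Boundaryless]

theorem inverse_ofChart_eventuallyEq_chartVF (x : M) (X : ∀ y : M, TangentSpace I y) :
    (fun z => (ofChart I x z).inverse (X ((extChartAt I x).symm z))) =ᶠ[𝓝 (extChartAt I x x)]
      chartVF x X := by
  filter_upwards [target_mem_nhds (mem_extChartAt_target x)] with z hz
  exact DFunLike.congr_fun (ofChart_inverse hz) (X ((extChartAt I x).symm z))

theorem mpullbackWithin_eventuallyEq_chartVF (x : M) (X : ∀ y : M, TangentSpace I y) :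
    VectorField.mpullbackWithin 𝓘(ℝ, E) I (extChartAt I x).symm X (range I)
      =ᶠ[𝓝 (extChartAt I x x)] chartVF x X := by
  refine .trans (.of_eq (funext fun z => ?_)) (inverse_ofChart_eventuallyEq_chartVF x X)
  rw [VectorField.mpullbackWithin_apply, ModelWithCorners.range_eq_univ, mfderivWithin_univ]
  rfl

theorem mlieBracket_eq_lieBracket_chartVF (X Y : ∀ y : M, TangentSpace I y) (x : M) :
    VectorField.mlieBracket I X Y x =
      VectorField.lieBracket ℝ (chartVF x X) (chartVF x Y) (extChartAt I x x) := by
  have h_chart {U V : E → E} (hU : U =ᶠ[𝓝 (extChartAt I x x)] chartVF x X)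
      (hV : V =ᶠ[𝓝 (extChartAt I x x)] chartVF x Y) :
      (toChart I x x).inverse (VectorField.lieBracketWithin ℝ U V
        ((extChartAt I x).symm ⁻¹' univ ∩ range I) (extChartAt I x x)) =
      VectorField.lieBracket ℝ (chartVF x X) (chartVF x Y) (extChartAt I x x) := by
    rw [ModelWithCorners.range_eq_univ, preimage_univ, inter_univ,
      VectorField.lieBracketWithin_univ, hU.lieBracket_vectorField_eq hV, toChart_self,
      ContinuousLinearMap.inverse_id]
    rfl
  exact h_chart (mpullbackWithin_eventuallyEq_chartVF x X)
    (mpullbackWithin_eventuallyEq_chartVF x Y)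

theorem chartForm_interior {x : M} {z : E} (hz : z ∈ (extChartAt I x).target) (m : ℕ)
    (X : ∀ y : M, TangentSpace I y) (α : FormField I M) :
    chartForm x m (fun y => interior (X y) (α y)) z =
      (chartForm x (m + 1) α z).curryLeft (chartVF x X z) := by
  have h_ofChart : ofChart I x z (chartVF x X z) = (X ((extChartAt I x).symm z) : E) :=
    DFunLike.congr_fun (ofChart_comp_toChart hz) _
  have h := ContinuousAlternatingMap.curryLeft_compContinuousLinearMap
    (toModel (α ((extChartAt I x).symm z)) (m + 1)) (ofChart I x z) (chartVF x X z)
  rw [h_ofChart] at h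
  exact h.symm

end ChartFields

section CanonicalForm

variable {E N : Type*} [NormedAddCommGroup E] [NormedSpace ℝ E] [TopologicalSpace N]
  [ChartedSpace E N] [IsManifold 𝓘(ℝ, E) ∞ N] {k : ℕ}

theorem chartDeriv_eq_fderiv_chartVF (x : N) (ξ : VF 𝓘(ℝ, E) N) :
    chartDeriv x ξ = fderiv ℝ (chartVF x ξ) (extChartAt 𝓘(ℝ, E) x x) :=
  (inverse_ofChart_eventuallyEq_chartVF x ξ).fderiv_eq

/-- The smooth vector fields on the base, represented in the chart at `x`. -/
def chartJet [CompleteSpace E] (x : N) :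
    VectorFieldJet (VF 𝓘(ℝ, E) N) (extChartAt 𝓘(ℝ, E) x x) where
  val := chartVFs x
  differentiableAt ξ :=
    (ξ.contDiffAt_chartVF (mem_extChartAt_target x)).differentiableAt (by simp)
  val_lie ξ η := (DFunLike.congr_fun (chartVFs_self x) ⁅ξ, η⁆).trans
    (mlieBracket_eq_lieBracket_chartVF ξ η x)

theorem chartJet_val_self [CompleteSpace E] (x : N) :
    (chartJet x).val (extChartAt 𝓘(ℝ, E) x x) = evalVF x := chartVFs_self x

theorem lift_chartJet_apply [CompleteSpace E] (μ : PhaseSpace E N k) (ξ : VF 𝓘(ℝ, E) N) :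
    (chartJet μ.1).lift μ.fiber ξ = completeLiftAt μ ξ := by
  refine Prod.ext (DFunLike.congr_fun (chartJet_val_self μ.1) ξ) ?_
  exact congrArg (fun B => -μ.fiber.fderivCompContinuousLinearMap (ContinuousLinearMap.id ℝ E) B)
    (chartDeriv_eq_fderiv_chartVF μ.1 ξ).symm

theorem pullback_dproj (μ : PhaseSpace E N k) (γ : GradedForms (TangentSpace 𝓘(ℝ, E) μ.1)) :
    toModel (pullback (dproj μ) γ) = pullback (baseProj E k) (toModel γ) :=
  congrArg (fun A : E × (E [⋀^Fin k]→L[ℝ] ℝ) →L[ℝ] E => pullback (W := E) A γ) (dprojModel_eq μ)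

theorem eventually_fst_mem_target (μ : PhaseSpace E N k) :
    ∀ᶠ q : E × (E [⋀^Fin k]→L[ℝ] ℝ) in 𝓝 (extChartAt (phaseModel E k) μ μ),
      q.1 ∈ (extChartAt 𝓘(ℝ, E) μ.1).target := by
  filter_upwards [target_mem_nhds (mem_extChartAt_target μ)] with q hq
  exact mem_target_phase.1 hq

theorem chartForm_contractTheta_eventuallyEq (μ : PhaseSpace E N k) (m : ℕ)
    (Y : ExteriorAlgebra ℝ (VF 𝓘(ℝ, E) N)) :
    chartForm μ m (contractTheta k Y) =ᶠ[𝓝 (extChartAt (phaseModel E k) μ μ)] fun q =>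
      pullbackCLM (baseProj E k) m
        (contract (ExteriorAlgebra.map (chartVFs μ.1 q.1) Y) (Pi.single k q.2) m) := by
  filter_upwards [eventually_fst_mem_target μ] with q hq
  exact chartForm_contractTheta hq m Y

theorem chartForm_positionForm_eventuallyEq (μ : PhaseSpace E N k) (m : ℕ)
    (α : FormField 𝓘(ℝ, E) N) :
    chartForm μ m (positionForm k α) =ᶠ[𝓝 (extChartAt (phaseModel E k) μ μ)] fun q =>
      pullbackCLM (baseProj E k) m (chartForm μ.1 m α q.1) := by
  filter_upwards [eventually_fst_mem_target μ] with q hq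
  exact chartForm_positionForm hq m α

theorem toModel_extD_contractTheta [CompleteSpace E] (μ : PhaseSpace E N k)
    (Y : ExteriorAlgebra ℝ (VF 𝓘(ℝ, E) N)) :
    toModel (extD (contractTheta k Y) μ) =
      contract (ExteriorAlgebra.map ((chartJet μ.1).lift μ.fiber) (gradeInvolution ℝ Y))
        (flatDTheta E k) +
      pullback (baseProj E k) (contract (ExteriorAlgebra.map (evalVF μ.1)
        (ceBoundary ℝ (VF 𝓘(ℝ, E) N) (gradeInvolution ℝ Y))) (Pi.single k μ.fiber)) := by
  have h := (chartJet μ.1).gradedAlt_pullback_fiberContractDeriv μ.fiber Y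
  rw [VectorFieldJet.fiberContract, chartJet_val_self] at h
  refine (toModel_extD_eq_gradedAlt fun m => ?_).trans h
  refine .congr_of_eventuallyEq ?_ (chartForm_contractTheta_eventuallyEq μ m Y)
  rw [extChartAt_phase_self]
  exact HasFDerivAt.comp (g := pullbackCLM (baseProj E k) m)
    (f := fun q => (chartJet μ.1).fiberContract Y q m) _ (pullbackCLM (baseProj E k) m).hasFDerivAt
    ((chartJet μ.1).hasFDerivAt_fiberContract μ.fiber Y m)

theorem chartForm_extD_theta {μ : PhaseSpace E N k} {q : E × (E [⋀^Fin k]→L[ℝ] ℝ)}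
    (hq : q ∈ (extChartAt (phaseModel E k) μ).target) (m : ℕ) :
    chartForm μ (m + 1) (extD (theta E N k)) q = flatDTheta E k (m + 1) := by
  have h_theta : HasFDerivAt (chartForm μ m (theta E N k)) ((pullbackCLM (baseProj E k) m).comp
      ((singleCLM E k m).comp (ContinuousLinearMap.snd ℝ E (E [⋀^Fin k]→L[ℝ] ℝ)))) q := by
    refine (ContinuousLinearMap.hasFDerivAt _).congr_of_eventuallyEq ?_
    filter_upwards [target_mem_nhds hq] with r hr
    rw [← contractTheta_one, chartForm_contractTheta (mem_target_phase.1 hr), map_one, contract_one]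
    rfl
  rw [chartForm_extD hq m h_theta.differentiableAt, extDeriv, h_theta.fderiv]
  rfl

theorem toModel_extD_theta (μ : PhaseSpace E N k) :
    toModel (extD (theta E N k) μ) = flatDTheta E k := by
  funext m
  cases m with
  | zero => rfl
  | succ m =>
    rw [← chartForm_extD_theta (mem_extChartAt_target μ), chartForm, ofChart_self,
      extChartAt_to_inv]
    rfl

theorem dproj_apply (μ : PhaseSpace E N k) (v : TangentSpace (phaseModel E k) μ) :
    dproj μ v = (show E × (E [⋀^Fin k]→L[ℝ] ℝ) from v).1 :=
  congrArg (fun A : E × (E [⋀^Fin k]→L[ℝ] ℝ) →L[ℝ] E => A v) (dprojModel_eq μ)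

theorem dproj_completeLiftAt [CompleteSpace E] (μ : PhaseSpace E N k) (ξ : VF 𝓘(ℝ, E) N) :
    dproj μ (completeLiftAt μ ξ) = ξ μ.1 := dproj_apply μ _

theorem interior_flatDTheta_inr (p : E [⋀^Fin k]→L[ℝ] ℝ) :
    interior ((0, p) : E × (E [⋀^Fin k]→L[ℝ] ℝ)) (flatDTheta E k) =
      pullback (baseProj E k) (Pi.single k p) := by
  have h_horizontal : (fun m => (interiorCLM ((0, p) : E × (E [⋀^Fin k]→L[ℝ] ℝ)) m).comp
      ((pullbackCLM (baseProj E k) (m + 1)).comp ((singleCLM E k (m + 1)).comp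
        (ContinuousLinearMap.snd ℝ E (E [⋀^Fin k]→L[ℝ] ℝ))))) = 0 := by
    funext m
    refine ContinuousLinearMap.ext fun w => ?_
    refine (congrFun (interior_pullback (baseProj E k) ((0, p) : E × (E [⋀^Fin k]→L[ℝ] ℝ))
      (Pi.single k w.2 : GradedForms E)) m).trans ?_
    rw [show baseProj E k (0, p) = 0 from rfl, map_zero]
    rfl
  rw [flatDTheta, interior_gradedAlt, h_horizontal, gradedAlt_zero, sub_zero]
  rfl

theorem curryLeft_flatDTheta_comp_inl (v : E × (E [⋀^Fin k]→L[ℝ] ℝ)) :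
    ((flatDTheta E k (k + 1)).curryLeft v).compContinuousLinearMap
      (ContinuousLinearMap.inl ℝ E (E [⋀^Fin k]→L[ℝ] ℝ)) = v.2 := by
  have h := congrFun (congrArg (pullback (ContinuousLinearMap.inl ℝ E (E [⋀^Fin k]→L[ℝ] ℝ)))
    (interior_gradedAlt v fun m => (pullbackCLM (baseProj E k) m).comp
      ((singleCLM E k m).comp (ContinuousLinearMap.snd ℝ E (E [⋀^Fin k]→L[ℝ] ℝ))))) k
  refine h.trans ?_
  have h_vertical : (fun m =>
      (pullbackCLM (ContinuousLinearMap.inl ℝ E (E [⋀^Fin k]→L[ℝ] ℝ)) m).comp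
      (((interiorCLM v m).comp ((pullbackCLM (baseProj E k) (m + 1)).comp
        ((singleCLM E k (m + 1)).comp (ContinuousLinearMap.snd ℝ E (E [⋀^Fin k]→L[ℝ] ℝ))))).comp
          (ContinuousLinearMap.inl ℝ E (E [⋀^Fin k]→L[ℝ] ℝ)))) = 0 := by
    funext m
    refine ContinuousLinearMap.ext fun w => ?_
    change pullbackCLM _ m (interiorCLM v m (pullbackCLM (baseProj E k) (m + 1)
      (singleCLM E k (m + 1) 0))) = 0
    rw [map_zero, map_zero, map_zero, map_zero]
  rw [map_sub, pullback_gradedAlt, h_vertical, gradedAlt_zero, sub_zero]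
  ext w
  change (Pi.single k v.2 : GradedForms E) k w = v.2 w
  rw [Pi.single_eq_same]

theorem baseProj_comp_toChart {μ : PhaseSpace E N k} {q : E × (E [⋀^Fin k]→L[ℝ] ℝ)}
    (hq : q ∈ (extChartAt (phaseModel E k) μ).target) :
    (baseProj E k).comp (toChart (phaseModel E k) μ ((extChartAt (phaseModel E k) μ).symm q)) =
      (toChart 𝓘(ℝ, E) μ.1 ((extChartAt 𝓘(ℝ, E) μ.1).symm q.1)).comp
        (dprojModel ((extChartAt (phaseModel E k) μ).symm q)) := by
  set T := toChart (phaseModel E k) μ ((extChartAt (phaseModel E k) μ).symm q)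
  have hq' := mem_target_phase.1 hq
  calc (baseProj E k).comp T
      = ((toChart 𝓘(ℝ, E) μ.1 ((extChartAt 𝓘(ℝ, E) μ.1).symm q.1)).comp
          (ofChart 𝓘(ℝ, E) μ.1 q.1)).comp ((baseProj E k).comp T) := by
        rw [toChart_comp_ofChart hq', ContinuousLinearMap.id_comp]
    _ = (toChart 𝓘(ℝ, E) μ.1 ((extChartAt 𝓘(ℝ, E) μ.1).symm q.1)).comp
          (((ofChart 𝓘(ℝ, E) μ.1 q.1).comp (baseProj E k)).comp T) := rfl
    _ = _ := by
        rw [← dprojModel_comp_ofChart hq', ContinuousLinearMap.comp_assoc, ofChart_comp_toChart hq,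
          ContinuousLinearMap.comp_id]

theorem fst_chartVF {X : ∀ μ : PhaseSpace E N k, TangentSpace (phaseModel E k) μ}
    {ξ : VF 𝓘(ℝ, E) N} (hX : ∀ μ, dproj μ (X μ) = ξ μ.1) {μ : PhaseSpace E N k}
    {q : E × (E [⋀^Fin k]→L[ℝ] ℝ)} (hq : q ∈ (extChartAt (phaseModel E k) μ).target) :
    (chartVF (I := phaseModel E k) μ X q).1 = chartVF μ.1 ξ q.1 := by
  set ν := (extChartAt (phaseModel E k) μ).symm q
  have h_base : ν.1 = (extChartAt 𝓘(ℝ, E) μ.1).symm q.1 :=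
    congrArg (fun ν : PhaseSpace E N k => ν.1) (extChartAt_phase_symm q.2 (mem_target_phase.1 hq))
  have h_value : dprojModel ν (X ν) = evalVF ((extChartAt 𝓘(ℝ, E) μ.1).symm q.1) ξ := by
    rw [← h_base]
    exact hX ν
  exact (DFunLike.congr_fun (baseProj_comp_toChart hq) (X ν)).trans
    (congrArg (toChart 𝓘(ℝ, E) μ.1 ((extChartAt 𝓘(ℝ, E) μ.1).symm q.1)) h_value)

theorem contDiffAt_compContinuousLinearMap {V W U : Type*} [NormedAddCommGroup V]
    [NormedSpace ℝ V] [NormedAddCommGroup W] [NormedSpace ℝ W] [NormedAddCommGroup U]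
    [NormedSpace ℝ U] {m : ℕ} {n : WithTop ℕ∞} {g : U → W [⋀^Fin m]→L[ℝ] ℝ} {u : U}
    (hg : ContDiffAt ℝ n g u) (f : V →L[ℝ] W) :
    ContDiffAt ℝ n (fun u => (g u).compContinuousLinearMap f) u :=
  ContDiffAt.comp (g := pullbackCLM f m) u (pullbackCLM f m).contDiff.contDiffAt hg

/-- The base component of `X` is that of `ξ`, and its fibre component is the restriction of
`X ⌟ dθ` to horizontal vectors. -/
theorem contDiffAt_chartVF_of_interior_extD_theta
    {X : ∀ μ : PhaseSpace E N k, TangentSpace (phaseModel E k) μ}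
    (ξ : VF 𝓘(ℝ, E) N) (hX : ∀ μ, dproj μ (X μ) = ξ μ.1)
    {β : FormField (phaseModel E k) (PhaseSpace E N k)} (hβ : IsForm k β)
    (hXβ : ∀ μ, interior (X μ) (extD (theta E N k) μ) = β μ) (μ : PhaseSpace E N k) :
    ContDiffAt ℝ ∞ (chartVF (I := phaseModel E k) μ X) (extChartAt (phaseModel E k) μ μ) := by
  have hμ := mem_extChartAt_target (I := phaseModel E k) μ
  have h_base : ContDiffAt ℝ ∞ (fun q : E × (E [⋀^Fin k]→L[ℝ] ℝ) => chartVF μ.1 ξ q.1)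
      (extChartAt (phaseModel E k) μ μ) :=
    ContDiffAt.comp (g := chartVF μ.1 ξ) (f := Prod.fst) _
      (ξ.contDiffAt_chartVF (mem_target_phase.1 hμ)) contDiffAt_fst
  have h_fiber := contDiffAt_compContinuousLinearMap (hβ.contDiffAt_chartForm hμ k)
    (ContinuousLinearMap.inl ℝ E (E [⋀^Fin k]→L[ℝ] ℝ))
  refine (h_base.prodMk h_fiber).congr_of_eventuallyEq ?_
  filter_upwards [target_mem_nhds hμ] with q hq
  refine Prod.ext (fst_chartVF hX hq) ?_
  rw [← funext hXβ, chartForm_interior hq k X (extD (theta E N k)), chartForm_extD_theta hq]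
  exact (curryLeft_flatDTheta_comp_inl _).symm

end CanonicalForm

section PhaseForms

variable {E N : Type*} [NormedAddCommGroup E] [NormedSpace ℝ E] [TopologicalSpace N]
  [ChartedSpace E N] [IsManifold 𝓘(ℝ, E) ∞ N] {k : ℕ}

theorem contractTheta_eq_zero {Y : ExteriorAlgebra ℝ (VF 𝓘(ℝ, E) N)}
    (hY : ∀ x, evalAt x Y = 0) : contractTheta k Y = 0 := by
  funext μ
  rw [contractTheta, hY, contract_zero, map_zero]
  rfl

theorem contractTheta_add (X Y : ExteriorAlgebra ℝ (VF 𝓘(ℝ, E) N)) :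
    contractTheta k (X + Y) = contractTheta k X + contractTheta k Y := by
  funext μ
  rw [contractTheta, map_add, contract_add, map_add]
  rfl

theorem contractTheta_smul (c : ℝ) (Y : ExteriorAlgebra ℝ (VF 𝓘(ℝ, E) N)) :
    contractTheta k (c • Y) = c • contractTheta k Y := by
  funext μ
  rw [contractTheta, map_smul, contract_smul, map_smul]
  rfl

theorem momentumForm_eq_contractTheta (l : ℕ) (Y : ExteriorAlgebra ℝ (VF 𝓘(ℝ, E) N)) :
    momentumForm k l Y = contractTheta k (-zeta (l + 1) • Y) := by
  rw [contractTheta_smul]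
  rfl

theorem contDiffAt_contract_chartVFs {x : N} {q : E × (E [⋀^Fin k]→L[ℝ] ℝ)}
    (hq : q.1 ∈ (extChartAt 𝓘(ℝ, E) x).target) (m : ℕ)
    (Y : ExteriorAlgebra ℝ (VF 𝓘(ℝ, E) N)) :
    ContDiffAt ℝ ∞ (fun q : E × (E [⋀^Fin k]→L[ℝ] ℝ) =>
      contract (ExteriorAlgebra.map (chartVFs x q.1) Y) (Pi.single k q.2 : GradedForms E) m) q := by
  induction Y using exteriorAlgebra_right_induction generalizing m with
  | one =>
    simp only [map_one, contract_one]
    exact ((singleCLM E k m).comp (ContinuousLinearMap.snd ℝ E _)).contDiff.contDiffAt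
  | smul r Y hY =>
    simp only [map_smul, contract_smul, Pi.smul_apply]
    exact (hY m).const_smul r
  | add X Y hX hY =>
    simp only [map_add, contract_add, Pi.add_apply]
    exact (hX m).add (hY m)
  | mul_ι Y ξ hY =>
    simp only [map_mul, contract_mul, ExteriorAlgebra.map_apply_ι, contract_ι,
      interior_eq_curryLeft]
    have h_field : ContDiffAt ℝ ∞ (fun q : E × (E [⋀^Fin k]→L[ℝ] ℝ) => chartVFs x q.1 ξ) q :=
      ContDiffAt.comp (g := chartVF x ξ) (f := Prod.fst) q (ξ.contDiffAt_chartVF hq)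
        contDiffAt_fst
    exact ContDiffAt.comp (g := fun q : (E [⋀^Fin (m + 1)]→L[ℝ] ℝ) × E => q.1.curryLeft q.2)
      (f := fun q : E × (E [⋀^Fin k]→L[ℝ] ℝ) => (contract (ExteriorAlgebra.map (chartVFs x q.1) Y)
        (Pi.single k q.2 : GradedForms E) (m + 1), chartVFs x q.1 ξ)) q
      (isBoundedBilinearMap_curryLeft m).contDiff.contDiffAt ((hY (m + 1)).prodMk h_field)

theorem isForm_contractTheta {l : ℕ} (hl : l ≤ k) {Y : ExteriorAlgebra ℝ (VF 𝓘(ℝ, E) N)}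
    (hY : Y ∈ ⋀[ℝ]^l (VF 𝓘(ℝ, E) N)) : IsForm (k - l) (contractTheta k Y) := by
  refine isForm_of_contDiffAt (fun μ m hm => ?_) fun μ => ?_
  · have h_degree : contract (evalAt μ.1 Y) μ.form m = 0 :=
      contract_apply_eq_zero (exteriorAlgebra_map_mem_exteriorPower _ hY)
        (fun _ hm => Pi.single_eq_of_ne hm _) (by lia)
    rw [contractTheta, pullback_apply, h_degree]
    rfl
  · refine .congr_of_eventuallyEq ?_ (chartForm_contractTheta_eventuallyEq μ (k - l) Y)
    have hμ := mem_target_phase.1 (mem_extChartAt_target (I := phaseModel E k) μ)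
    exact contDiffAt_compContinuousLinearMap (contDiffAt_contract_chartVFs hμ (k - l) Y)
      (baseProj E k)

theorem isForm_positionForm {p : ℕ} {α : FormField 𝓘(ℝ, E) N} (hα : IsForm p α) :
    IsForm p (positionForm k α) := by
  refine isForm_of_contDiffAt (fun μ m hm => ?_) fun μ => ?_
  · rw [positionForm, pullback_apply, hα.1 _ _ hm]
    rfl
  · refine .congr_of_eventuallyEq ?_ (chartForm_positionForm_eventuallyEq μ p α)
    have hμ := mem_target_phase.1 (mem_extChartAt_target (I := phaseModel E k) μ)
    exact contDiffAt_compContinuousLinearMap (ContDiffAt.comp (g := chartForm μ.1 p α)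
      (f := Prod.fst) _ (hα.contDiffAt_chartForm hμ p) contDiffAt_fst) (baseProj E k)

theorem extD_positionForm {p : ℕ} {α : FormField 𝓘(ℝ, E) N} (hα : IsForm p α) :
    extD (positionForm k α) = positionForm k (extD α) := by
  funext μ
  have h_base (m : ℕ) : HasFDerivAt (chartForm μ.1 m α) (fderiv ℝ (chartForm μ.1 m α)
      (extChartAt 𝓘(ℝ, E) μ.1 μ.1)) (extChartAt 𝓘(ℝ, E) μ.1 μ.1) :=
    ((hα.contDiffAt_chartForm (mem_extChartAt_target μ.1) m).differentiableAt
      (by simp)).hasFDerivAt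
  have h_phase (m : ℕ) : HasFDerivAt (chartForm μ m (positionForm k α))
      ((pullbackCLM (baseProj E k) m).comp ((fderiv ℝ (chartForm μ.1 m α)
        (extChartAt 𝓘(ℝ, E) μ.1 μ.1)).comp (baseProj E k)))
      (extChartAt (phaseModel E k) μ μ) := by
    refine .congr_of_eventuallyEq ?_ (chartForm_positionForm_eventuallyEq μ m α)
    rw [extChartAt_phase_self]
    exact HasFDerivAt.comp (g := pullbackCLM (baseProj E k) m)
      (f := fun q : E × (E [⋀^Fin k]→L[ℝ] ℝ) => chartForm μ.1 m α q.1) _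
      (pullbackCLM (baseProj E k) m).hasFDerivAt
      (HasFDerivAt.comp (g := chartForm μ.1 m α) (f := Prod.fst) (_, μ.fiber) (h_base m)
        (baseProj E k).hasFDerivAt)
  calc toModel (extD (positionForm k α) μ)
      = pullback (baseProj E k) (gradedAlt fun m => fderiv ℝ (chartForm μ.1 m α)
          (extChartAt 𝓘(ℝ, E) μ.1 μ.1)) := by
        rw [toModel_extD_eq_gradedAlt h_phase, pullback_gradedAlt]
    _ = toModel (positionForm k (extD α) μ) := by
        rw [← toModel_extD_eq_gradedAlt h_base, positionForm, pullback_dproj]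

end PhaseForms

section Lifts

variable {E N : Type*} [NormedAddCommGroup E] [NormedSpace ℝ E] [TopologicalSpace N]
  [ChartedSpace E N] [IsManifold 𝓘(ℝ, E) ∞ N] {k : ℕ}

/-- The vertical vector at `μ` given by a `k`-form on the model space. -/
def verticalAt (μ : PhaseSpace E N k) (p : E [⋀^Fin k]→L[ℝ] ℝ) : TangentSpace (phaseModel E k) μ :=
  ((0, p) : E × (E [⋀^Fin k]→L[ℝ] ℝ))

theorem dproj_verticalAt (μ : PhaseSpace E N k) (p : E [⋀^Fin k]→L[ℝ] ℝ) :
    dproj μ (verticalAt μ p) = 0 := dproj_apply μ _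

theorem interior_verticalAt (μ : PhaseSpace E N k) (p : E [⋀^Fin k]→L[ℝ] ℝ) :
    interior (verticalAt μ p) (extD (theta E N k) μ) =
      pullback (dproj μ) (Pi.single k p : GradedForms E) :=
  calc toModel (interior (verticalAt μ p) (extD (theta E N k) μ))
      = interior ((0, p) : E × (E [⋀^Fin k]→L[ℝ] ℝ)) (toModel (extD (theta E N k) μ)) := rfl
    _ = toModel (pullback (dproj μ) (Pi.single k p : GradedForms E)) := by
        rw [toModel_extD_theta, interior_flatDTheta_inr]
        exact (pullback_dproj μ _).symm

theorem interior_verticalAt_of_isForm {η : FormField 𝓘(ℝ, E) N} (hη : IsForm k η)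
    (μ : PhaseSpace E N k) :
    interior (verticalAt μ (toModel (η μ.1) k)) (extD (theta E N k) μ) = positionForm k η μ := by
  have h_single : (Pi.single k (toModel (η μ.1) k) : GradedForms E) = toModel (η μ.1) := by
    funext m
    by_cases hm : m = k
    · subst hm
      exact Pi.single_eq_same _ _
    · exact (Pi.single_eq_of_ne hm _).trans (hη.1 _ _ hm).symm
  exact (interior_verticalAt μ _).trans (congrArg (pullback (dproj μ)) h_single)

/-- The vertical lift of a `k`-form on the base: the vertical vector field which is constantly
`η x` on the fibre over `x`. -/
def verticalLift {η : FormField 𝓘(ℝ, E) N} (hη : IsForm k η) :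
    VF (phaseModel E k) (PhaseSpace E N k) :=
  .ofContDiffAt (fun μ => verticalAt μ (toModel (η μ.1) k))
    (contDiffAt_chartVF_of_interior_extD_theta 0 (fun μ => dproj_verticalAt μ _)
      (isForm_positionForm hη) (interior_verticalAt_of_isForm hη))

variable [CompleteSpace E]

theorem contract_completeLift_pullback (μ : PhaseSpace E N k)
    (Y : ExteriorAlgebra ℝ (VF 𝓘(ℝ, E) N)) (γ : GradedForms (TangentSpace 𝓘(ℝ, E) μ.1)) :
    contract (completeLift k Y μ) (pullback (dproj μ) γ) =
      pullback (dproj μ) (contract (evalAt μ.1 Y) γ) := by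
  have h_eval : (dproj μ).toLinearMap ∘ₗ completeLiftAt μ =
      { toFun := fun X => X μ.1, map_add' := fun _ _ => rfl, map_smul' := fun _ _ => rfl } :=
    LinearMap.ext fun ξ => dproj_completeLiftAt μ ξ
  rw [contract_pullback, completeLift, ← AlgHom.comp_apply, ExteriorAlgebra.map_comp_map, h_eval]
  rfl

theorem contractField_completeLift_contractTheta (X Y : ExteriorAlgebra ℝ (VF 𝓘(ℝ, E) N)) :
    contractField (completeLift k Y) (contractTheta k X) = contractTheta k (X * Y) := by
  funext μ
  rw [contractField, contractTheta, contract_completeLift_pullback, contractTheta, map_mul,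
    contract_mul]

theorem extD_contractTheta (Y : ExteriorAlgebra ℝ (VF 𝓘(ℝ, E) N)) :
    extD (contractTheta k Y) =
      contractField (completeLift k (gradeInvolution ℝ Y)) (extD (theta E N k)) +
        contractTheta k (ceBoundary ℝ (VF 𝓘(ℝ, E) N) (gradeInvolution ℝ Y)) := by
  funext μ
  have h_lift : (chartJet μ.1).lift μ.fiber = completeLiftAt μ :=
    LinearMap.ext fun ξ => lift_chartJet_apply μ ξ
  refine (toModel_extD_contractTheta μ Y).trans ?_
  rw [h_lift, ← toModel_extD_theta μ]
  exact congrArg (toModel (contractField (completeLift k (gradeInvolution ℝ Y))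
    (extD (theta E N k)) μ) + ·) (pullback_dproj μ _).symm

theorem interior_completeLiftAt (μ : PhaseSpace E N k) (ξ : VF 𝓘(ℝ, E) N) :
    interior (completeLiftAt μ ξ) (extD (theta E N k) μ) =
      extD (contractTheta k (ExteriorAlgebra.ι ℝ (-ξ))) μ := by
  have h_closed : ceBoundary ℝ (VF 𝓘(ℝ, E) N) (ExteriorAlgebra.ι ℝ ξ) = 0 := by
    simpa using ceBoundary_ι_mul (R := ℝ) ξ (1 : ExteriorAlgebra ℝ (VF 𝓘(ℝ, E) N))
  rw [extD_contractTheta, gradeInvolution_ι, map_neg, neg_neg, h_closed,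
    contractTheta_eq_zero (fun _ => map_zero _), add_zero, contractField, completeLift,
    ExteriorAlgebra.map_apply_ι, contract_ι]

/-- The complete lift `ξ^♯` as a smooth vector field on the phase space. -/
def completeLiftVF (hk : 1 ≤ k) (ξ : VF 𝓘(ℝ, E) N) : VF (phaseModel E k) (PhaseSpace E N k) :=
  have h_form : IsForm k (extD (contractTheta k (ExteriorAlgebra.ι ℝ (-ξ)))) := by
    have h := (isForm_contractTheta hk (Y := ExteriorAlgebra.ι ℝ (-ξ)) (by simp)).extD
    rwa [Nat.sub_add_cancel hk] at h
  .ofContDiffAt (fun μ => completeLiftAt μ ξ)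
    (contDiffAt_chartVF_of_interior_extD_theta ξ (fun μ => dproj_completeLiftAt μ ξ) h_form
      fun μ => interior_completeLiftAt μ ξ)

end Lifts

section MultivectorFields

variable {E H : Type*} [NormedAddCommGroup E] [NormedSpace ℝ E] [TopologicalSpace H]
  {I : ModelWithCorners ℝ E H} {M : Type*} [TopologicalSpace M] [ChartedSpace H M]

theorem contractField_smul_left (c : ℝ) (X : MultivectorField I M) (α : FormField I M) :
    contractField (c • X) α = c • contractField X α :=
  funext fun x => contract_smul c (X x) (α x)

theorem contractField_smul_right (c : ℝ) (X : MultivectorField I M) (α : FormField I M) :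
    contractField X (c • α) = c • contractField X α :=
  funext fun x => map_smul (contract (X x)) c (α x)

theorem contractField_neg_right (X : MultivectorField I M) (α : FormField I M) :
    contractField X (-α) = -contractField X α :=
  funext fun x => map_neg (contract (X x)) (α x)

variable [IsManifold I ∞ M] {l : ℕ} {X Y : MultivectorField I M} {x₀ : M}

/-- Smoothness of a field of multivectors of degree `l` near a point; `IsMultivectorField l X`
says that it holds at every point. -/
def IsMultivectorFieldAt (l : ℕ) (X : MultivectorField I M) (x₀ : M) : Prop :=
  ∃ (n : ℕ) (f : Fin n → C^∞⟮I, M; ℝ⟯) (V : Fin n → Fin l → VF I M),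
    ∀ᶠ x in 𝓝 x₀, X x = ∑ a, f a x • ExteriorAlgebra.ιMulti ℝ l (fun j => V a j x)

theorem IsMultivectorFieldAt.congr_of_eventuallyEq (h : IsMultivectorFieldAt l X x₀)
    (hY : ∀ᶠ x in 𝓝 x₀, Y x = X x) : IsMultivectorFieldAt l Y x₀ := by
  obtain ⟨n, f, V, hX⟩ := h
  exact ⟨n, f, V, by filter_upwards [hX, hY] with x hX hY using hY.trans hX⟩

theorem isMultivectorFieldAt_zero : IsMultivectorFieldAt l (0 : MultivectorField I M) x₀ :=
  ⟨0, Fin.elim0, Fin.elim0, .of_forall fun x => by simp⟩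

theorem IsMultivectorFieldAt.add (hX : IsMultivectorFieldAt l X x₀)
    (hY : IsMultivectorFieldAt l Y x₀) : IsMultivectorFieldAt l (X + Y) x₀ := by
  obtain ⟨n, f, V, hX⟩ := hX
  obtain ⟨n', f', V', hY⟩ := hY
  refine ⟨n + n', Fin.append f f', Fin.append V V', ?_⟩
  filter_upwards [hX, hY] with x hX hY
  rw [Pi.add_apply, hX, hY, Fin.sum_univ_add]
  simp only [Fin.append_left, Fin.append_right]

theorem IsMultivectorFieldAt.smul (g : C^∞⟮I, M; ℝ⟯) (hX : IsMultivectorFieldAt l X x₀) :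
    IsMultivectorFieldAt l (fun x => g x • X x) x₀ := by
  obtain ⟨n, f, V, hX⟩ := hX
  refine ⟨n, fun a => g * f a, V, ?_⟩
  filter_upwards [hX] with x hX
  rw [hX, Finset.smul_sum]
  exact Finset.sum_congr rfl fun a _ => smul_smul _ _ _

theorem IsMultivectorFieldAt.const_smul (c : ℝ) (hX : IsMultivectorFieldAt l X x₀) :
    IsMultivectorFieldAt l (c • X) x₀ :=
  hX.smul (ContMDiffMap.const c)

theorem isMultivectorFieldAt_ιMulti (V : Fin l → VF I M) :
    IsMultivectorFieldAt l (fun x => ExteriorAlgebra.ιMulti ℝ l fun j => V j x) x₀ :=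
  ⟨1, fun _ => 1, fun _ => V, .of_forall fun x => by simp⟩

theorem IsMultivectorFieldAt.sum {ι : Type*} (s : Finset ι) {X : ι → MultivectorField I M}
    (h : ∀ i ∈ s, IsMultivectorFieldAt l (X i) x₀) : IsMultivectorFieldAt l (∑ i ∈ s, X i) x₀ :=
  Finset.sum_induction X (IsMultivectorFieldAt l · x₀) (fun _ _ => .add)
    isMultivectorFieldAt_zero h

end MultivectorFields

section Signs

theorem zeta_succ (l : ℕ) : zeta (l + 1) = (-1) ^ (l + 1) * zeta l := by
  have h_triangle : (l + 1) * (l + 1 + 1) / 2 = l * (l + 1) / 2 + (l + 1) := by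
    rw [← Nat.add_mul_div_right _ _ two_pos]
    congr 1
    ring
  rw [zeta, h_triangle, pow_add, zeta]
  ring

theorem zeta_add (s t : ℕ) : zeta (s + t) = -((-1) ^ (s * t) * zeta s * zeta t) := by
  have h_triangle : (s + t) * (s + t + 1) / 2 =
      s * (s + 1) / 2 + t * (t + 1) / 2 + s * t := by
    obtain ⟨a, ha⟩ := (Nat.even_mul_succ_self s).two_dvd
    obtain ⟨b, hb⟩ := (Nat.even_mul_succ_self t).two_dvd
    have : (s + t) * (s + t + 1) = s * (s + 1) + t * (t + 1) + 2 * (s * t) := by ring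
    lia
  rw [zeta, h_triangle, pow_add, pow_add, zeta, zeta]
  ring

theorem neg_one_pow_mul_self (n : ℕ) : (-1 : ℝ) ^ n * (-1) ^ n = 1 := by
  rw [← mul_pow, neg_one_mul, neg_neg, one_pow]

theorem neg_one_pow_mul_zeta_add (s t : ℕ) :
    (-1) ^ (t * s + s + t) * zeta (s + t) = -((-1) ^ (s + t) * zeta s * zeta t) := by
  rw [zeta_add, add_assoc, pow_add, mul_comm t s]
  linear_combination (-(-1) ^ (s + t) * zeta s * zeta t) * neg_one_pow_mul_self (s * t)

theorem neg_one_pow_mul_zeta_succ_mul_zeta_succ (s t : ℕ) :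
    (-1) ^ (t * (s + 1)) * zeta (s + 1) * zeta (t + 1) =
      (-1) ^ s * (-1) ^ (t * s) * zeta s * zeta t := by
  rw [zeta_succ, zeta_succ, mul_add_one, pow_add, pow_succ, pow_succ]
  linear_combination ((-1) ^ s * (-1) ^ (t * s) * zeta s * zeta t) * neg_one_pow_mul_self t

end Signs

section MomentumForms

variable {E N : Type*} [NormedAddCommGroup E] [NormedSpace ℝ E] [TopologicalSpace N]
  [ChartedSpace E N] [IsManifold 𝓘(ℝ, E) ∞ N] {k : ℕ}

theorem isForm_momentumForm {l : ℕ} (hl : l ≤ k) {Y : ExteriorAlgebra ℝ (VF 𝓘(ℝ, E) N)}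
    (hY : Y ∈ ⋀[ℝ]^l (VF 𝓘(ℝ, E) N)) : IsForm (k - l) (momentumForm k l Y) := by
  rw [momentumForm_eq_contractTheta]
  exact isForm_contractTheta hl (Submodule.smul_mem _ _ hY)

variable [CompleteSpace E]

theorem contractTheta_ceBoundary_mul {s t : ℕ} {Y₁ Y₂ : ExteriorAlgebra ℝ (VF 𝓘(ℝ, E) N)}
    (h₁ : Y₁ ∈ lieKernel 𝓘(ℝ, E) N s) (h₂ : Y₂ ∈ lieKernel 𝓘(ℝ, E) N t) :
    contractTheta k (ceBoundary ℝ (VF 𝓘(ℝ, E) N) (Y₁ * Y₂)) =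
      (-1 : ℝ) ^ s • contractTheta k (schoutenVF Y₁ Y₂) := by
  have h_boundaries : contractTheta k (ceBoundary ℝ (VF 𝓘(ℝ, E) N) Y₁ * Y₂ +
      gradeInvolution ℝ Y₁ * ceBoundary ℝ (VF 𝓘(ℝ, E) N) Y₂) = 0 :=
    contractTheta_eq_zero fun x => by
      rw [map_add, map_mul, map_mul, h₁.2, h₂.2, zero_mul, mul_zero, add_zero]
  rw [ceBoundary_mul, contractTheta_add, h_boundaries, zero_add, gradeInvolution_eq_smul h₁.1,
    schouten_smul_left, contractTheta_smul]
  rfl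

theorem completeLift_smul (c : ℝ) (Y : ExteriorAlgebra ℝ (VF 𝓘(ℝ, E) N)) :
    completeLift k (c • Y) = c • completeLift k Y :=
  funext fun _ => map_smul _ c Y

theorem isMultivectorField_completeLift (hk : 1 ≤ k) {l : ℕ}
    {Y : ExteriorAlgebra ℝ (VF 𝓘(ℝ, E) N)} (hY : Y ∈ ⋀[ℝ]^l (VF 𝓘(ℝ, E) N)) :
    IsMultivectorField l (completeLift k Y) := by
  intro μ
  change IsMultivectorFieldAt l (completeLift k Y) μ
  rw [← ExteriorAlgebra.ιMulti_span_fixedDegree] at hY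
  induction hY using Submodule.span_induction with
  | mem Y hY =>
    obtain ⟨ξ, rfl⟩ := hY
    refine (isMultivectorFieldAt_ιMulti fun j => completeLiftVF hk (ξ j)).congr_of_eventuallyEq
      (.of_forall fun ν => ?_)
    rw [completeLift, ExteriorAlgebra.map_apply_ιMulti]
    rfl
  | zero => exact isMultivectorFieldAt_zero.congr_of_eventuallyEq (.of_forall fun _ => map_zero _)
  | add X Y _ _ hX hY =>
    exact (hX.add hY).congr_of_eventuallyEq (.of_forall fun _ => map_add _ _ _)
  | smul c Y _ hY =>
    rw [completeLift_smul]
    exact hY.const_smul c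

theorem extD_contractTheta_smul (c : ℝ) (Y : ExteriorAlgebra ℝ (VF 𝓘(ℝ, E) N)) :
    extD (contractTheta k (c • Y)) = c • extD (contractTheta k Y) := by
  rw [extD_contractTheta, extD_contractTheta, map_smul, map_smul, completeLift_smul,
    contractField_smul_left, contractTheta_smul, smul_add]

theorem extD_momentumForm {l : ℕ} {Y : ExteriorAlgebra ℝ (VF 𝓘(ℝ, E) N)}
    (hY : Y ∈ lieKernel 𝓘(ℝ, E) N l) :
    extD (momentumForm k l Y) = -contractField (zeta l • completeLift k Y) (omega E N k) := by
  have h_sign : -zeta (l + 1) * (-1) ^ l = zeta l := by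
    rw [zeta_succ, pow_succ]
    linear_combination zeta l * neg_one_pow_mul_self l
  have h_closed : contractTheta k (ceBoundary ℝ (VF 𝓘(ℝ, E) N) Y) = 0 :=
    contractTheta_eq_zero hY.2
  calc extD (momentumForm k l Y)
      = (-zeta (l + 1) * (-1) ^ l) • contractField (completeLift k Y) (extD (theta E N k)) := by
        rw [momentumForm_eq_contractTheta, extD_contractTheta_smul, extD_contractTheta,
          gradeInvolution_eq_smul hY.1, map_smul, contractTheta_smul, h_closed, smul_zero,
          add_zero, completeLift_smul, contractField_smul_left, smul_smul]
    _ = -contractField (zeta l • completeLift k Y) (omega E N k) := by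
        rw [h_sign, omega, contractField_neg_right, neg_neg, contractField_smul_left]

theorem isHamiltonianField_momentumForm (hk : 1 ≤ k) {l : ℕ}
    {Y : ExteriorAlgebra ℝ (VF 𝓘(ℝ, E) N)} (hY : Y ∈ lieKernel 𝓘(ℝ, E) N l) :
    IsHamiltonianField (omega E N k) l (momentumForm k l Y) (zeta l • completeLift k Y) :=
  ⟨fun μ => IsMultivectorFieldAt.const_smul _ (isMultivectorField_completeLift hk hY.1 μ),
    extD_momentumForm hY⟩

theorem contractField_completeLift_mul (Y₁ Y₂ : ExteriorAlgebra ℝ (VF 𝓘(ℝ, E) N))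
    (α : FormField (phaseModel E k) (PhaseSpace E N k)) :
    contractField (completeLift k (Y₁ * Y₂)) α =
      contractField (completeLift k Y₂) (contractField (completeLift k Y₁) α) := by
  funext μ
  rw [contractField, completeLift, map_mul, contract_mul]
  rfl

theorem contractField_smul_completeLift_omega (a b : ℝ)
    (Y₁ Y₂ : ExteriorAlgebra ℝ (VF 𝓘(ℝ, E) N)) :
    contractField (b • completeLift k Y₂) (contractField (a • completeLift k Y₁) (omega E N k)) =
      -(b * a) • contractField (completeLift k (Y₁ * Y₂)) (extD (theta E N k)) := by
  rw [contractField_smul_left, contractField_smul_left, contractField_smul_right, omega,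
    contractField_neg_right, contractField_neg_right, ← contractField_completeLift_mul, smul_neg,
    smul_neg, smul_smul]
  exact (neg_smul _ _).symm

theorem contractField_completeLift_completeLift_theta {s t : ℕ}
    {Y₁ Y₂ : ExteriorAlgebra ℝ (VF 𝓘(ℝ, E) N)} (h₁ : Y₁ ∈ ⋀[ℝ]^s (VF 𝓘(ℝ, E) N))
    (h₂ : Y₂ ∈ ⋀[ℝ]^t (VF 𝓘(ℝ, E) N)) :
    contractField (completeLift k Y₁) (contractField (completeLift k Y₂) (theta E N k)) =
      contractTheta k ((-1 : ℝ) ^ (t * s) • (Y₁ * Y₂)) := by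
  rw [← contractTheta_one, contractField_completeLift_contractTheta,
    contractField_completeLift_contractTheta, one_mul, mul_comm_of_mem h₂ h₁]

theorem extD_contractTheta_mul {s t : ℕ} {Y₁ Y₂ : ExteriorAlgebra ℝ (VF 𝓘(ℝ, E) N)}
    (h₁ : Y₁ ∈ lieKernel 𝓘(ℝ, E) N s) (h₂ : Y₂ ∈ lieKernel 𝓘(ℝ, E) N t) :
    extD (contractTheta k (Y₁ * Y₂)) = ((-1 : ℝ) ^ s * (-1) ^ t) •
      (contractField (completeLift k (Y₁ * Y₂)) (extD (theta E N k)) +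
        (-1 : ℝ) ^ s • contractTheta k (schoutenVF Y₁ Y₂)) := by
  have h_involution : gradeInvolution ℝ (Y₁ * Y₂) = ((-1 : ℝ) ^ s * (-1) ^ t) • (Y₁ * Y₂) := by
    rw [map_mul, gradeInvolution_eq_smul h₁.1, gradeInvolution_eq_smul h₂.1, smul_mul_smul_comm]
  rw [extD_contractTheta, h_involution, map_smul, contractTheta_smul,
    contractTheta_ceBoundary_mul h₁ h₂, completeLift_smul, contractField_smul_left, smul_add]

theorem hamBracket_momentumForm (hk : 1 ≤ k) {s t : ℕ} (hs : 1 ≤ s)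
    {Y₁ Y₂ : ExteriorAlgebra ℝ (VF 𝓘(ℝ, E) N)} (h₁ : Y₁ ∈ lieKernel 𝓘(ℝ, E) N s)
    (h₂ : Y₂ ∈ lieKernel 𝓘(ℝ, E) N t) :
    hamBracket (omega E N k) s t (momentumForm k s Y₁) (momentumForm k t Y₂) =
      -(-1 : ℝ) ^ (t * s + s + t) • momentumForm k (s + t - 1) (schoutenVF Y₁ Y₂) +
        ((-1 : ℝ) ^ (t * (s + 1)) * zeta (s + 1) * zeta (t + 1)) •
          extD (contractField (completeLift k Y₁)
            (contractField (completeLift k Y₂) (theta E N k))) := by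
  set A := contractField (completeLift k (Y₁ * Y₂)) (extD (theta E N k))
  set B := contractTheta k (schoutenVF Y₁ Y₂) with hB
  have h_bracket : hamBracket (omega E N k) s t (momentumForm k s Y₁) (momentumForm k t Y₂) =
      ((-1 : ℝ) ^ t * zeta s * zeta t) • A := by
    rw [hamBracket_eq (isHamiltonianField_momentumForm hk h₁)
      (isHamiltonianField_momentumForm hk h₂), contractField_smul_completeLift_omega, smul_smul,
      pow_succ]
    congr 1
    ring
  have h_schouten : -(-1 : ℝ) ^ (t * s + s + t) • momentumForm k (s + t - 1) (schoutenVF Y₁ Y₂) =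
      -((-1 : ℝ) ^ (s + t) * zeta s * zeta t) • B := by
    rw [momentumForm_eq_contractTheta, contractTheta_smul, ← hB, smul_smul, neg_mul_neg,
      Nat.sub_add_cancel (hs.trans (Nat.le_add_right s t)), neg_one_pow_mul_zeta_add]
  have h_exact : ((-1 : ℝ) ^ (t * (s + 1)) * zeta (s + 1) * zeta (t + 1)) •
      extD (contractField (completeLift k Y₁) (contractField (completeLift k Y₂) (theta E N k))) =
        ((-1 : ℝ) ^ t * zeta s * zeta t) • (A + (-1 : ℝ) ^ s • B) := by
    rw [contractField_completeLift_completeLift_theta h₁.1 h₂.1, extD_contractTheta_smul,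
      extD_contractTheta_mul h₁ h₂, smul_smul, smul_smul, neg_one_pow_mul_zeta_succ_mul_zeta_succ]
    congr 1
    linear_combination (-1) ^ t * zeta s * zeta t *
      ((-1) ^ (t * s) * (-1) ^ (t * s) * neg_one_pow_mul_self s + neg_one_pow_mul_self (t * s))
  rw [h_bracket, h_schouten, h_exact, smul_add, smul_smul, pow_add]
  module

end MomentumForms

section FormDecomposition

variable {V : Type*} [NormedAddCommGroup V] [NormedSpace ℝ V]

theorem interior_single_succ (v : V) {p : ℕ} (γ : V [⋀^Fin (p + 1)]→L[ℝ] ℝ) :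
    interior v (Pi.single (p + 1) γ) = Pi.single p (γ.curryLeft v) := by
  funext m
  rw [interior_eq_curryLeft]
  by_cases hm : m = p
  · subst hm
    rw [Pi.single_eq_same, Pi.single_eq_same]
  · rw [Pi.single_eq_of_ne hm, Pi.single_eq_of_ne (by lia)]
    rfl

theorem contract_ιMulti_cons_single {r p : ℕ} (v : V) (w : Fin r → V)
    (γ : V [⋀^Fin (p + 1)]→L[ℝ] ℝ) :
    contract (ExteriorAlgebra.ιMulti ℝ (r + 1) (Fin.cons v w)) (Pi.single (p + 1) γ) =
      contract (ExteriorAlgebra.ιMulti ℝ r w) (Pi.single p (γ.curryLeft v)) := by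
  rw [ExteriorAlgebra.ιMulti_succ_apply, contract_mul, contract_ι, Fin.cons_zero,
    interior_single_succ]
  rfl

/-- The exterior product of a linear form with an alternating form. -/
def wedgeForm (ε : V →L[ℝ] ℝ) (p : ℕ) : (V [⋀^Fin p]→L[ℝ] ℝ) →L[ℝ] (V [⋀^Fin (p + 1)]→L[ℝ] ℝ) :=
  (ContinuousAlternatingMap.alternatizeUncurryFinCLM ℝ V ℝ).comp
    (ContinuousLinearMap.smulRightL ℝ V (V [⋀^Fin p]→L[ℝ] ℝ) ε)

theorem curryLeft_wedgeForm (ε : V →L[ℝ] ℝ) (p : ℕ) (γ : V [⋀^Fin p]→L[ℝ] ℝ) (v : V) :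
    (wedgeForm ε p γ).curryLeft v = ε v • γ - gradedAlt (fun m => ε.smulRight
      (interior v (Pi.single p γ : GradedForms V) m)) p := by
  have h_interior := congrFun (interior_gradedAlt v fun m =>
    ε.smulRight ((Pi.single p γ : GradedForms V) m)) p
  rw [interior_eq_curryLeft, gradedAlt_succ_apply, Pi.sub_apply,
    ContinuousLinearMap.smulRight_apply, Pi.single_eq_same] at h_interior
  refine h_interior.trans (congrArg (ε v • γ - gradedAlt · p) ?_)
  funext m
  exact ContinuousLinearMap.ext fun w => map_smul (interiorCLM v m) (ε w) _

variable [FiniteDimensional ℝ V] {ι : Type*} [Fintype ι] (b : Module.Basis ι ℝ V)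

theorem formDerivation_id_eq_sum (α : GradedForms V) :
    formDerivation (ContinuousLinearMap.id ℝ V) α =
      ∑ a, gradedAlt fun m => (LinearMap.toContinuousLinearMap (b.coord a)).smulRight
        (interior (b a) α m) := by
  funext m
  rw [Finset.sum_apply]
  cases m with
  | zero => simp only [formDerivation, gradedAlt_zero_apply, Finset.sum_const_zero]
  | succ m =>
    have h_expand : (α (m + 1)).curryLeft.comp (ContinuousLinearMap.id ℝ V) =
        ∑ a, (LinearMap.toContinuousLinearMap (b.coord a)).smulRight (interior (b a) α m) := by
      ext1 w
      rw [ContinuousLinearMap.comp_id, sum_apply]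
      conv_lhs => rw [← b.sum_repr w, map_sum]
      exact Finset.sum_congr rfl fun a _ => map_smul _ _ _
    rw [formDerivation, gradedAlt_succ_apply, h_expand]
    exact map_sum (ContinuousAlternatingMap.alternatizeUncurryFinCLM ℝ V ℝ) _ _

theorem sum_curryLeft_wedgeForm (p : ℕ) (γ : V [⋀^Fin p]→L[ℝ] ℝ) :
    ∑ a, (wedgeForm (LinearMap.toContinuousLinearMap (b.coord a)) p γ).curryLeft (b a) =
      ((Fintype.card ι : ℝ) - p) • γ := by
  have h_degree : ∑ a, gradedAlt (fun m => (LinearMap.toContinuousLinearMap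
      (b.coord a)).smulRight (interior (b a) (Pi.single p γ : GradedForms V) m)) p = p • γ := by
    rw [← Finset.sum_apply, ← formDerivation_id_eq_sum, formDerivation_id, Pi.single_eq_same]
  have h_dual (a : ι) : LinearMap.toContinuousLinearMap (b.coord a) (b a) = 1 := by simp
  simp only [curryLeft_wedgeForm, Finset.sum_sub_distrib]
  rw [h_degree]
  simp only [h_dual, one_smul, Finset.sum_const, Finset.card_univ]
  rw [← Nat.cast_smul_eq_nsmul ℝ, ← Nat.cast_smul_eq_nsmul ℝ p, ← sub_smul]

/-- Iterating `γ = (1 / (dim V - p)) ∑ₐ b a ⌟ (εᵃ ∧ γ)`, with `ε` the basis dual to `b`. -/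
theorem exists_sum_contract_basis_eq (p r : ℕ) (h : p + r ≤ Fintype.card ι) :
    ∃ L : (Fin r → ι) → (V [⋀^Fin p]→L[ℝ] ℝ) →L[ℝ] (V [⋀^Fin (p + r)]→L[ℝ] ℝ),
      ∀ γ, ∑ J, contract (ExteriorAlgebra.ιMulti ℝ r fun i => b (J i))
        (Pi.single (p + r) (L J γ)) = (Pi.single p γ : GradedForms V) := by
  induction r with
  | zero => exact ⟨fun _ => ContinuousLinearMap.id ℝ _, fun γ => by simp⟩
  | succ r ih =>
    obtain ⟨L, hL⟩ := ih (by lia)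
    set c : ℝ := (Fintype.card ι : ℝ) - (p + r : ℕ)
    have hc : c ≠ 0 := (sub_pos.2 (Nat.cast_lt.2 (Nat.lt_of_succ_le h))).ne'
    let ε a := LinearMap.toContinuousLinearMap (b.coord a)
    refine ⟨fun J => c⁻¹ • (wedgeForm (ε (J 0)) (p + r)).comp (L (Fin.tail J)), fun γ => ?_⟩
    have h_cons (a : ι) (J : Fin r → ι) : (fun i => b ((Fin.cons a J : Fin (r + 1) → ι) i)) =
        Fin.cons (b a) fun i => b (J i) := Fin.comp_cons b a J
    have h_average (J : Fin r → ι) :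
        ∑ a, (Pi.single (p + r) ((c⁻¹ • wedgeForm (ε a) (p + r) (L J γ)).curryLeft (b a)) :
          GradedForms V) = Pi.single (p + r) (L J γ) := by
      calc _ = (Pi.single (p + r) (∑ a, (c⁻¹ • wedgeForm (ε a) (p + r) (L J γ)).curryLeft (b a)) :
            GradedForms V) :=
            (map_sum (LinearMap.single ℝ (fun m : ℕ => V [⋀^Fin m]→L[ℝ] ℝ) (p + r)) _ _).symm
        _ = Pi.single (p + r) (c⁻¹ • c • L J γ) := by
            rw [← sum_curryLeft_wedgeForm b, Finset.smul_sum]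
            rfl
        _ = Pi.single (p + r) (L J γ) := by rw [inv_smul_smul₀ hc]
    calc _ = ∑ J : Fin r → ι, ∑ a, contract (ExteriorAlgebra.ιMulti ℝ (r + 1)
            (Fin.cons (b a) fun i => b (J i)))
            (Pi.single (p + r + 1) (c⁻¹ • wedgeForm (ε a) (p + r) (L J γ)) : GradedForms V) := by
          rw [← (Fin.consEquiv fun _ => ι).sum_comp, Fintype.sum_prod_type_right]
          simp only [← h_cons]
          rfl
      _ = ∑ J, contract (ExteriorAlgebra.ιMulti ℝ r fun i => b (J i))
            (Pi.single (p + r) (L J γ)) := by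
          simp_rw [contract_ιMulti_cons_single, ← map_sum, h_average]
      _ = Pi.single p γ := hL γ

end FormDecomposition

section MultivectorGluing

variable {E H : Type*} [NormedAddCommGroup E] [NormedSpace ℝ E] [TopologicalSpace H]
  {I : ModelWithCorners ℝ E H} {M : Type*} [TopologicalSpace M] [ChartedSpace H M]
  [IsManifold I ∞ M] {E' H' : Type*} [NormedAddCommGroup E'] [NormedSpace ℝ E']
  [FiniteDimensional ℝ E'] [TopologicalSpace H'] {J : ModelWithCorners ℝ E' H'} {B : Type*}
  [TopologicalSpace B] [ChartedSpace H' B] [IsManifold J ∞ B] [T2Space B] [SigmaCompactSpace B]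

theorem exists_multivectorField_forall_mem_convex {l : ℕ} (proj : C^∞⟮I, M; J, B⟯)
    {C : ∀ x : M, Set (ExteriorAlgebra ℝ (TangentSpace I x))} (hC : ∀ x, Convex ℝ (C x))
    (h_local : ∀ y : B, ∃ X : MultivectorField I M, IsMultivectorField l X ∧
      ∀ᶠ x in Filter.comap proj (𝓝 y), X x ∈ C x) :
    ∃ X : MultivectorField I M, IsMultivectorField l X ∧ ∀ x, X x ∈ C x := by
  choose X hX h_mem using h_local
  choose U hU hU_open hU_self using fun y =>
    eventually_nhds_iff.1 (Filter.eventually_comap.1 (h_mem y))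
  obtain ⟨ρ, hρ⟩ := SmoothPartitionOfUnity.exists_isSubordinate J (s := univ) isClosed_univ U
    hU_open fun y _ => mem_iUnion.2 ⟨y, hU_self y⟩
  refine ⟨fun x => ∑ᶠ y, ρ y (proj x) • X y x, fun x => ?_, fun x => ?_⟩
  · obtain ⟨s, hs⟩ := ρ.toPartitionOfUnity.exists_finset_nhds (proj x)
    refine (IsMultivectorFieldAt.sum s fun y _ => .smul ((ρ y).comp proj)
      (hX y x)).congr_of_eventuallyEq ?_
    filter_upwards [proj.contMDiff.continuous.continuousAt.eventually hs] with x' hx'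
    rw [Finset.sum_apply]
    refine finsum_eq_sum_of_support_subset _ fun y hy => hx'.2 ?_
    exact left_ne_zero_of_smul (Function.mem_support.1 hy)
  · refine (hC x).finsum_mem (fun y => ρ.nonneg y _) (ρ.sum_eq_one (mem_univ _)) fun y hy => ?_
    exact hU y (proj x) (hρ y (subset_tsupport _ hy)) x rfl

end MultivectorGluing

section BumpExtension

variable {E H : Type*} [NormedAddCommGroup E] [NormedSpace ℝ E] [FiniteDimensional ℝ E]
  [TopologicalSpace H] {I : ModelWithCorners ℝ E H} {M : Type*} [TopologicalSpace M]
  [ChartedSpace H M] [IsManifold I ∞ M] [T2Space M]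

theorem exists_contMDiffSection_eventuallyEq {F : Type*} [NormedAddCommGroup F] [NormedSpace ℝ F]
    {W : M → Type*} [TopologicalSpace (TotalSpace F W)] [∀ x, AddCommGroup (W x)]
    [∀ x, Module ℝ (W x)] [∀ x, TopologicalSpace (W x)] [FiberBundle F W] [VectorBundle ℝ F W]
    {x₀ : M} {s : ∀ x : M, W x}
    (hs : ContMDiffOn I (I.prod 𝓘(ℝ, F)) ∞ (fun x => TotalSpace.mk' F x (s x))
      (extChartAt I x₀).source) :
    ∃ σ : Cₛ^∞⟮I; F, W⟯, ∀ᶠ x in 𝓝 x₀, σ x = s x := by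
  obtain ⟨f⟩ : Nonempty (SmoothBumpFunction I x₀) := inferInstance
  refine ⟨⟨fun x => f x • s x, f.contMDiff.contMDiffOn.smul_section_of_tsupport
    (isOpen_extChartAt_source x₀) f.tsupport_subset_extChartAt_source hs⟩, ?_⟩
  filter_upwards [f.eventuallyEq_one] with x hx
  exact (congrArg (· • s x) hx).trans (one_smul ℝ (s x))

variable [I.Boundaryless]

theorem exists_vectorField_eventuallyEq (x₀ : M) (e : E) :
    ∃ ξ : VF I M, ∀ᶠ x in 𝓝 x₀, ξ x = ofChart I x₀ (extChartAt I x₀ x) e := by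
  refine exists_contMDiffSection_eventuallyEq (W := TangentSpace I) fun x hx =>
    ((contMDiffAt_vectorField_iff x₀ hx).2 ?_).contMDiffWithinAt
  refine (contDiffAt_const (c := e)).congr_of_eventuallyEq ?_
  filter_upwards [target_mem_nhds ((extChartAt I x₀).map_source hx)] with z hz
  simp only [chartVF]
  rw [(extChartAt I x₀).right_inv hz]
  exact congrArg (fun A : E →L[ℝ] E => A e) (toChart_comp_ofChart hz)

theorem exists_form_eventuallyEq (x₀ : M) {p : ℕ} {g : E → E [⋀^Fin p]→L[ℝ] ℝ}
    (hg : ∀ z ∈ (extChartAt I x₀).target, ContDiffAt ℝ ∞ g z) :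
    ∃ η : FormField I M, IsForm p η ∧ ∀ᶠ x in 𝓝 x₀, toModel (η x) =
      pullback (toChart I x₀ x) (Pi.single p (g (extChartAt I x₀ x)) : GradedForms E) := by
  let ζ : FormField I M := fun x => (Pi.single p
    ((g (extChartAt I x₀ x)).compContinuousLinearMap (toChart I x₀ x)) : GradedForms E)
  have h_same (x : M) : toModel (ζ x) p =
      (g (extChartAt I x₀ x)).compContinuousLinearMap (toChart I x₀ x) := Pi.single_eq_same _ _
  have h_chart (z : E) (hz : z ∈ (extChartAt I x₀).target) : chartForm x₀ p ζ z = g z :=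
    calc chartForm x₀ p ζ z
        = ((g z).compContinuousLinearMap (toChart I x₀ ((extChartAt I x₀).symm z))
            ).compContinuousLinearMap (ofChart I x₀ z) := by
          rw [chartForm, h_same, (extChartAt I x₀).right_inv hz]
      _ = g z := compContinuousLinearMap_toChart_ofChart hz _
  obtain ⟨σ, hσ⟩ := exists_contMDiffSection_eventuallyEq (I := I)
    (W := fun x : M => TangentSpace I x [⋀^Fin p]→L[ℝ] Bundle.Trivial M ℝ x) (x₀ := x₀)
    (s := fun x => ζ x p) fun x hx => by
      have hz := (extChartAt I x₀).map_source hx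
      exact ((contMDiffAt_form_iff x₀ hx).2 ((hg _ hz).congr_of_eventuallyEq
        (by filter_upwards [target_mem_nhds hz] using h_chart))).contMDiffWithinAt
  refine ⟨fun x => Pi.single p (σ x), ⟨fun x m hm => Pi.single_eq_of_ne hm _, ?_⟩, ?_⟩
  · simp only [Pi.single_eq_same]
    exact σ.contMDiff
  · filter_upwards [hσ] with x hx
    rw [pullback_single, ← h_same]
    exact congrArg (Pi.single p) hx

end BumpExtension

section LocalDecomposition

variable {E H : Type*} [NormedAddCommGroup E] [NormedSpace ℝ E]
  [TopologicalSpace H] {I : ModelWithCorners ℝ E H} [I.Boundaryless] {M : Type*}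
  [TopologicalSpace M] [ChartedSpace H M] [IsManifold I ∞ M]

theorem pullback_toChart_chartForm {p : ℕ} {γ : FormField I M} (hγ : IsForm p γ) {x₀ x : M}
    (hx : x ∈ (extChartAt I x₀).source) :
    pullback (toChart I x₀ x) (Pi.single p (chartForm x₀ p γ (extChartAt I x₀ x)) :
      GradedForms E) = toModel (γ x) := by
  have h_form : (chartForm x₀ p γ (extChartAt I x₀ x)).compContinuousLinearMap (toChart I x₀ x) =
      toModel (γ x) p := by
    ext w
    rw [chartForm, (extChartAt I x₀).left_inv hx]
    exact congrArg (toModel (γ x) p) (funext fun i => congrArg (fun A : E →L[ℝ] E => A (w i))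
      (ofChart_comp_toChart_of_mem_source hx))
  rw [pullback_single, h_form]
  funext m
  by_cases hm : m = p
  · subst hm
    exact Pi.single_eq_same _ _
  · exact (Pi.single_eq_of_ne hm _).trans (hγ.1 _ _ hm).symm

variable [FiniteDimensional ℝ E] [T2Space M]

theorem exists_sum_contract_eventuallyEq {p r : ℕ} (h : p + r ≤ Module.finrank ℝ E)
    {γ : FormField I M} (hγ : IsForm p γ) (x₀ : M) :
    ∃ (ξ : Fin (Module.finrank ℝ E) → VF I M)
      (η : (Fin r → Fin (Module.finrank ℝ E)) → FormField I M), (∀ J, IsForm (p + r) (η J)) ∧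
      ∀ᶠ x in 𝓝 x₀, ∑ J, contract (evalAt x (ExteriorAlgebra.ιMulti ℝ r fun i => ξ (J i)))
        (η J x) = γ x := by
  let b := Module.finBasis ℝ E
  obtain ⟨L, hL⟩ := exists_sum_contract_basis_eq b p r (by simpa using h)
  choose ξ hξ using fun a => exists_vectorField_eventuallyEq (I := I) x₀ (b a)
  choose η hη hη_chart using fun J => exists_form_eventuallyEq (I := I) x₀
    (g := fun z => L J (chartForm x₀ p γ z)) fun z hz =>
      (L J).contDiff.contDiffAt.comp z (hγ.contDiffAt_chartForm hz p)
  refine ⟨ξ, η, hη, ?_⟩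
  filter_upwards [Filter.eventually_all.2 hξ, Filter.eventually_all.2 hη_chart,
    extChartAt_source_mem_nhds (I := I) x₀] with x hξ hη hx
  let v (a : Fin (Module.finrank ℝ E)) : E := ξ a x
  have h_basis (a) : toChart I x₀ x (v a) = b a := by
    change toChart I x₀ x (ξ a x) = b a
    rw [hξ]
    exact congrArg (fun A : E →L[ℝ] E => A (b a)) (toChart_comp_ofChart_of_mem_source hx)
  have h_term (J : Fin r → Fin (Module.finrank ℝ E)) :
      contract (evalAt x (ExteriorAlgebra.ιMulti ℝ r fun i => ξ (J i))) (η J x) =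
      pullback (toChart I x₀ x) (contract (ExteriorAlgebra.ιMulti ℝ r fun i => b (J i))
        (Pi.single (p + r) (L J (chartForm x₀ p γ (extChartAt I x₀ x))) : GradedForms E)) := by
    have h_map : ExteriorAlgebra.map (toChart I x₀ x : E →ₗ[ℝ] E)
        (ExteriorAlgebra.ιMulti ℝ r fun i => v (J i)) =
        ExteriorAlgebra.ιMulti ℝ r fun i => b (J i) := by
      rw [ExteriorAlgebra.map_apply_ιMulti]
      exact congrArg _ (funext fun i => h_basis (J i))
    rw [evalAt, ExteriorAlgebra.map_apply_ιMulti, ← h_map]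
    exact (congrArg (contract (ExteriorAlgebra.ιMulti ℝ r fun i => v (J i))) (hη J)).trans
      (contract_pullback _ _ _)
  calc toModel (∑ J, contract (evalAt x (ExteriorAlgebra.ιMulti ℝ r fun i => ξ (J i))) (η J x))
      = pullback (toChart I x₀ x) (∑ J, contract (ExteriorAlgebra.ιMulti ℝ r fun i => b (J i))
        (Pi.single (p + r) (L J (chartForm x₀ p γ (extChartAt I x₀ x))) : GradedForms E)) := by
        rw [map_sum]
        exact Finset.sum_congr rfl fun J _ => h_term J
    _ = toModel (γ x) := by
        rw [hL]
        exact pullback_toChart_chartForm hγ hx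

end LocalDecomposition

section PositionForms

theorem convex_setOf_contract_eq {V : Type*} [AddCommGroup V] [Module ℝ V] [TopologicalSpace V]
    (α β : GradedForms V) : Convex ℝ {X : ExteriorAlgebra ℝ V | contract X α = β} := by
  intro X hX Y hY a b _ _ hab
  rw [mem_ofPred_eq] at *
  rw [contract_add, contract_smul, contract_smul, hX, hY, ← add_smul, hab, one_smul]

variable {E N : Type*} [NormedAddCommGroup E] [NormedSpace ℝ E] [TopologicalSpace N]
  [ChartedSpace E N] [IsManifold 𝓘(ℝ, E) ∞ N] {k : ℕ}

theorem contractField_omega_of_isHamiltonianField_positionForm {i p : ℕ}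
    {α : FormField 𝓘(ℝ, E) N} (hα : IsForm p α)
    {X : MultivectorField (phaseModel E k) (PhaseSpace E N k)}
    (hX : IsHamiltonianField (omega E N k) i (positionForm k α) X) :
    contractField X (omega E N k) = -positionForm k (extD α) := by
  rw [← extD_positionForm hα, hX.2, neg_neg]

variable [CompleteSpace E]

/-- The field `η^v ∧ Y^♯` on the phase space, where `η^v` is the vertical lift of the degree `k`
component of `η`. The vertical factor makes it annihilate the forms pulled back from the base, while
its contraction with `dθ` is the pullback of `Y ⌟ η`. -/
def verticalWedgeCompleteLift (η : FormField 𝓘(ℝ, E) N) (Y : ExteriorAlgebra ℝ (VF 𝓘(ℝ, E) N)) :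
    MultivectorField (phaseModel E k) (PhaseSpace E N k) :=
  fun μ => ExteriorAlgebra.ι ℝ (verticalAt μ (toModel (η μ.1) k)) * completeLift k Y μ

theorem contract_verticalWedgeCompleteLift_pullback (η : FormField 𝓘(ℝ, E) N)
    (Y : ExteriorAlgebra ℝ (VF 𝓘(ℝ, E) N)) (μ : PhaseSpace E N k)
    (γ : GradedForms (TangentSpace 𝓘(ℝ, E) μ.1)) :
    contract (verticalWedgeCompleteLift η Y μ) (pullback (dproj μ) γ) = 0 := by
  rw [verticalWedgeCompleteLift, contract_mul, contract_ι, interior_pullback, dproj_verticalAt,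
    map_zero, LinearMap.zero_apply, map_zero, map_zero]

theorem isMultivectorField_verticalWedgeCompleteLift (hk : 1 ≤ k) {η : FormField 𝓘(ℝ, E) N}
    (hη : IsForm k η) {r : ℕ} (ξ : Fin r → VF 𝓘(ℝ, E) N) :
    IsMultivectorField (r + 1) (verticalWedgeCompleteLift (k := k) η
      (ExteriorAlgebra.ιMulti ℝ r ξ)) := by
  let V : Fin (r + 1) → VF (phaseModel E k) (PhaseSpace E N k) :=
    Fin.cons (verticalLift hη) fun i => completeLiftVF hk (ξ i)
  refine fun μ => (isMultivectorFieldAt_ιMulti V).congr_of_eventuallyEq (.of_forall fun ν => ?_)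
  rw [verticalWedgeCompleteLift, completeLift, ExteriorAlgebra.map_apply_ιMulti]
  exact (ExteriorAlgebra.ιMulti_succ_apply fun j => V j ν).symm

theorem contract_verticalWedgeCompleteLift_extD_theta {η : FormField 𝓘(ℝ, E) N} (hη : IsForm k η)
    (Y : ExteriorAlgebra ℝ (VF 𝓘(ℝ, E) N)) (μ : PhaseSpace E N k) :
    contract (verticalWedgeCompleteLift η Y μ) (extD (theta E N k) μ) =
      pullback (dproj μ) (contract (evalAt μ.1 Y) (η μ.1)) := by
  rw [verticalWedgeCompleteLift, contract_mul, contract_ι, interior_verticalAt_of_isForm hη]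
  exact contract_completeLift_pullback μ Y _

variable [FiniteDimensional ℝ E] [T2Space N] [SecondCountableTopology N]

theorem exists_multivectorField_contractField_eq (hk : 1 ≤ k) {p r : ℕ} (hpr : p + r = k)
    (hkn : k ≤ Module.finrank ℝ E) {γ : FormField 𝓘(ℝ, E) N} (hγ : IsForm p γ) :
    ∃ X : MultivectorField (phaseModel E k) (PhaseSpace E N k), IsMultivectorField (r + 1) X ∧
      (∀ β, contractField X (positionForm k β) = 0) ∧
      contractField X (extD (theta E N k)) = positionForm k γ := by
  have : LocallyCompactSpace N := ChartedSpace.locallyCompactSpace E N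
  let proj : C^∞⟮phaseModel E k, PhaseSpace E N k; 𝓘(ℝ, E), N⟯ := ⟨TotalSpace.proj, contMDiff_proj
    (fun x : N => TangentSpace 𝓘(ℝ, E) x [⋀^Fin k]→L[ℝ] Bundle.Trivial N ℝ x)⟩
  let C (μ : PhaseSpace E N k) : Set (ExteriorAlgebra ℝ (TangentSpace (phaseModel E k) μ)) :=
    (⋂ β, {X | contract X (positionForm k β μ) = 0}) ∩
      {X | contract X (extD (theta E N k) μ) = positionForm k γ μ}
  have h_convex (μ) : Convex ℝ (C μ) := (convex_iInter fun _ =>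
    convex_setOf_contract_eq _ _).inter (convex_setOf_contract_eq _ _)
  obtain ⟨X, hX, h_mem⟩ := exists_multivectorField_forall_mem_convex (l := r + 1) proj h_convex
    fun x₀ => by
      obtain ⟨ξ, η, hη, h_sum⟩ := exists_sum_contract_eventuallyEq (hpr.trans_le hkn) hγ x₀
      subst hpr
      refine ⟨∑ J, verticalWedgeCompleteLift (η J) (ExteriorAlgebra.ιMulti ℝ r fun i => ξ (J i)),
        fun μ => IsMultivectorFieldAt.sum _ fun J _ =>
           isMultivectorField_verticalWedgeCompleteLift hk (hη J) _ μ,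
        Filter.eventually_comap.2 ?_⟩
      filter_upwards [h_sum] with x h_sum
      rintro μ (rfl : μ.1 = x)
      refine ⟨mem_iInter.2 fun β => ?_, ?_⟩
      · rw [mem_ofPred_eq, Finset.sum_apply, contract_sum]
        exact Finset.sum_eq_zero fun J _ => contract_verticalWedgeCompleteLift_pullback _ _ _ _
      · rw [mem_ofPred_eq, Finset.sum_apply, contract_sum, positionForm, ← h_sum, map_sum]
        exact Finset.sum_congr rfl fun J _ =>
          contract_verticalWedgeCompleteLift_extD_theta (hη J) _ μ
  exact ⟨X, hX, fun β => funext fun μ => mem_iInter.1 (h_mem μ).1 β, funext fun μ => (h_mem μ).2⟩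

theorem exists_hamiltonianField_positionForm (hkn : k ≤ Module.finrank ℝ E) {i : ℕ} (hi : 1 ≤ i)
    (hik : i ≤ k) {α : FormField 𝓘(ℝ, E) N} (hα : IsForm (k - i) α) :
    ∃ X, IsHamiltonianField (omega E N k) i (positionForm k α) X ∧
      ∀ β, contractField X (positionForm k β) = 0 := by
  obtain ⟨X, hX, h_base, h_theta⟩ := exists_multivectorField_contractField_eq (hi.trans hik)
    (show k - i + 1 + (i - 1) = k by lia) hkn hα.extD
  rw [Nat.sub_add_cancel hi] at hX
  refine ⟨X, ⟨hX, ?_⟩, h_base⟩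
  rw [extD_positionForm hα, omega, contractField_neg_right, neg_neg, h_theta]

theorem hamBracket_positionForm (hkn : k ≤ Module.finrank ℝ E) {i j : ℕ} (hi : 1 ≤ i)
    (hik : i ≤ k) (hj : 1 ≤ j) (hjk : j ≤ k) {α β : FormField 𝓘(ℝ, E) N}
    (hα : IsForm (k - i) α) (hβ : IsForm (k - j) β) :
    hamBracket (omega E N k) i j (positionForm k α) (positionForm k β) = 0 := by
  obtain ⟨X, hX, -⟩ := exists_hamiltonianField_positionForm hkn hi hik hα
  obtain ⟨Y, hY, hY_base⟩ := exists_hamiltonianField_positionForm hkn hj hjk hβ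
  rw [hamBracket_eq hX hY, contractField_omega_of_isHamiltonianField_positionForm hα hX,
    contractField_neg_right, hY_base, neg_zero, smul_zero]

theorem hamBracket_positionForm_momentumForm (hkn : k ≤ Module.finrank ℝ E) {i j : ℕ}
    (hi : 1 ≤ i) (hik : i ≤ k) {α : FormField 𝓘(ℝ, E) N} (hα : IsForm (k - i) α)
    {Y : ExteriorAlgebra ℝ (VF 𝓘(ℝ, E) N)} (hY : Y ∈ lieKernel 𝓘(ℝ, E) N j) :
    hamBracket (omega E N k) i j (positionForm k α) (momentumForm k j Y) =
      ((-1 : ℝ) ^ j * zeta j) •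
        positionForm k (contractField (toMultivectorField Y) (extD α)) := by
  obtain ⟨X, hX, -⟩ := exists_hamiltonianField_positionForm hkn hi hik hα
  have h_lift : contractField (completeLift k Y) (positionForm k (extD α)) =
      positionForm k (contractField (toMultivectorField Y) (extD α)) :=
    funext fun μ => contract_completeLift_pullback μ Y _
  rw [hamBracket_eq hX (isHamiltonianField_momentumForm (hi.trans hik) hY),
    contractField_omega_of_isHamiltonianField_positionForm hα hX,
    contractField_neg_right, contractField_smul_left, h_lift, pow_succ]
  module

end PositionForms

end MultiPhase

end

theorem mainTheorem11 {E : Type*} [NormedAddCommGroup E] [NormedSpace ℝ E] [FiniteDimensional ℝ E]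
    {N : Type*} [TopologicalSpace N] [ChartedSpace E N] [IsManifold 𝓘(ℝ, E) ∞ N] [T2Space N]
    [SecondCountableTopology N] (k : ℕ) (hk : 1 ≤ k) (hkn : k ≤ Module.finrank ℝ E) :
    -- momentum forms are Hamiltonian, with Hamiltonian multivector field `ζ(l) Y♯`
    (∀ l : ℕ, 1 ≤ l → l ≤ k → ∀ Y ∈ MultiPhase.lieKernel 𝓘(ℝ, E) N l,
      MultiPhase.IsHamiltonianForm (MultiPhase.omega E N k) k l (MultiPhase.momentumForm k l Y) ∧
      MultiPhase.IsHamiltonianField (MultiPhase.omega E N k) l (MultiPhase.momentumForm k l Y)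
        (MultiPhase.zeta l • MultiPhase.completeLift k Y)) ∧
    -- the bracket of two momentum forms
    (∀ s t : ℕ, 1 ≤ s → s ≤ k → 1 ≤ t → t ≤ k →
      ∀ Y₁ ∈ MultiPhase.lieKernel 𝓘(ℝ, E) N s, ∀ Y₂ ∈ MultiPhase.lieKernel 𝓘(ℝ, E) N t,
      MultiPhase.hamBracket (MultiPhase.omega E N k) s t
          (MultiPhase.momentumForm k s Y₁) (MultiPhase.momentumForm k t Y₂) =
        -(-1 : ℝ) ^ (t * s + s + t) •
            MultiPhase.momentumForm k (s + t - 1) (MultiPhase.schoutenVF Y₁ Y₂) +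
          ((-1 : ℝ) ^ (t * (s + 1)) * MultiPhase.zeta (s + 1) * MultiPhase.zeta (t + 1)) •
            MultiPhase.extD (MultiPhase.contractField (MultiPhase.completeLift k Y₁)
              (MultiPhase.contractField (MultiPhase.completeLift k Y₂)
                (MultiPhase.theta E N k)))) ∧
    -- position forms are Hamiltonian
    (∀ i : ℕ, 1 ≤ i → i ≤ k → ∀ α : MultiPhase.FormField 𝓘(ℝ, E) N, MultiPhase.IsForm (k - i) α →
      MultiPhase.IsHamiltonianForm (MultiPhase.omega E N k) k i
        (MultiPhase.positionForm k α)) ∧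
    -- the bracket of two position forms
    (∀ i j : ℕ, 1 ≤ i → i ≤ k → 1 ≤ j → j ≤ k →
      ∀ α β : MultiPhase.FormField 𝓘(ℝ, E) N, MultiPhase.IsForm (k - i) α →
        MultiPhase.IsForm (k - j) β →
      MultiPhase.hamBracket (MultiPhase.omega E N k) i j
        (MultiPhase.positionForm k α) (MultiPhase.positionForm k β) = 0) ∧
    -- the bracket of a position form and a momentum form
    (∀ i j : ℕ, 1 ≤ i → i ≤ k → 1 ≤ j → j ≤ k →
      ∀ α : MultiPhase.FormField 𝓘(ℝ, E) N, MultiPhase.IsForm (k - i) α →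
      ∀ Y ∈ MultiPhase.lieKernel 𝓘(ℝ, E) N j,
      MultiPhase.hamBracket (MultiPhase.omega E N k) i j
          (MultiPhase.positionForm k α) (MultiPhase.momentumForm k j Y) =
        ((-1 : ℝ) ^ j * MultiPhase.zeta j) •
          MultiPhase.positionForm k
            (MultiPhase.contractField (MultiPhase.toMultivectorField Y)
              (MultiPhase.extD α))) := by
  refine ⟨fun l _ hlk Y hY => ?_, fun s t hs _ _ _ Y₁ h₁ Y₂ h₂ =>
    MultiPhase.hamBracket_momentumForm hk hs h₁ h₂, fun i hi hik α hα => ?_,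
    fun i j hi hik hj hjk α β hα hβ =>
      MultiPhase.hamBracket_positionForm hkn hi hik hj hjk hα hβ,
    fun i j hi hik _ _ α hα Y hY =>
      MultiPhase.hamBracket_positionForm_momentumForm hkn hi hik hα hY⟩
  · have h := MultiPhase.isHamiltonianField_momentumForm hk hY
    exact ⟨⟨MultiPhase.isForm_momentumForm hlk hY.1, _, h⟩, h⟩
  · obtain ⟨X, hX, -⟩ := MultiPhase.exists_hamiltonianField_positionForm hkn hi hik hα
    exact ⟨MultiPhase.isForm_positionForm hα, X, hX⟩
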